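/- Let $d\ge 1$, let $w_1,w_2,\dots$ be standard Gaussian vectors in $\mathbb R^d$ and $\tau_1,\tau_2,\dots$ uniform on $[0,2\pi]$, all of them independent. Let $\gamma>0$ and let $u,v\in\mathbb R^d$ be unit vectors with $\rho=u^Tv$. Put $K=e^{-\gamma^2\|u-v\|^2/2}=e^{-\gamma^2(1-\rho)}$, $z_{u,i}=\cos(\gamma w_i^Tu+\tau_i)$ and $z_{v,i}=\cos(\gamma w_i^Tv+\tau_i)$. For $b\ge 1$, a $b$-bit quantizer $Q$ is given by borders $-1=t_0<\dots<t_{2^b}=1$ and real levels $\mu_1,\dots,\mu_{2^b}$, with $Q(x)=\mu_i$ for $t_{i-1}<x\le t_i$ (and $Q(-1)=\mu_1$). It is symmetric if $t_{2^b-i}=-t_i$ and $\mu_{2^b+1-i}=-\mu_i$ for all $i$. A $b$-bit LM-type quantizer is one of the following two kinds: (LM-RFF) a minimizer of $\int_{-1}^1 (z-Q(z))^2\frac{dz}{\pi\sqrt{1-z^2}}$ among all $b$-bit quantizers; or (LM$^2$-RFF) a symmetric $b$-bit quantizer with $\mu_i\ge 0$ for $i>2^{b-1}$ that minimizes $\int_{-1}^1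 (z^2-Q(z)^2)^2\frac{dz}{\pi\sqrt{1-z^2}}$ among all symmetric $b$-bit quantizers. Consider the simple and the normalized kernel estimator $$\hat K_Q=\frac2m\sum_{i=1}^m Q(z_{u,i})Q(z_{v,i}),\qquad \hat K_{n,Q}=\frac{\sum_{i=1}^m Q(z_{u,i})Q(z_{v,i})}{\sqrt{\sum_{i=1}^m Q(z_{u,i})^2}\sqrt{\sum_{i=1}^m Q(z_{v,i})^2}},$$ and, for an estimator $\hat K$ with $\mathbb E[\hat K]>0$, its debiased variance $Var^{db}[\hat K]=Var[\hat K]\,K^2/\mathbb E[\hat K]^2$. Theorem. Let $Q$ be any LM-type quantizer and assume $\gamma\le\pi/\sqrt2$. Then $Var^{db}[\hat K_{n,Q}]\le Var^{db}[\hat K_Q]$ as $m\to\infty$, for every $\rho\in[0,1]$. That is, for all such $u,v$ with $\rho\in[0,1]$: both estimators have positive mean and $Var^{db}[\hat K_{n,Q}]\le Var^{db}[\hat K_Q]$ for all sufficiently large $m$; moreover the limits $V_n=\lim_{m\to\infty} m\,Var^{db}[\hat K_{n,Q}]$ and $V_s=\lim_{m\to\infty} m\,Var^{db}[\hat K_Q]$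 exist and are finite, and $V_n\le V_s$. -/

import Mathlib

open MeasureTheory ProbabilityTheory Filter Topology

noncomputable section

namespace RFF

/-- A fixed (deterministic) scalar quantizer on `[-1, 1]` with `n` cells: borders
`-1 = t 0 < t 1 < ... < t n = 1` and one reconstruction level for each cell. -/
structure Quantizer (n : ℕ) where
  t : Fin (n + 1) → ℝ
  level : Fin n → ℝ
  t_strictMono : StrictMono t
  t_first : t 0 = -1
  t_last : t (Fin.last n) = 1

/-- The `i`-th cell `(t i, t (i+1)]`; the first cell also contains the end point `-1`. -/
def Quantizer.cell {n : ℕ} (Q : Quantizer n) (i : Fin n) : Set ℝ :=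
  {x | (Q.t i.castSucc < x ∨ (i.val = 0 ∧ x = -1)) ∧ x ≤ Q.t i.succ}

/-- The value `Q(x)`: the reconstruction level of the cell that contains `x ∈ [-1, 1]`. -/
def Quantizer.val {n : ℕ} (Q : Quantizer n) (x : ℝ) : ℝ :=
  ∑ i, (Q.cell i).indicator (fun _ => Q.level i) x

/-- The density `1 / (π √(1 - z²))` of the unscaled random Fourier feature on `[-1, 1]`. -/
def density (z : ℝ) : ℝ := 1 / (Real.pi * Real.sqrt (1 - z ^ 2))

/-- The distortion `∫ (z - Q(z))² f(z) dz`. -/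
def distortion {n : ℕ} (Q : Quantizer n) : ℝ :=
  ∫ z in Set.Icc (-1 : ℝ) 1, (z - Q.val z) ^ 2 * density z

/-- The distortion `∫ (z² - Q(z)²)² f(z) dz`. -/
def distortionSq {n : ℕ} (Q : Quantizer n) : ℝ :=
  ∫ z in Set.Icc (-1 : ℝ) 1, (z ^ 2 - Q.val z ^ 2) ^ 2 * density z

/-- `Q` is symmetric about `0`: borders and levels are both antisymmetric. -/
def Quantizer.IsSymmetric {n : ℕ} (Q : Quantizer n) : Prop :=
  (∀ i, Q.t i.rev = -Q.t i) ∧ ∀ i, Q.level i.rev = -Q.level i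

/-- A `b`-bit LM-RFF quantizer: a minimizer of the first distortion among all quantizers
with `2 ^ b` cells. -/
def IsLMRFF (b : ℕ) (Q : Quantizer (2 ^ b)) : Prop :=
  ∀ Q' : Quantizer (2 ^ b), distortion Q ≤ distortion Q'

/-- A `b`-bit LM²-RFF quantizer: symmetric about `0`, with nonnegative levels on the cells of
the positive half `[0, 1]`, and a minimizer of the second distortion among all quantizers with
`2 ^ b` cells that are symmetric about `0`. -/
def IsLMSqRFF (b : ℕ) (Q : Quantizer (2 ^ b)) : Prop :=
  Q.IsSymmetric ∧ (∀ i : Fin (2 ^ b), 2 ^ b ≤ 2 * i.val → 0 ≤ Q.level i) ∧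
    ∀ Q' : Quantizer (2 ^ b), Q'.IsSymmetric → distortionSq Q ≤ distortionSq Q'

/-- A `b`-bit LM-type quantizer, of either of the two kinds. -/
def IsLMType (b : ℕ) (Q : Quantizer (2 ^ b)) : Prop :=
  IsLMRFF b Q ∨ IsLMSqRFF b Q

/-- The Gaussian kernel `exp (-γ² ‖u - v‖² / 2)`; on the unit sphere it is
`exp (-γ² (1 - ρ))` with `ρ = ⟪u, v⟫`. -/
def kernel {d : ℕ} (γ : ℝ) (u v : EuclideanSpace ℝ (Fin d)) : ℝ :=
  Real.exp (-(γ ^ 2 * ‖u - v‖ ^ 2) / 2)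

/-- The random draws behind the features: the pairs `(w i, τ i)` are independent, `w i` is a
standard Gaussian vector, `τ i` is uniform on `[0, 2π]`, and `w i`, `τ i` are independent. -/
structure IsSample {Ω : Type*} [MeasurableSpace Ω] (P : Measure Ω) {d : ℕ}
    (w : ℕ → Ω → EuclideanSpace ℝ (Fin d)) (τ : ℕ → Ω → ℝ) : Prop where
  law_w : ∀ i, HasLaw (w i) (stdGaussian (EuclideanSpace ℝ (Fin d))) P
  law_τ : ∀ i, HasLaw (τ i) (ProbabilityTheory.cond volume (Set.Icc 0 (2 * Real.pi))) P
  indep_pair : ∀ i, IndepFun (w i) (τ i) P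
  indep : iIndepFun (fun i ω => (w i ω, τ i ω)) P

/-- The unscaled random Fourier feature `cos (γ wᵀu + τ)` of the data point `u`. -/
def feature {d : ℕ} (γ : ℝ) (w : EuclideanSpace ℝ (Fin d)) (τ : ℝ)
    (u : EuclideanSpace ℝ (Fin d)) : ℝ :=
  Real.cos (γ * inner ℝ w u + τ)

section Estimators

variable {Ω : Type*} {d n : ℕ}

/-- The simple quantized kernel estimator with `m` features. -/
def simpleEst (γ : ℝ) (w : ℕ → Ω → EuclideanSpace ℝ (Fin d)) (τ : ℕ → Ω → ℝ)
    (Q : Quantizer n) (u v : EuclideanSpace ℝ (Fin d)) (m : ℕ) (ω : Ω) : ℝ :=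
  2 / (m : ℝ) * ∑ i ∈ Finset.range m,
    Q.val (feature γ (w i ω) (τ i ω) u) * Q.val (feature γ (w i ω) (τ i ω) v)

/-- The normalized quantized kernel estimator with `m` features. -/
def normEst (γ : ℝ) (w : ℕ → Ω → EuclideanSpace ℝ (Fin d)) (τ : ℕ → Ω → ℝ)
    (Q : Quantizer n) (u v : EuclideanSpace ℝ (Fin d)) (m : ℕ) (ω : Ω) : ℝ :=
  (∑ i ∈ Finset.range m,
    Q.val (feature γ (w i ω) (τ i ω) u) * Q.val (feature γ (w i ω) (τ i ω) v)) /
  (Real.sqrt (∑ i ∈ Finset.range m, Q.val (feature γ (w i ω) (τ i ω) u) ^ 2) *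
    Real.sqrt (∑ i ∈ Finset.range m, Q.val (feature γ (w i ω) (τ i ω) v) ^ 2))

end Estimators

/-- The debiased variance `Var[X] · K² / E[X]²` of an estimator `X` of `K`
(meaningful when `E[X] > 0`). -/
def dbVariance {Ω : Type*} [MeasurableSpace Ω] (P : Measure Ω) (X : Ω → ℝ) (K : ℝ) : ℝ :=
  variance X P * K ^ 2 / (∫ ω, X ω ∂P) ^ 2

end RFF

end

/-! Write A, B for the quantized features of u, v on one draw, s = E[A²] = E[B²], c = E[AB], H = A²
+ B² - 2s, X = E[H AB], Y = E[H²]. The delta method, applied to the ratio of empirical means and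
controlled in L² by fourth moments, gives limits of m times the debiased variances that satisfy V_s
- V_n = (4sX - cY) K² / (4 s² c). So everything reduces to cY < 4sX; the strict form transfers from
the limits to every large m.

The joint law is handled by Fourier series. The phase of z_u is uniform on the circle and that of
z_v is the same phase shifted by an independent centred Gaussian, whose characteristic function at
the integer k is K^(k²). By Parseval, E[f(z_u) f(z_v)] is the sum of |f̂(k)|² K^(k²). Keeping only k
= ±1 bounds it below by 2K E[f(z) z]²; for centred f the estimate K^(k²) ≤ K bounds it above by K
E[f²].

X is not itself an autocorrelation, but by polarization 2X is the difference of the autocorrelations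
of f + (hf - k) and f - (hf - k), where f = Q, h = Q² - s and k = E[hf]. With x = E[h²], F =
E[h²f²], p = E[f z], q = E[h f z], the two bounds give 2X ≥ K(2(p + q)² - s + 2x - F). Since c ≤ Ks
and Y ≤ 4x, the one-dimensional condition s + F < 2(p + q)² suffices
(`normalized_moment_inequality`, `estimator_comparison`).

It remains to check this condition for optimal quantizers. For b ≥ 2, stationarity of the levels
(the centroid condition, for z or for z²) expresses or bounds every moment by the distortion, and an
explicit four-cell competitor makes the distortion small enough (`moment_condition_of_centroid`,
`moment_condition_of_centroidSq`). For b = 1 the square Q² is constant, and the two estimators are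
proportional. -/

namespace RFF

/-! ### Moments of sums of bounded independent variables -/

section Moments

/-- The partial sums `∑ i < m, φ (Y i)`. -/
noncomputable def partialSum {Ω S : Type*} (Y : ℕ → Ω → S) (φ : S → ℝ) (m : ℕ) (ω : Ω) : ℝ :=
  ∑ i ∈ Finset.range m, φ (Y i ω)

lemma abs_partialSum_le {Ω S : Type*} (Y : ℕ → Ω → S) {φ : S → ℝ} {C : ℝ} (hC : ∀ x, |φ x| ≤ C)
    (m : ℕ) (ω : Ω) : |partialSum Y φ m ω| ≤ m * C := by
  refine (Finset.abs_sum_le_sum_abs _ _).trans ?_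
  refine (Finset.sum_le_card_nsmul _ _ C fun i _ => hC _).trans ?_
  simp

variable {Ω S : Type*} [MeasurableSpace Ω] [MeasurableSpace S] {P : Measure Ω} {μ : Measure S}

lemma integrable_of_abs_le [IsFiniteMeasure P] {f : Ω → ℝ} (hf : AEMeasurable f P) {C : ℝ}
    (hC : ∀ ω, |f ω| ≤ C) : Integrable f P :=
  Integrable.of_bound hf.aestronglyMeasurable C (ae_of_all _ fun ω => by simpa using hC ω)

lemma aemeasurable_partialSum {Y : ℕ → Ω → S} (hY : ∀ i, HasLaw (Y i) μ P) {φ : S → ℝ}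
    (hφ : Measurable φ) (m : ℕ) : AEMeasurable (partialSum Y φ m) P := by
  unfold partialSum
  exact Finset.aemeasurable_fun_sum _ fun i _ => hφ.comp_aemeasurable (hY i).aemeasurable

lemma integral_comp_of_hasLaw {X : Ω → S} (hX : HasLaw X μ P) {φ : S → ℝ} (hφ : Measurable φ) :
    ∫ ω, φ (X ω) ∂P = ∫ x, φ x ∂μ :=
  hX.integral_comp hφ.aestronglyMeasurable

lemma indepFun_partialSum {Y : ℕ → Ω → S} (hY : ∀ i, HasLaw (Y i) μ P) (hind : iIndepFun Y P)
    {φ : S → ℝ} (hφ : Measurable φ) (m : ℕ) :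
    IndepFun (partialSum Y φ m) (fun ω => φ (Y m ω)) P := by
  have h := (hind.comp (fun _ => φ) (fun _ => hφ)).indepFun_finsetSum_of_notMem₀
    (fun i => hφ.comp_aemeasurable (hY i).aemeasurable) (s := Finset.range m) (i := m) (by simp)
  have e : (∑ j ∈ Finset.range m, φ ∘ Y j) = partialSum Y φ m := by
    ext ω; simp [partialSum]
  rw [e] at h
  exact h

lemma integral_partialSum_pow_mul_pow [IsProbabilityMeasure P] {Y : ℕ → Ω → S}
    (hY : ∀ i, HasLaw (Y i) μ P) (hind : iIndepFun Y P)
    {φ : S → ℝ} (hφ : Measurable φ) (m k l : ℕ) :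
    ∫ ω, partialSum Y φ m ω ^ k * φ (Y m ω) ^ l ∂P =
      (∫ ω, partialSum Y φ m ω ^ k ∂P) * ∫ x, φ x ^ l ∂μ := by
  rw [← integral_comp_of_hasLaw (hY m) (hφ.pow_const l)]
  exact (indepFun_partialSum hY hind hφ m).integral_fun_comp_mul_comp
    (f := fun x : ℝ => x ^ k) (g := fun x : ℝ => x ^ l)
    (aemeasurable_partialSum hY hφ m) (hφ.comp_aemeasurable (hY m).aemeasurable)
    (by fun_prop) (by fun_prop)

lemma integrable_partialSum_pow_mul_pow [IsProbabilityMeasure P] {Y : ℕ → Ω → S}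
    (hY : ∀ i, HasLaw (Y i) μ P) {φ : S → ℝ} (hφ : Measurable φ) {C : ℝ} (hC : ∀ x, |φ x| ≤ C)
    (m k l : ℕ) : Integrable (fun ω => partialSum Y φ m ω ^ k * φ (Y m ω) ^ l) P := by
  refine integrable_of_abs_le (C := (m * C) ^ k * C ^ l) ?_ fun ω => ?_
  · exact ((aemeasurable_partialSum hY hφ m).pow_const k).mul
      ((hφ.comp_aemeasurable (hY m).aemeasurable).pow_const l)
  · have h1 := abs_partialSum_le Y hC m ω
    have h2 := hC (Y m ω)
    have h3 : 0 ≤ C := (abs_nonneg _).trans h2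
    rw [abs_mul, abs_pow, abs_pow]
    gcongr

lemma integral_partialSum [IsProbabilityMeasure P] [IsProbabilityMeasure μ] {Y : ℕ → Ω → S}
    (hY : ∀ i, HasLaw (Y i) μ P) {φ : S → ℝ} (hφ : Measurable φ) {C : ℝ} (hC : ∀ x, |φ x| ≤ C)
    (m : ℕ) : ∫ ω, partialSum Y φ m ω ∂P = m * ∫ x, φ x ∂μ := by
  unfold partialSum
  rw [integral_finsetSum]
  · simp [integral_comp_of_hasLaw (hY _) hφ]
  · exact fun i _ => integrable_of_abs_le (hφ.comp_aemeasurable (hY i).aemeasurable)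
      fun ω => hC _

lemma integral_partialSum_succ_pow [IsProbabilityMeasure P] {Y : ℕ → Ω → S}
    (hY : ∀ i, HasLaw (Y i) μ P) (hind : iIndepFun Y P)
    {φ : S → ℝ} (hφ : Measurable φ) {C : ℝ} (hC : ∀ x, |φ x| ≤ C) (m n : ℕ) :
    ∫ ω, partialSum Y φ (m + 1) ω ^ n ∂P = ∑ k ∈ Finset.range (n + 1),
      (∫ ω, partialSum Y φ m ω ^ k ∂P) * (∫ x, φ x ^ (n - k) ∂μ) * (n.choose k : ℝ) := by
  have e : ∀ ω, partialSum Y φ (m + 1) ω ^ n = ∑ k ∈ Finset.range (n + 1),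
      partialSum Y φ m ω ^ k * φ (Y m ω) ^ (n - k) * (n.choose k : ℝ) := by
    intro ω
    rw [← add_pow, partialSum, Finset.sum_range_succ, partialSum]
  simp_rw [e]
  rw [integral_finsetSum]
  · refine Finset.sum_congr rfl fun k _ => ?_
    rw [integral_mul_const, integral_partialSum_pow_mul_pow hY hind hφ]
  · exact fun k _ => (integrable_partialSum_pow_mul_pow hY hφ hC m _ _).mul_const _

lemma integral_partialSum_sq [IsProbabilityMeasure P] [IsProbabilityMeasure μ] {Y : ℕ → Ω → S}
    (hY : ∀ i, HasLaw (Y i) μ P) (hind : iIndepFun Y P)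
    {φ : S → ℝ} (hφ : Measurable φ) {C : ℝ} (hC : ∀ x, |φ x| ≤ C) (h0 : ∫ x, φ x ∂μ = 0)
    (m : ℕ) : ∫ ω, partialSum Y φ m ω ^ 2 ∂P = m * ∫ x, φ x ^ 2 ∂μ := by
  induction m with
  | zero => simp [partialSum]
  | succ m ih =>
    rw [integral_partialSum_succ_pow hY hind hφ hC]
    simp [Finset.sum_range_succ, h0, ih]
    ring

/-- In the binomial expansion the odd cross terms vanish by centring, so one step adds at most 6mC⁴
+ C⁴, which is below the increment 3C⁴((m + 1)² - m²) = 6mC⁴ + 3C⁴. -/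
lemma integral_partialSum_pow_four_le [IsProbabilityMeasure P] [IsProbabilityMeasure μ]
    {Y : ℕ → Ω → S} (hY : ∀ i, HasLaw (Y i) μ P) (hind : iIndepFun Y P)
    {φ : S → ℝ} (hφ : Measurable φ) {C : ℝ} (hC : ∀ x, |φ x| ≤ C) (h0 : ∫ x, φ x ∂μ = 0)
    (m : ℕ) : ∫ ω, partialSum Y φ m ω ^ 4 ∂P ≤ 3 * C ^ 4 * m ^ 2 := by
  induction m with
  | zero => simp [partialSum]
  | succ m ih =>
    have hle : ∀ k : ℕ, ∫ x, φ x ^ (2 * k) ∂μ ≤ C ^ (2 * k) := by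
      intro k
      have : ∀ x, φ x ^ (2 * k) ≤ C ^ (2 * k) := fun x => by
        rw [pow_mul, pow_mul, ← sq_abs (φ x)]
        have := hC x
        gcongr
      have h2 := integral_mono (μ := μ) (f := fun x => φ x ^ (2 * k)) (g := fun _ => C ^ (2 * k))
        (integrable_of_abs_le (hφ.pow_const _).aemeasurable (C := C ^ (2 * k)) fun x => by
          rw [abs_of_nonneg (by rw [pow_mul]; positivity)]; exact this x)
        (integrable_const _) this
      simpa using h2
    rw [integral_partialSum_succ_pow hY hind hφ hC]
    simp only [Finset.sum_range_succ, Finset.sum_range_zero, pow_zero, integral_const,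
      probReal_univ, smul_eq_mul, mul_one, pow_one, integral_partialSum hY hφ hC, h0, mul_zero,
      zero_mul, integral_partialSum_sq hY hind hφ hC h0]
    have h2 := hle 1
    have h4 := hle 2
    have h22 : 0 ≤ ∫ x, φ x ^ 2 ∂μ := integral_nonneg fun x => sq_nonneg _
    norm_num [Nat.choose, h0] at h2 h4 ⊢
    have : (m : ℝ) * (∫ x, φ x ^ 2 ∂μ) * ∫ x, φ x ^ 2 ∂μ ≤ m * C ^ 2 * C ^ 2 := by gcongr
    have hC4 : 0 ≤ C ^ 4 := by positivity
    nlinarith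

end Moments

/-! ### Taylor remainder of the ratio A / √(ST) -/

lemma abs_linear_le {r σ τ : ℝ} (α : ℝ) (hr : |r| ≤ 1) :
    |α - r * (σ + τ) / 2| ≤ |α| + (|σ| + |τ|) / 2 := by
  have h1 : |r * (σ + τ) / 2| ≤ (|σ| + |τ|) / 2 := by
    rw [abs_div, abs_mul, abs_two]
    have := abs_add_le σ τ
    have : |r| * |σ + τ| ≤ 1 * (|σ| + |τ|) := by gcongr
    linarith
  exact (abs_sub _ _).trans (by linarith)

/-- The gap between the two means, multiplied by their sum, equals (S - T)² / 4, and that sum is at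
least s. -/
lemma abs_geomMean_sub_arithMean_le {s S T : ℝ} (hs : 0 < s) (hS : s / 2 ≤ S) (hT : s / 2 ≤ T) :
    |√S * √T - (S + T) / 2| ≤ ((S - s) ^ 2 + (T - s) ^ 2) / (2 * s) := by
  have hS0 : 0 ≤ S := by linarith
  have hT0 : 0 ≤ T := by linarith
  have hG2 : (√S * √T) ^ 2 = S * T := by rw [mul_pow, Real.sq_sqrt hS0, Real.sq_sqrt hT0]
  have hG0 : 0 ≤ √S * √T := by positivity
  set G := √S * √T
  have hGs : s / 2 ≤ G := by
    apply le_of_sq_le_sq _ hG0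
    rw [hG2]; nlinarith
  have hGle : G ≤ (S + T) / 2 := by
    apply le_of_sq_le_sq _ (by linarith)
    rw [hG2]; nlinarith [sq_nonneg (S - T)]
  rw [abs_of_nonpos (by linarith), le_div_iff₀ (by positivity)]
  have h1 : ((S + T) / 2 - G) * ((S + T) / 2 + G) = (S - T) ^ 2 / 4 := by
    linear_combination -hG2
  have h2 : ((S + T) / 2 - G) * s ≤ ((S + T) / 2 - G) * ((S + T) / 2 + G) :=
    mul_le_mul_of_nonneg_left (by linarith) (by linarith)
  nlinarith [sq_nonneg ((S - s) + (T - s))]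

/-- The geometric mean lies between min(S, T) and (S + T) / 2. -/
lemma abs_sub_geomMean_le {s S T : ℝ} (hs : 0 < s) (hS : s / 2 ≤ S) (hT : s / 2 ≤ T) :
    |s - √S * √T| ≤ |S - s| + |T - s| := by
  have hS0 : 0 ≤ S := by linarith
  have hT0 : 0 ≤ T := by linarith
  have hG2 : (√S * √T) ^ 2 = S * T := by rw [mul_pow, Real.sq_sqrt hS0, Real.sq_sqrt hT0]
  have hG0 : 0 ≤ √S * √T := by positivity
  set G := √S * √T
  have hGle : G ≤ (S + T) / 2 := by
    apply le_of_sq_le_sq _ (by linarith)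
    rw [hG2]; nlinarith [sq_nonneg (S - T)]
  have hσ1 := le_abs_self (S - s)
  have hτ1 := le_abs_self (T - s)
  have hσ2 := neg_abs_le (S - s)
  have hτ2 := neg_abs_le (T - s)
  have hσ0 := abs_nonneg (S - s)
  have hτ0 := abs_nonneg (T - s)
  rw [abs_le]
  constructor
  · linarith
  · by_contra hc
    push Not at hc
    have : G * G < S * T := mul_lt_mul'' (by linarith) (by linarith) hG0 hG0
    nlinarith

/-- Second-order remainder bound for `(A, S, T) ↦ A / √(S T)` at `(r s, s, s)`, near that point. -/
lemma abs_ratio_sub_linear_le_of_near {s r A S T : ℝ} (hs : 0 < s) (hr : |r| ≤ 1)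
    (hS : s / 2 ≤ S) (hT : s / 2 ≤ T) :
    |A / (√S * √T) - r - ((A - r * s) - r * ((S - s) + (T - s)) / 2) / s| ≤
      5 / s ^ 2 * ((A - r * s) ^ 2 + (S - s) ^ 2 + (T - s) ^ 2) := by
  have hS0 : 0 ≤ S := by linarith
  have hT0 : 0 ≤ T := by linarith
  have hE := abs_geomMean_sub_arithMean_le hs hS hT
  have hGs' := abs_sub_geomMean_le hs hS hT
  have hN := abs_linear_le (σ := S - s) (τ := T - s) (A - r * s) hr
  have hG2 : (√S * √T) ^ 2 = S * T := by rw [mul_pow, Real.sq_sqrt hS0, Real.sq_sqrt hT0]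
  have hG0 : 0 ≤ √S * √T := by positivity
  generalize √S * √T = G at *
  have hGs : s / 2 ≤ G := by
    apply le_of_sq_le_sq _ hG0
    rw [hG2]; nlinarith
  have hGpos : 0 < G := by linarith
  -- The remainder splits into the linear term N times the deviation of G from s, and the gap
  -- between arithmetic and geometric mean. Both are quadratic in the deviations; they contribute 4
  -- and 1 to the constant 5.
  have key : A / G - r - ((A - r * s) - r * ((S - s) + (T - s)) / 2) / s =
      ((A - r * s) - r * ((S - s) + (T - s)) / 2) * (s - G) / (G * s)
        - r * (G - (S + T) / 2) / G := by
    field_simp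
    ring
  rw [key]
  generalize (A - r * s) - r * ((S - s) + (T - s)) / 2 = N at *
  have hE2 : |G - (S + T) / 2| ≤ ((A - r * s) ^ 2 + (S - s) ^ 2 + (T - s) ^ 2) / (2 * s) := by
    refine hE.trans ?_
    gcongr
    linarith [sq_nonneg (A - r * s)]
  have hD : |A - r * s| ^ 2 + |S - s| ^ 2 + |T - s| ^ 2 =
      (A - r * s) ^ 2 + (S - s) ^ 2 + (T - s) ^ 2 := by simp
  rw [← hD] at hE2 ⊢
  have hα0 := abs_nonneg (A - r * s)
  have hσ0 := abs_nonneg (S - s)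
  have hτ0 := abs_nonneg (T - s)
  generalize |A - r * s| = α at *
  generalize |S - s| = σ at *
  generalize |T - s| = τ at *
  have hD0 : 0 ≤ α ^ 2 + σ ^ 2 + τ ^ 2 := by positivity
  have h2D : (α + (σ + τ) / 2) * (σ + τ) ≤ 2 * (α ^ 2 + σ ^ 2 + τ ^ 2) := by
    nlinarith [sq_nonneg (α - σ), sq_nonneg (α - τ), sq_nonneg (σ - τ)]
  generalize α ^ 2 + σ ^ 2 + τ ^ 2 = D at *
  have h1 : |N * (s - G) / (G * s)| ≤ 4 / s ^ 2 * D := by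
    rw [abs_div, abs_mul, abs_of_pos (by positivity : 0 < G * s), div_le_iff₀ (by positivity)]
    have : |N| * |s - G| ≤ (α + (σ + τ) / 2) * (σ + τ) := by gcongr
    have h3 : 4 / s ^ 2 * D * (s / 2 * s) ≤ 4 / s ^ 2 * D * (G * s) := by gcongr
    have h4 : 4 / s ^ 2 * D * (s / 2 * s) = 2 * D := by field_simp; ring
    linarith
  have h2 : |r * (G - (S + T) / 2) / G| ≤ 1 / s ^ 2 * D := by
    rw [abs_div, abs_mul, abs_of_pos hGpos, div_le_iff₀ hGpos]
    have : |r| * |G - (S + T) / 2| ≤ 1 * (D / (2 * s)) := by gcongr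
    have h3 : 1 / s ^ 2 * D * (s / 2) ≤ 1 / s ^ 2 * D * G := by gcongr
    have h4 : 1 / s ^ 2 * D * (s / 2) = D / (2 * s) := by field_simp
    linarith
  have h3 := abs_sub (N * (s - G) / (G * s)) (r * (G - (S + T) / 2) / G)
  have h4 : 5 / s ^ 2 * D = 4 / s ^ 2 * D + 1 / s ^ 2 * D := by ring
  linarith

/-- Second-order remainder bound for `(A, S, T) ↦ A / √(S T)` at `(r s, s, s)`. -/
lemma abs_ratio_sub_linear_le {s r A S T : ℝ} (hs : 0 < s) (hr : |r| ≤ 1)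
    (hR : |A / (√S * √T)| ≤ 1) :
    |A / (√S * √T) - r - ((A - r * s) - r * ((S - s) + (T - s)) / 2) / s| ≤
      15 / s ^ 2 * ((A - r * s) ^ 2 + (S - s) ^ 2 + (T - s) ^ 2) := by
  have hs2 : 0 < s ^ 2 := by positivity
  by_cases h : s / 2 ≤ S ∧ s / 2 ≤ T
  · refine (abs_ratio_sub_linear_le_of_near hs hr h.1 h.2).trans ?_
    gcongr
    norm_num
  -- Away from the base point the squared deviations D total at least s² / 4, while the ratio and r
  -- are at most 1 and |N| / s ≤ 3/2 + D / (2s²). Hence the remainder is at most 7/2 + D / (2s²) ≤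
  -- 14.5 D / s².
  · have hN := abs_linear_le (σ := S - s) (τ := T - s) (A - r * s) hr
    have hDs : s ^ 2 / 4 ≤ (A - r * s) ^ 2 + (S - s) ^ 2 + (T - s) ^ 2 := by
      rw [not_and_or] at h
      rcases h with h | h
      · have : s / 2 ≤ s - S := by linarith
        nlinarith [sq_nonneg (A - r * s), sq_nonneg (T - s)]
      · have : s / 2 ≤ s - T := by linarith
        nlinarith [sq_nonneg (A - r * s), sq_nonneg (S - s)]
    have hx : ∀ x : ℝ, |x| / s ≤ 1 / 2 + x ^ 2 / (2 * s ^ 2) := fun x => by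
      have : 1 / 2 + x ^ 2 / (2 * s ^ 2) - |x| / s = (1 - |x| / s) ^ 2 / 2 := by
        rw [← sq_abs x]; field_simp; ring
      nlinarith [sq_nonneg (1 - |x| / s)]
    have hα := hx (A - r * s)
    have hσ := hx (S - s)
    have hτ := hx (T - s)
    generalize (A - r * s) - r * ((S - s) + (T - s)) / 2 = N at *
    have h1 : |N / s| ≤ |A - r * s| / s + |S - s| / s + |T - s| / s := by
      rw [abs_div, abs_of_pos hs, ← add_div, ← add_div]
      gcongr
      linarith [abs_nonneg (S - s), abs_nonneg (T - s)]
    have h2 := abs_sub (A / (√S * √T) - r) (N / s)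
    have h3 := abs_sub (A / (√S * √T)) r
    have e : ((A - r * s) ^ 2 + (S - s) ^ 2 + (T - s) ^ 2) / s ^ 2 =
        2 * ((A - r * s) ^ 2 / (2 * s ^ 2) + (S - s) ^ 2 / (2 * s ^ 2)
          + (T - s) ^ 2 / (2 * s ^ 2)) := by ring
    have h6 : 1 / 4 ≤ ((A - r * s) ^ 2 + (S - s) ^ 2 + (T - s) ^ 2) / s ^ 2 := by
      rw [le_div_iff₀ hs2]; linarith
    have h4 : 15 / s ^ 2 * ((A - r * s) ^ 2 + (S - s) ^ 2 + (T - s) ^ 2) =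
      15 * (((A - r * s) ^ 2 + (S - s) ^ 2 + (T - s) ^ 2) / s ^ 2) := by ring
    linarith

/-! ### Mean and variance from an L² linearization -/

section Asymptotics

variable {Ω : Type*} [MeasurableSpace Ω] {P : Measure Ω} [IsProbabilityMeasure P]

/-- If `W m = r + L m + E m` with `L m` centred of variance `v / m` and `E m` of size `1 / m`
in `L²`, then the mean of `W m` tends to `r` and its variance is `v / m + o (1 / m)`. -/
lemma tendsto_mean_variance_of_linearization {W L : ℕ → Ω → ℝ} {r v C : ℝ}
    (hW : ∀ m, MemLp (W m) 2 P) (hL : ∀ m, MemLp (L m) 2 P)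
    (hL0 : ∀ m, ∫ ω, L m ω ∂P = 0) (hL2 : ∀ m : ℕ, 1 ≤ m → ∫ ω, L m ω ^ 2 ∂P = v / m)
    (hE : ∀ m : ℕ, 1 ≤ m → ∫ ω, (W m ω - r - L m ω) ^ 2 ∂P ≤ C / m ^ 2) :
    Tendsto (fun m => ∫ ω, W m ω ∂P) atTop (𝓝 r) ∧
      Tendsto (fun m : ℕ => (m : ℝ) * variance (W m) P) atTop (𝓝 v) := by
  set E : ℕ → Ω → ℝ := fun m ω => W m ω - r - L m ω with hEdef
  have hEm : ∀ m, MemLp (E m) 2 P := fun m => ((hW m).sub (memLp_const r)).sub (hL m)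
  have iE : ∀ m, Integrable (E m) P := fun m => (hEm m).integrable one_le_two
  have iL : ∀ m, Integrable (L m) P := fun m => (hL m).integrable one_le_two
  have iW : ∀ m, Integrable (W m) P := fun m => (hW m).integrable one_le_two
  have iE2 : ∀ m, Integrable (fun ω => E m ω ^ 2) P := fun m => (hEm m).integrable_sq
  have iL2 : ∀ m, Integrable (fun ω => L m ω ^ 2) P := fun m => (hL m).integrable_sq
  have iLE : ∀ m, Integrable (fun ω => L m ω * E m ω) P := fun m => (hL m).integrable_mul (hEm m)
  have hmean : ∀ m, ∫ ω, W m ω ∂P = r + ∫ ω, E m ω ∂P := by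
    intro m
    have : ∫ ω, E m ω ∂P = ∫ ω, W m ω ∂P - r - ∫ ω, L m ω ∂P := by
      simp only [hEdef]
      rw [integral_sub (f := fun ω => W m ω - r) ((iW m).sub (integrable_const r)) (iL m),
        integral_sub (iW m) (integrable_const r)]
      simp
    rw [this, hL0]; ring
  have hEsq : ∀ m, (∫ ω, E m ω ∂P) ^ 2 ≤ ∫ ω, E m ω ^ 2 ∂P := by
    intro m
    have h1 := variance_nonneg (E m) P
    rw [variance_eq_sub (hEm m)] at h1
    simp only [Pi.pow_apply] at h1
    linarith
  have hC : 0 ≤ C := by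
    have h1 := hE 1 le_rfl
    have h2 : 0 ≤ ∫ ω, (W 1 ω - r - L 1 ω) ^ 2 ∂P := integral_nonneg fun ω => sq_nonneg _
    simp at h1
    linarith
  have hv : 0 ≤ v := by
    have h1 := hL2 1 le_rfl
    have h2 : 0 ≤ ∫ ω, L 1 ω ^ 2 ∂P := integral_nonneg fun ω => sq_nonneg _
    simp at h1
    linarith
  have hinv : Tendsto (fun m : ℕ => 1 / (m : ℝ)) atTop (𝓝 0) := tendsto_one_div_atTop_nhds_zero_nat
  constructor
  · rw [tendsto_iff_dist_tendsto_zero]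
    have hb : Tendsto (fun m : ℕ => √C * (1 / (m : ℝ))) atTop (𝓝 0) := by
      simpa using hinv.const_mul (√C)
    refine squeeze_zero' (Eventually.of_forall fun _ => dist_nonneg) ?_ hb
    filter_upwards [eventually_ge_atTop 1] with m hm
    rw [Real.dist_eq, hmean, add_sub_cancel_left]
    have hm0 : (0 : ℝ) < m := by exact_mod_cast hm
    apply abs_le_of_sq_le_sq _ (by positivity)
    have := (hEsq m).trans (hE m hm)
    rw [mul_pow, Real.sq_sqrt hC]
    calc _ ≤ _ := this
      _ = _ := by field_simp
  · rw [tendsto_iff_dist_tendsto_zero]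
    have hsq : Tendsto (fun m : ℕ => √(1 / (m : ℝ))) atTop (𝓝 0) := by
      simpa [Function.comp_def] using (Real.continuous_sqrt.tendsto 0).comp hinv
    have hb : Tendsto (fun m : ℕ => (v + C) * √(1 / (m : ℝ)) + 2 * C * (1 / (m : ℝ)))
        atTop (𝓝 0) := by
      simpa using (hsq.const_mul (v + C)).add (hinv.const_mul (2 * C))
    refine squeeze_zero' (Eventually.of_forall fun _ => dist_nonneg) ?_ hb
    filter_upwards [eventually_ge_atTop 1] with m hm
    have hm0 : (0 : ℝ) < m := by exact_mod_cast hm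
    -- Weight for Young's inequality 2|LE| ≤ qL² + E²/q. With q² = 1/m both terms are of order q /
    -- m, so the cross term is o(1/m).
    set q := √(1 / (m : ℝ)) with hq
    have hq0 : 0 < q := by positivity
    have hq2 : q ^ 2 = 1 / m := Real.sq_sqrt (by positivity)
    have hvar : variance (W m) P = v / m + 2 * ∫ ω, L m ω * E m ω ∂P + ∫ ω, E m ω ^ 2 ∂P
        - (∫ ω, E m ω ∂P) ^ 2 := by
      have e1 : W m = fun ω => (L m ω + E m ω) + r := by ext ω; simp only [hEdef]; ring
      have hLE : MemLp (fun ω => L m ω + E m ω) 2 P := (hL m).add (hEm m)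
      rw [e1, variance_add_const hLE.aestronglyMeasurable, variance_eq_sub hLE]
      have e2 : (fun ω => L m ω + E m ω) ^ 2 =
          fun ω => L m ω ^ 2 + 2 * (L m ω * E m ω) + E m ω ^ 2 := by
        ext ω; simp only [Pi.pow_apply]; ring
      rw [e2, integral_add ((iL2 m).fun_add ((iLE m).const_mul 2)) (iE2 m),
        integral_add (iL2 m) ((iLE m).const_mul 2), integral_const_mul, hL2 m hm,
        integral_add (iL m) (iE m), hL0]
      ring
    have hcross : |2 * ∫ ω, L m ω * E m ω ∂P| ≤ q * (v / m) + C / m ^ 2 / q := by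
      have h1 : |2 * ∫ ω, L m ω * E m ω ∂P| ≤ ∫ ω, q * L m ω ^ 2 + E m ω ^ 2 / q ∂P := by
        rw [← integral_const_mul]
        refine (abs_integral_le_integral_abs).trans ?_
        refine integral_mono ((iLE m).const_mul 2).abs
          (((iL2 m).const_mul q).add ((iE2 m).div_const q)) fun ω => ?_
        dsimp only
        rw [abs_mul, abs_mul, abs_two, ← sq_abs (L m ω), ← sq_abs (E m ω)]
        have : q * |L m ω| ^ 2 + |E m ω| ^ 2 / q - 2 * (|L m ω| * |E m ω|)
            = (q * |L m ω| - |E m ω|) ^ 2 / q := by field_simp; ring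
        have h2 : 0 ≤ (q * |L m ω| - |E m ω|) ^ 2 / q := by positivity
        linarith
      rw [integral_add ((iL2 m).const_mul q) ((iE2 m).div_const q), integral_const_mul,
        integral_div, hL2 m hm] at h1
      have h3 : (∫ ω, E m ω ^ 2 ∂P) / q ≤ C / m ^ 2 / q := by
        gcongr; exact hE m hm
      linarith
    have h1 := hE m hm
    have h2 : 0 ≤ ∫ ω, E m ω ^ 2 ∂P := integral_nonneg fun ω => sq_nonneg _
    have h3 := (hEsq m).trans h1
    rw [Real.dist_eq, hvar]
    have e3 : (m : ℝ) * (v / m + 2 * ∫ ω, L m ω * E m ω ∂P + ∫ ω, E m ω ^ 2 ∂P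
        - (∫ ω, E m ω ∂P) ^ 2) - v = m * (2 * (∫ ω, L m ω * E m ω ∂P)
          + ((∫ ω, E m ω ^ 2 ∂P) - (∫ ω, E m ω ∂P) ^ 2)) := by
      field_simp; ring
    rw [e3, abs_mul, abs_of_pos hm0]
    have h4 : |(∫ ω, E m ω ^ 2 ∂P) - (∫ ω, E m ω ∂P) ^ 2| ≤ C / m ^ 2 := by
      rw [abs_le]
      have := sq_nonneg (∫ ω, E m ω ∂P)
      constructor <;> linarith [hEsq m]
    have h5 : |2 * (∫ ω, L m ω * E m ω ∂P) + ((∫ ω, E m ω ^ 2 ∂P) - (∫ ω, E m ω ∂P) ^ 2)| ≤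
        q * (v / m) + C / m ^ 2 / q + C / m ^ 2 := (abs_add_le _ _).trans (by linarith)
    have h6 : (m : ℝ) * (q * (v / m) + C / m ^ 2 / q + C / m ^ 2)
        = (v + C) * q + C * (1 / m) := by
      have : C / (m : ℝ) ^ 2 / q = C * q / m := by
        rw [div_div, div_eq_div_iff (by positivity) (by positivity)]
        have : (m : ℝ) * q ^ 2 = 1 := by rw [hq2]; field_simp
        linear_combination (-(C * m)) * this
      rw [this]; field_simp
    have h7 : 0 ≤ C * (1 / (m : ℝ)) := by positivity
    calc _ ≤ (m : ℝ) * (q * (v / m) + C / m ^ 2 / q + C / m ^ 2) := by gcongr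
      _ ≤ _ := by rw [h6]; linarith

end Asymptotics

/-! ### Delta method for the normalized and simple estimators -/

section Ratio

variable {Ω S : Type*} [MeasurableSpace Ω] [MeasurableSpace S] {P : Measure Ω} {μ : Measure S}
  [IsProbabilityMeasure P] [IsProbabilityMeasure μ]

lemma integral_mean_pow_four_le {Y : ℕ → Ω → S} (hY : ∀ i, HasLaw (Y i) μ P)
    (hind : iIndepFun Y P) {φ : S → ℝ} (hφ : Measurable φ) {C : ℝ} (hC : ∀ x, |φ x| ≤ C)
    (h0 : ∫ x, φ x ∂μ = 0) {m : ℕ} (hm : 1 ≤ m) :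
    ∫ ω, (partialSum Y φ m ω / m) ^ 4 ∂P ≤ 3 * C ^ 4 / m ^ 2 := by
  have hm0 : (0 : ℝ) < m := by exact_mod_cast hm
  simp_rw [div_pow]
  rw [integral_div, div_le_div_iff₀ (by positivity) (by positivity)]
  have := integral_partialSum_pow_four_le hY hind hφ hC h0 m
  calc _ ≤ (3 * C ^ 4 * (m : ℝ) ^ 2) * m ^ 2 := by gcongr
    _ = _ := by ring

lemma integrable_mean_pow_four {ν : Measure S} {Y : ℕ → Ω → S}
    (hY : ∀ i, HasLaw (Y i) ν P) {φ : S → ℝ} (hφ : Measurable φ) {C : ℝ} (hC : ∀ x, |φ x| ≤ C) (m : ℕ) :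
    Integrable (fun ω => (partialSum Y φ m ω / m) ^ 4) P := by
  have := (integrable_partialSum_pow_mul_pow (P := P) hY hφ hC m 4 0).div_const ((m : ℝ) ^ 4)
  simpa [div_pow] using this

lemma abs_sum_mul_div_le_one (s : Finset ℕ) (a b : ℕ → ℝ) :
    |(∑ i ∈ s, a i * b i) / (√(∑ i ∈ s, a i ^ 2) * √(∑ i ∈ s, b i ^ 2))| ≤ 1 := by
  rw [abs_div, abs_of_nonneg (by positivity :
    0 ≤ √(∑ i ∈ s, a i ^ 2) * √(∑ i ∈ s, b i ^ 2))]
  refine div_le_one_of_le₀ ?_ (by positivity)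
  rw [← Real.sqrt_mul (Finset.sum_nonneg fun i _ => sq_nonneg _)]
  exact Real.abs_le_sqrt (Finset.sum_mul_sq_le_sq_mul_sq _ _ _)

/-- The delta method for the cosine similarity of two bounded samples with equal second
moments. -/
theorem tendsto_normRatio {Y : ℕ → Ω → S} (hY : ∀ i, HasLaw (Y i) μ P)
    (hind : iIndepFun Y P) {f g : S → ℝ} (hf : Measurable f) (hg : Measurable g) {C : ℝ}
    (hfC : ∀ x, |f x| ≤ C) (hgC : ∀ x, |g x| ≤ C) {s : ℝ} (hs : 0 < s)
    (hfs : ∫ x, f x ^ 2 ∂μ = s) (hgs : ∫ x, g x ^ 2 ∂μ = s) {r : ℝ}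
    (hr : ∫ x, f x * g x ∂μ = r * s) {W : ℕ → Ω → ℝ}
    (hW : ∀ m ω, W m ω = (∑ i ∈ Finset.range m, f (Y i ω) * g (Y i ω)) /
      (√(∑ i ∈ Finset.range m, f (Y i ω) ^ 2) * √(∑ i ∈ Finset.range m, g (Y i ω) ^ 2))) :
    Tendsto (fun m => ∫ ω, W m ω ∂P) atTop (𝓝 r) ∧
      Tendsto (fun m : ℕ => (m : ℝ) * variance (W m) P) atTop
        (𝓝 (∫ x, ((f x * g x - r * (f x ^ 2 + g x ^ 2) / 2) / s) ^ 2 ∂μ)) := by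
  obtain ⟨x₀⟩ : Nonempty S := by
    by_contra h
    rw [not_nonempty_iff] at h
    exact IsProbabilityMeasure.ne_zero μ (Measure.eq_zero_of_isEmpty μ)
  have hC0 : 0 ≤ C := (abs_nonneg _).trans (hfC x₀)
  have bfg : ∀ x, |f x * g x| ≤ C ^ 2 := fun x => by
    rw [abs_mul, sq]; exact mul_le_mul (hfC x) (hgC x) (abs_nonneg _) hC0
  have bff : ∀ x, |f x ^ 2| ≤ C ^ 2 := fun x => by
    rw [abs_pow]; exact pow_le_pow_left₀ (abs_nonneg _) (hfC x) 2
  have bgg : ∀ x, |g x ^ 2| ≤ C ^ 2 := fun x => by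
    rw [abs_pow]; exact pow_le_pow_left₀ (abs_nonneg _) (hgC x) 2
  have ifg : Integrable (fun x => f x * g x) μ := integrable_of_abs_le (hf.mul hg).aemeasurable bfg
  have iff : Integrable (fun x => f x ^ 2) μ := integrable_of_abs_le (hf.pow_const 2).aemeasurable bff
  have igg : Integrable (fun x => g x ^ 2) μ := integrable_of_abs_le (hg.pow_const 2).aemeasurable bgg
  have hs_le : s ≤ C ^ 2 := by
    rw [← hfs]
    have := integral_mono iff (integrable_const (C ^ 2)) fun x => (le_abs_self _).trans (bff x)
    simpa using this
  have hr1 : |r| ≤ 1 := by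
    have h1 : |r * s| ≤ s := by
      rw [← hr]
      refine abs_integral_le_integral_abs.trans ?_
      have h2 : ∫ x, |f x * g x| ∂μ ≤ ∫ x, (f x ^ 2 + g x ^ 2) / 2 ∂μ := by
        refine integral_mono ifg.abs ((iff.fun_add igg).div_const 2) fun x => ?_
        dsimp only
        rw [abs_mul, ← sq_abs (f x), ← sq_abs (g x)]
        nlinarith [sq_nonneg (|f x| - |g x|)]
      rw [integral_div, integral_add iff igg, hfs, hgs] at h2
      linarith
    rw [abs_mul, abs_of_pos hs] at h1
    exact le_of_mul_le_mul_right (by linarith) hs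
  -- the centred summands
  set φ₁ : S → ℝ := fun x => f x * g x - r * s with hφ₁
  set φ₂ : S → ℝ := fun x => f x ^ 2 - s with hφ₂
  set φ₃ : S → ℝ := fun x => g x ^ 2 - s with hφ₃
  set ψ : S → ℝ := fun x => (f x * g x - r * (f x ^ 2 + g x ^ 2) / 2) / s with hψ
  have m₁ : Measurable φ₁ := by fun_prop
  have m₂ : Measurable φ₂ := by fun_prop
  have m₃ : Measurable φ₃ := by fun_prop
  have mψ : Measurable ψ := by fun_prop
  have hrs : |r * s| ≤ C ^ 2 := by
    rw [abs_mul, abs_of_pos hs]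
    calc |r| * s ≤ 1 * C ^ 2 := by gcongr
      _ = _ := one_mul _
  have b₁ : ∀ x, |φ₁ x| ≤ 2 * C ^ 2 := fun x =>
    (abs_sub _ _).trans (by linarith [bfg x])
  have b₂ : ∀ x, |φ₂ x| ≤ 2 * C ^ 2 := fun x =>
    (abs_sub _ _).trans (by linarith [bff x, abs_of_pos hs])
  have b₃ : ∀ x, |φ₃ x| ≤ 2 * C ^ 2 := fun x =>
    (abs_sub _ _).trans (by linarith [bgg x, abs_of_pos hs])
  have bψ : ∀ x, |ψ x| ≤ 2 * C ^ 2 / s := fun x => by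
    rw [hψ, abs_div, abs_of_pos hs]
    gcongr
    have h1 : |r * (f x ^ 2 + g x ^ 2) / 2| ≤ C ^ 2 := by
      rw [abs_div, abs_mul, abs_two]
      have h2 := abs_add_le (f x ^ 2) (g x ^ 2)
      have : |r| * |f x ^ 2 + g x ^ 2| ≤ 1 * (2 * C ^ 2) := by
        gcongr; linarith [bff x, bgg x]
      linarith
    exact (abs_sub _ _).trans (by linarith [bfg x])
  have z₁ : ∫ x, φ₁ x ∂μ = 0 := by
    rw [hφ₁, integral_sub ifg (integrable_const _), hr]; simp
  have z₂ : ∫ x, φ₂ x ∂μ = 0 := by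
    rw [hφ₂, integral_sub iff (integrable_const _), hfs]; simp
  have z₃ : ∫ x, φ₃ x ∂μ = 0 := by
    rw [hφ₃, integral_sub igg (integrable_const _), hgs]; simp
  have zψ : ∫ x, ψ x ∂μ = 0 := by
    have i2 : Integrable (fun x => r * (f x ^ 2 + g x ^ 2) / 2) μ :=
      ((iff.fun_add igg).const_mul r).div_const 2
    rw [hψ, integral_div, integral_sub ifg i2, integral_div, integral_const_mul,
      integral_add iff igg, hr, hfs, hgs]
    ring
  -- linearization
  set L : ℕ → Ω → ℝ := fun m ω => partialSum Y ψ m ω / m with hL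
  have hLlin : ∀ m : ℕ, 1 ≤ m → ∀ ω, L m ω = (partialSum Y φ₁ m ω / m
      - r * (partialSum Y φ₂ m ω / m + partialSum Y φ₃ m ω / m) / 2) / s := by
    intro m hm ω
    have hm0 : (0 : ℝ) < m := by exact_mod_cast hm
    have : partialSum Y ψ m ω = (partialSum Y φ₁ m ω
        - r * (partialSum Y φ₂ m ω + partialSum Y φ₃ m ω) / 2) / s := by
      unfold partialSum
      rw [← Finset.sum_add_distrib, Finset.mul_sum, Finset.sum_div, ← Finset.sum_sub_distrib,
        Finset.sum_div]
      refine Finset.sum_congr rfl fun i _ => ?_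
      simp only [hψ, hφ₁, hφ₂, hφ₃]
      ring
    simp only [hL]
    rw [this]
    field_simp
  have hrem : ∀ m : ℕ, 1 ≤ m → ∀ ω, |W m ω - r - L m ω| ≤ 15 / s ^ 2 *
      ((partialSum Y φ₁ m ω / m) ^ 2 + (partialSum Y φ₂ m ω / m) ^ 2
        + (partialSum Y φ₃ m ω / m) ^ 2) := by
    intro m hm ω
    have hm0 : (0 : ℝ) < m := by exact_mod_cast hm
    have e : ∀ (h : S → ℝ) (c : ℝ), partialSum Y (fun x => h x - c) m ω / m =
        (∑ i ∈ Finset.range m, h (Y i ω)) / m - c := by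
      intro h c
      unfold partialSum
      rw [Finset.sum_sub_distrib]
      simp
      field_simp
    -- The factor 1/m cancels between numerator and denominator, so the ratio is evaluated at
    -- empirical means, which are close to (r s, s, s).
    have hWe : W m ω = ((∑ i ∈ Finset.range m, f (Y i ω) * g (Y i ω)) / m) /
        (√((∑ i ∈ Finset.range m, f (Y i ω) ^ 2) / m) *
          √((∑ i ∈ Finset.range m, g (Y i ω) ^ 2) / m)) := by
      rw [hW, Real.sqrt_div' _ hm0.le, Real.sqrt_div' _ hm0.le, div_mul_div_comm,
        Real.mul_self_sqrt hm0.le, div_div_div_cancel_right₀ hm0.ne']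
    rw [hLlin m hm, hφ₁, hφ₂, hφ₃, e, e, e, hWe]
    apply abs_ratio_sub_linear_le hs hr1
    rw [← hWe, hW]
    exact abs_sum_mul_div_le_one _ _ _
  apply tendsto_mean_variance_of_linearization (L := L)
    (C := (15 / s ^ 2) ^ 2 * (3 * (3 * (3 * (2 * C ^ 2) ^ 4))))
  · intro m
    refine MemLp.of_bound ?_ 1 (ae_of_all _ fun ω => ?_)
    · have : W m = fun ω => partialSum Y (fun x => f x * g x) m ω /
          (√(partialSum Y (fun x => f x ^ 2) m ω) * √(partialSum Y (fun x => g x ^ 2) m ω)) := by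
        ext ω; rw [hW]; rfl
      rw [this]
      exact ((aemeasurable_partialSum hY (hf.mul hg) m).div
        ((aemeasurable_partialSum hY (hf.pow_const 2) m).sqrt.mul
        (aemeasurable_partialSum hY (hg.pow_const 2) m).sqrt)).aestronglyMeasurable
    · rw [Real.norm_eq_abs, hW]
      exact abs_sum_mul_div_le_one _ _ _
  · intro m
    refine MemLp.of_bound ((aemeasurable_partialSum hY mψ m).div_const _).aestronglyMeasurable
      (m * (2 * C ^ 2 / s) / m) (ae_of_all _ fun ω => ?_)
    simp only [hL]
    rw [Real.norm_eq_abs, abs_div, Nat.abs_cast]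
    gcongr
    exact abs_partialSum_le Y bψ m ω
  · intro m
    simp only [hL]
    rw [integral_div, integral_partialSum hY mψ bψ, zψ]
    simp
  · intro m hm
    have hm0 : (0 : ℝ) < m := by exact_mod_cast hm
    simp only [hL, div_pow]
    rw [integral_div, integral_partialSum_sq hY hind mψ bψ zψ, sq (m : ℝ),
      mul_div_mul_left _ _ hm0.ne']
    simp only [hψ, div_pow]
  · intro m hm
    have hm0 : (0 : ℝ) < m := by exact_mod_cast hm
    have i₁ := integrable_mean_pow_four hY m₁ b₁ m
    have i₂ := integrable_mean_pow_four hY m₂ b₂ m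
    have i₃ := integrable_mean_pow_four hY m₃ b₃ m
    -- The remainder is quadratic in the centred means, so its square is controlled by fourth powers
    -- through (a² + b² + c²)² ≤ 3(a⁴ + b⁴ + c⁴); the fourth moments of the means are O(1/m²).
    have hle : ∫ ω, (W m ω - r - L m ω) ^ 2 ∂P ≤ ∫ ω, (15 / s ^ 2) ^ 2 * (3 *
        ((partialSum Y φ₁ m ω / m) ^ 4 + (partialSum Y φ₂ m ω / m) ^ 4
        + (partialSum Y φ₃ m ω / m) ^ 4)) ∂P := by
      refine integral_mono_of_nonneg (ae_of_all _ fun ω => sq_nonneg _)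
        ((((i₁.fun_add i₂).fun_add i₃).const_mul 3).const_mul _) (ae_of_all _ fun ω => ?_)
      dsimp only
      rw [← sq_abs]
      refine (pow_le_pow_left₀ (abs_nonneg _) (hrem m hm ω) 2).trans ?_
      rw [mul_pow]
      gcongr
      generalize partialSum Y φ₁ m ω / m = a
      generalize partialSum Y φ₂ m ω / m = b
      generalize partialSum Y φ₃ m ω / m = c
      nlinarith [sq_nonneg (a ^ 2 - b ^ 2), sq_nonneg (a ^ 2 - c ^ 2), sq_nonneg (b ^ 2 - c ^ 2)]
    refine hle.trans ?_
    rw [integral_const_mul, integral_const_mul, integral_add (i₁.fun_add i₂) i₃,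
      integral_add i₁ i₂, mul_div_assoc, mul_div_assoc, mul_div_assoc]
    gcongr
    have h₁ := integral_mean_pow_four_le hY hind m₁ b₁ z₁ hm
    have h₂ := integral_mean_pow_four_le hY hind m₂ b₂ z₂ hm
    have h₃ := integral_mean_pow_four_le hY hind m₃ b₃ z₃ hm
    linarith

/-- Mean and variance of twice the empirical mean of a bounded function. -/
lemma mean_variance_twice_mean {Y : ℕ → Ω → S} (hY : ∀ i, HasLaw (Y i) μ P)
    (hind : iIndepFun Y P) {φ : S → ℝ} (hφ : Measurable φ) {C : ℝ} (hC : ∀ x, |φ x| ≤ C)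
    {m : ℕ} (hm : 1 ≤ m) {c : ℝ} (hc : ∫ x, φ x ∂μ = c) {W : Ω → ℝ}
    (hW : ∀ ω, W ω = 2 / (m : ℝ) * ∑ i ∈ Finset.range m, φ (Y i ω)) :
    ∫ ω, W ω ∂P = 2 * c ∧ variance W P = 4 / m * ∫ x, (φ x - c) ^ 2 ∂μ := by
  have hm0 : (0 : ℝ) < m := by exact_mod_cast hm
  have hi : Integrable φ μ := integrable_of_abs_le hφ.aemeasurable hC
  have hW' : W = fun ω => 2 / (m : ℝ) * partialSum Y φ m ω := by ext ω; rw [hW]; rfl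
  have hmean : ∫ ω, W ω ∂P = 2 * c := by
    rw [hW', integral_const_mul, integral_partialSum hY hφ hC, hc]
    field_simp
  refine ⟨hmean, ?_⟩
  have hm1 : Measurable fun x => φ x - c := by fun_prop
  have hb : ∀ x, |φ x - c| ≤ C + |c| := fun x =>
    (abs_sub _ _).trans (by linarith [hC x])
  have hz : ∫ x, (φ x - c) ∂μ = 0 := by
    rw [integral_sub hi (integrable_const _), hc]; simp
  have e : W = fun ω => 2 / (m : ℝ) * partialSum Y (fun x => φ x - c) m ω + 2 * c := by
    ext ω
    rw [hW]
    unfold partialSum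
    rw [Finset.sum_sub_distrib]
    simp
    field_simp
    ring
  have hmeas : AEMeasurable (partialSum Y (fun x => φ x - c) m) P :=
    aemeasurable_partialSum hY hm1 m
  rw [e, variance_add_const (hmeas.const_mul _).aestronglyMeasurable, variance_const_mul,
    variance_of_integral_eq_zero hmeas (by rw [integral_partialSum hY hm1 hb, hz, mul_zero]),
    integral_partialSum_sq hY hind hm1 hb hz]
  field_simp
  ring

end Ratio

/-! ### Fourier analysis of autocorrelations on the circle -/

section Circle

open AddCircle

instance fact_two_pi_pos : Fact (0 < 2 * Real.pi) := ⟨Real.two_pi_pos⟩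

/-- The circle `ℝ / 2πℤ`. -/
abbrev Circ : Type := AddCircle (2 * Real.pi)

/-- The cosine as a function on the circle `ℝ / 2πℤ`. -/
noncomputable def circleCos (t : Circ) : ℝ := (fourier 1 t).re

lemma fourier_coe_re (k : ℤ) (x : ℝ) : (fourier k (x : Circ)).re = Real.cos (k * x) := by
  rw [fourier_coe_apply]
  have : (2 * (Real.pi : ℂ) * Complex.I * k * x / ((2 * Real.pi : ℝ) : ℂ)) =
      ((k * x : ℝ) : ℂ) * Complex.I := by
    have : (Real.pi : ℂ) ≠ 0 := by exact_mod_cast Real.pi_ne_zero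
    push_cast
    field_simp
  rw [this, Complex.exp_ofReal_mul_I_re]

lemma circleCos_coe (x : ℝ) : circleCos (x : Circ) = Real.cos x := by
  rw [circleCos, fourier_coe_re]; simp

lemma continuous_circleCos : Continuous circleCos :=
  Complex.continuous_re.comp (fourier 1).continuous

lemma norm_fourier_apply (k : ℤ) (t : Circ) : ‖fourier k t‖ = 1 := Circle.norm_coe _

lemma fourier_add_arg (k : ℤ) (s t : Circ) : fourier k (s + t) = fourier k s * fourier k t := by
  rw [fourier_apply, fourier_apply, fourier_apply, smul_add, toCircle_add, Circle.coe_mul]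

lemma fourierCoeff_translate (φ : Circ → ℂ) (δ : Circ) (k : ℤ) :
    fourierCoeff (fun t => φ (t + δ)) k = fourier k δ * fourierCoeff φ k := by
  unfold fourierCoeff
  rw [← integral_add_right_eq_self (μ := haarAddCircle) (fun t => fourier (-k) t • φ t) δ,
    ← integral_const_mul]
  congr 1
  ext t
  rw [fourier_add_arg, smul_eq_mul, smul_eq_mul]
  have : fourier k δ * fourier (-k) δ = 1 := by
    rw [← fourier_add, add_neg_cancel, fourier_zero]
  linear_combination (-(fourier (-k) t * φ (t + δ))) * this

/-- Parseval's identity for the autocorrelation of a bounded function on the circle. -/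
lemma hasSum_autocorrelation {φ : Circ → ℝ} (hφ : Measurable φ) {C : ℝ} (hC : ∀ t, |φ t| ≤ C)
    (δ : Circ) :
    HasSum (fun k : ℤ => ‖fourierCoeff (fun t => (φ t : ℂ)) k‖ ^ 2 * (fourier k δ).re)
      (∫ t, φ t * φ (t + δ) ∂haarAddCircle) := by
  have hmem : ∀ ψ : Circ → ℝ, Measurable ψ → (∀ t, |ψ t| ≤ C) →
      MemLp (fun t => (ψ t : ℂ)) 2 haarAddCircle := fun ψ hψ hb =>
    MemLp.of_bound (Complex.measurable_ofReal.comp hψ).aestronglyMeasurable C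
      (ae_of_all _ fun t => by simpa using hb t)
  have h1 := hmem φ hφ hC
  have h2 := hmem (fun t => φ (t + δ)) (by fun_prop) (fun t => hC _)
  -- Parseval for φ and its translate: the coefficients of the translate are those of φ times the
  -- character at δ, so the products become |φ̂(k)|² times that character.
  have key := fourierBasis.hasSum_inner_mul_inner h1.toLp h2.toLp
  have e1 : ∀ k, fourierBasis.repr h1.toLp k = fourierCoeff (fun t => (φ t : ℂ)) k := fun k => by
    rw [fourierBasis_repr]
    exact congr_fun (fourierCoeff_congr_ae h1.coeFn_toLp) k
  have e2 : ∀ k, fourierBasis.repr h2.toLp k =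
      fourier k δ * fourierCoeff (fun t => (φ t : ℂ)) k := fun k => by
    rw [fourierBasis_repr, ← fourierCoeff_translate]
    exact congr_fun (fourierCoeff_congr_ae h2.coeFn_toLp) k
  have e3 : inner ℂ h1.toLp h2.toLp = ((∫ t, φ t * φ (t + δ) ∂haarAddCircle : ℝ) : ℂ) := by
    rw [L2.inner_def, ← integral_complex_ofReal]
    apply integral_congr_ae
    filter_upwards [h1.coeFn_toLp, h2.coeFn_toLp] with t ht1 ht2
    rw [ht1, ht2]
    simp [mul_comm]
  rw [e3] at key
  have key2 := Complex.hasSum_re key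
  rw [Complex.ofReal_re] at key2
  convert key2 using 2 with k
  rw [← fourierBasis.repr_apply_apply, ← inner_conj_symm, ← fourierBasis.repr_apply_apply, e1, e2]
  set c := fourierCoeff (fun t => (φ t : ℂ)) k
  have : (starRingEnd ℂ) c * (fourier k δ * c) = ((‖c‖ ^ 2 : ℝ) : ℂ) * fourier k δ := by
    rw [← Complex.normSq_eq_norm_sq, Complex.normSq_eq_conj_mul_self]; ring
  rw [this, Complex.re_ofReal_mul]

lemma hasSum_sq_fourierCoeff_of_bounded {φ : Circ → ℝ} (hφ : Measurable φ) {C : ℝ}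
    (hC : ∀ t, |φ t| ≤ C) :
    HasSum (fun k : ℤ => ‖fourierCoeff (fun t => (φ t : ℂ)) k‖ ^ 2)
      (∫ t, φ t ^ 2 ∂haarAddCircle) := by
  have := hasSum_autocorrelation hφ hC 0
  simpa [sq] using this

variable {E : Type*} [MeasurableSpace E] {Λ : Measure E} [IsProbabilityMeasure Λ]

/-- Averaging the autocorrelation over a random shift multiplies the squared Fourier coefficients
by the characteristic function of the shift. -/
lemma hasSum_mean_autocorrelation {φ : Circ → ℝ} (hφ : Measurable φ) {C : ℝ}
    (hC : ∀ t, |φ t| ≤ C) {D : E → ℝ} (hD : Measurable D) {κ : ℤ → ℝ}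
    (hκ : ∀ k : ℤ, ∫ w, Real.cos (k * D w) ∂Λ = κ k) :
    HasSum (fun k : ℤ => ‖fourierCoeff (fun t => (φ t : ℂ)) k‖ ^ 2 * κ k)
      (∫ w, ∫ t, φ t * φ (t + (D w : Circ)) ∂haarAddCircle ∂Λ) := by
  have hs := (hasSum_sq_fourierCoeff_of_bounded hφ hC).summable
  -- Series and mean may be exchanged because the summable sequence |φ̂(k)|² dominates the terms for
  -- every shift.
  have h := hasSum_integral_of_dominated_convergence (μ := Λ)
    (F := fun (k : ℤ) w => ‖fourierCoeff (fun t => (φ t : ℂ)) k‖ ^ 2 * Real.cos (k * D w))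
    (f := fun w => ∫ t, φ t * φ (t + (D w : Circ)) ∂haarAddCircle)
    (fun k _ => ‖fourierCoeff (fun t => (φ t : ℂ)) k‖ ^ 2)
    (fun k => Measurable.aestronglyMeasurable (by fun_prop))
    (fun k => ae_of_all _ fun w => by
      rw [Real.norm_eq_abs, abs_mul, abs_of_nonneg (by positivity)]
      exact mul_le_of_le_one_right (by positivity) (Real.abs_cos_le_one _))
    (ae_of_all _ fun w => hs) (integrable_const _)
    (ae_of_all _ fun w => by
      have := hasSum_autocorrelation hφ hC (D w : Circ)
      simpa only [fourier_coe_re] using this)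
  simpa only [integral_const_mul, hκ] using h

variable {K : ℝ} {D : E → ℝ}

/-- All terms of the Parseval series are nonnegative. The frequencies 1 and -1 carry the weight K
each, and the real part of either coefficient is the cosine coefficient of φ. -/
lemma mean_autocorrelation_ge {φ : Circ → ℝ} (hφ : Measurable φ) {C : ℝ} (hC : ∀ t, |φ t| ≤ C)
    (hD : Measurable D) (hK : 0 < K)
    (hκ : ∀ k : ℤ, ∫ w, Real.cos (k * D w) ∂Λ = K ^ (k.natAbs ^ 2)) :
    2 * K * (∫ t, φ t * circleCos t ∂haarAddCircle) ^ 2 ≤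
      ∫ w, ∫ t, φ t * φ (t + (D w : Circ)) ∂haarAddCircle ∂Λ := by
  have h := hasSum_mean_autocorrelation hφ hC hD hκ
  have h2 := sum_le_hasSum {1, -1} (fun k _ => by positivity) h
  rw [Finset.sum_pair (by norm_num)] at h2
  have hint : Integrable φ haarAddCircle := integrable_of_abs_le hφ.aemeasurable hC
  have hre : ∀ k : ℤ, (∀ t : Circ, (fourier (-k) t).re = circleCos t) →
      (∫ t, φ t * circleCos t ∂haarAddCircle) ^ 2 ≤
        ‖fourierCoeff (fun t => (φ t : ℂ)) k‖ ^ 2 := by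
    intro k hk
    rw [← sq_abs]
    have : ∫ t, φ t * circleCos t ∂haarAddCircle =
        (fourierCoeff (fun t => (φ t : ℂ)) k).re := by
      unfold fourierCoeff
      have hi : Integrable (fun t => fourier (-k) t • (φ t : ℂ)) haarAddCircle :=
        hint.ofReal.fourier_smul (-k)
      have := integral_re (𝕜 := ℂ) hi
      simp only [RCLike.re_eq_complex_re] at this
      rw [← this]
      congr 1
      ext t
      rw [smul_eq_mul, Complex.re_mul_ofReal, hk, mul_comm]
    rw [this]
    gcongr
    exact Complex.abs_re_le_norm _
  have h3 := hre (-1) (fun t => by rw [neg_neg]; rfl)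
  have h4 := hre 1 (fun t => by rw [fourier_neg, Complex.conj_re]; rfl)
  simp at h2
  nlinarith

/-- Centring removes the frequency 0, and every other frequency has weight K^(k²) ≤ K. -/
lemma mean_autocorrelation_le {φ : Circ → ℝ} (hφ : Measurable φ) {C : ℝ} (hC : ∀ t, |φ t| ≤ C)
    (hD : Measurable D) (hK : 0 < K) (hK1 : K ≤ 1)
    (hκ : ∀ k : ℤ, ∫ w, Real.cos (k * D w) ∂Λ = K ^ (k.natAbs ^ 2))
    (h0 : ∫ t, φ t ∂haarAddCircle = 0) :
    ∫ w, ∫ t, φ t * φ (t + (D w : Circ)) ∂haarAddCircle ∂Λ ≤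
      K * ∫ t, φ t ^ 2 ∂haarAddCircle := by
  have h := hasSum_mean_autocorrelation hφ hC hD hκ
  refine hasSum_le (fun k => ?_) h ((hasSum_sq_fourierCoeff_of_bounded hφ hC).mul_left K)
  by_cases hk : k = 0
  · subst hk
    have : fourierCoeff (fun t => (φ t : ℂ)) 0 = 0 := by
      unfold fourierCoeff
      simp only [neg_zero, fourier_zero, one_smul]
      rw [integral_complex_ofReal, h0, Complex.ofReal_zero]
    rw [this]; simp
  · rw [mul_comm]
    gcongr
    refine (pow_le_pow_of_le_one hK.le hK1 (?_ : 1 ≤ k.natAbs ^ 2)).trans_eq (pow_one K)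
    exact Nat.one_le_pow _ _ (Int.natAbs_pos.mpr hk)

end Circle

/-! ### The arcsine law as the law of a cosine -/

section Arcsine

open AddCircle

/-- The arcsine law on `[-1, 1]`: the law of `cos θ` for `θ` uniform on `[0, π]`. -/
noncomputable def arcsine : Measure ℝ :=
  (ENNReal.ofReal Real.pi⁻¹ • volume.restrict (Set.Ioc 0 Real.pi)).map Real.cos

lemma integral_arcsine {f : ℝ → ℝ} (hf : Measurable f) :
    ∫ z, f z ∂arcsine = Real.pi⁻¹ * ∫ θ in (0 : ℝ)..Real.pi, f (Real.cos θ) := by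
  rw [arcsine, integral_map Real.measurable_cos.aemeasurable hf.aestronglyMeasurable,
    integral_smul_measure, intervalIntegral.integral_of_le Real.pi_pos.le,
    ENNReal.toReal_ofReal (by positivity), smul_eq_mul]

instance : IsProbabilityMeasure arcsine := by
  have : IsProbabilityMeasure
      (ENNReal.ofReal Real.pi⁻¹ • volume.restrict (Set.Ioc 0 Real.pi)) := by
    constructor
    simp only [Measure.smul_apply, Measure.restrict_apply_univ, Real.volume_Ioc, smul_eq_mul,
      sub_zero]
    rw [← ENNReal.ofReal_mul (by positivity), inv_mul_cancel₀ Real.pi_ne_zero, ENNReal.ofReal_one]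
  exact Measure.isProbabilityMeasure_map Real.measurable_cos.aemeasurable

lemma ae_arcsine_mem_Icc : ∀ᵐ z ∂arcsine, z ∈ Set.Icc (-1 : ℝ) 1 := by
  refine (ae_map_iff (p := fun z => z ∈ Set.Icc (-1 : ℝ) 1) Real.measurable_cos.aemeasurable
    measurableSet_Icc).2 ?_
  exact ae_of_all _ fun θ => ⟨Real.neg_one_le_cos θ, Real.cos_le_one θ⟩

lemma integral_mul_density {f : ℝ → ℝ} (hf : Measurable f) :
    ∫ z in Set.Icc (-1 : ℝ) 1, f z * density z = ∫ z, f z ∂arcsine := by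
  rw [integral_arcsine hf, ← Polynomial.Chebyshev.integral_measureT_eq_integral_cos,
    Polynomial.Chebyshev.integral_measureT, integral_Icc_eq_integral_Ioc,
    ← intervalIntegral.integral_of_le (by norm_num), ← intervalIntegral.integral_const_mul]
  congr 1
  ext z
  rw [density, Real.sqrt_inv]
  field_simp

lemma setIntegral_arcsine {f : ℝ → ℝ} (hf : Measurable f) {α β : ℝ} (hα : 0 ≤ α) (hαβ : α ≤ β)
    (hβ : β ≤ Real.pi) :
    ∫ z in Set.Ioc (Real.cos β) (Real.cos α), f z ∂arcsine =
      Real.pi⁻¹ * ∫ θ in α..β, f (Real.cos θ) := by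
  rw [← integral_indicator measurableSet_Ioc,
    integral_arcsine (hf.indicator measurableSet_Ioc)]
  congr 1
  rw [intervalIntegral.integral_of_le Real.pi_pos.le, intervalIntegral.integral_of_le hαβ,
    integral_Ioc_eq_integral_Ioo, integral_Ioc_eq_integral_Ioo,
    ← integral_indicator measurableSet_Ioo, ← integral_indicator measurableSet_Ioo]
  apply integral_congr_ae
  -- The half-open interval in z corresponds to α ≤ θ < β, which differs from the open interval by
  -- the null point α.
  have h1 : ∀ᵐ θ : ℝ, θ ≠ α := by simp [ae_iff]
  filter_upwards [h1] with θ h1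
  by_cases hθ : θ ∈ Set.Ioo 0 Real.pi
  · rw [Set.indicator_of_mem hθ]
    have hm : θ ∈ Set.Icc 0 Real.pi := ⟨hθ.1.le, hθ.2.le⟩
    have e1 : Real.cos β < Real.cos θ ↔ θ < β :=
      Real.strictAntiOn_cos.lt_iff_gt ⟨hα.trans hαβ, hβ⟩ hm
    have e2 : Real.cos θ ≤ Real.cos α ↔ α ≤ θ :=
      Real.strictAntiOn_cos.le_iff_ge hm ⟨hα, hαβ.trans hβ⟩
    by_cases h : θ ∈ Set.Ioo α β
    · rw [Set.indicator_of_mem h, Set.indicator_of_mem]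
      exact ⟨e1.2 h.2, e2.2 h.1.le⟩
    · rw [Set.indicator_of_notMem h, Set.indicator_of_notMem]
      exact fun hc => h ⟨lt_of_le_of_ne (e2.1 hc.2) (Ne.symm h1), e1.1 hc.1⟩
  · rw [Set.indicator_of_notMem hθ, Set.indicator_of_notMem]
    exact fun h => hθ ⟨hα.trans_lt h.1, h.2.trans_le hβ⟩

lemma integral_haar_eq (F : Circ → ℝ) :
    ∫ t, F t ∂haarAddCircle = (2 * Real.pi)⁻¹ * ∫ x in (0 : ℝ)..2 * Real.pi, F (x : Circ) := by
  have := AddCircle.intervalIntegral_preimage (2 * Real.pi) 0 F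
  rw [zero_add] at this
  rw [this, integral_haarAddCircle, smul_eq_mul]

/-- The reflection θ ↦ 2π - θ preserves the cosine, so both halves of the circle contribute equally.
-/
lemma integral_haar_circleCos {f : ℝ → ℝ} (hf : Measurable f) {C : ℝ} (hC : ∀ z, |f z| ≤ C) :
    ∫ t, f (circleCos t) ∂haarAddCircle = ∫ z, f z ∂arcsine := by
  rw [integral_haar_eq, integral_arcsine hf]
  simp_rw [circleCos_coe]
  have hi : ∀ a b, IntervalIntegrable (fun x => f (Real.cos x)) volume a b := fun a b => by
    rw [intervalIntegrable_iff]
    have : IsFiniteMeasure (volume.restrict (Set.uIoc a b)) := ⟨by simp [Set.uIoc]⟩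
    exact integrable_of_abs_le (hf.comp Real.measurable_cos).aemeasurable fun x => hC _
  rw [← intervalIntegral.integral_add_adjacent_intervals (hi 0 Real.pi) (hi Real.pi _)]
  have : ∫ x in Real.pi..2 * Real.pi, f (Real.cos x) = ∫ x in (0 : ℝ)..Real.pi, f (Real.cos x) := by
    have := intervalIntegral.integral_comp_sub_left (a := Real.pi) (b := 2 * Real.pi)
      (fun x => f (Real.cos x)) (2 * Real.pi)
    simp only [Real.cos_two_pi_sub] at this
    rw [this]
    congr 1 <;> ring
  rw [this]
  field_simp
  ring

end Arcsine

/-! ### Joint law of the two features -/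

section Law

open AddCircle

variable {d : ℕ}

/-- The law of one draw `(w, τ)`. -/
noncomputable def drawLaw (d : ℕ) : Measure (EuclideanSpace ℝ (Fin d) × ℝ) :=
  (stdGaussian (EuclideanSpace ℝ (Fin d))).prod
    (ProbabilityTheory.cond volume (Set.Icc 0 (2 * Real.pi)))

instance : IsProbabilityMeasure
    (ProbabilityTheory.cond (volume : Measure ℝ) (Set.Icc 0 (2 * Real.pi))) := by
  refine cond_isProbabilityMeasure_of_finite ?_ ?_
  · simp [Real.volume_Icc, Real.pi_pos]
  · rw [Real.volume_Icc]; exact ENNReal.ofReal_ne_top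

instance : IsProbabilityMeasure (drawLaw d) := by unfold drawLaw; infer_instance

lemma IsSample.hasLaw_draw {Ω : Type*} [MeasurableSpace Ω] {P : Measure Ω} [IsProbabilityMeasure P]
    {w : ℕ → Ω → EuclideanSpace ℝ (Fin d)} {τ : ℕ → Ω → ℝ} (h : IsSample P w τ) (i : ℕ) :
    HasLaw (fun ω => (w i ω, τ i ω)) (drawLaw d) P :=
  (h.indep_pair i).hasLaw_prod (h.law_w i) (h.law_τ i)

lemma integral_uniform (F : ℝ → ℝ) :
    ∫ x, F x ∂(ProbabilityTheory.cond volume (Set.Icc 0 (2 * Real.pi))) =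
      (2 * Real.pi)⁻¹ * ∫ x in (0 : ℝ)..2 * Real.pi, F x := by
  rw [ProbabilityTheory.cond, integral_smul_measure, intervalIntegral.integral_of_le (by positivity),
    integral_Icc_eq_integral_Ioc, Real.volume_Icc, sub_zero, ENNReal.toReal_inv,
    ENNReal.toReal_ofReal (by positivity), smul_eq_mul]

lemma integral_uniform_coe (F : Circ → ℝ) :
    ∫ x, F ((x : ℝ) : Circ) ∂(ProbabilityTheory.cond volume (Set.Icc 0 (2 * Real.pi))) =
      ∫ t, F t ∂haarAddCircle := by
  rw [integral_uniform, integral_haar_eq]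

lemma measurable_feature (γ : ℝ) (u : EuclideanSpace ℝ (Fin d)) :
    Measurable fun x : EuclideanSpace ℝ (Fin d) × ℝ => feature γ x.1 x.2 u := by
  unfold feature
  fun_prop

/-- The joint law of the features of `u` and `v`, as a random shift on the circle. -/
lemma integral_feature_mul {γ : ℝ} (u v : EuclideanSpace ℝ (Fin d)) {f g : ℝ → ℝ}
    (hf : Measurable f) (hg : Measurable g) {C : ℝ} (hfC : ∀ z, |f z| ≤ C) (hgC : ∀ z, |g z| ≤ C) :
    ∫ x, f (feature γ x.1 x.2 u) * g (feature γ x.1 x.2 v) ∂(drawLaw d) =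
      ∫ w, ∫ t, f (circleCos t) * g (circleCos (t + ((γ * inner ℝ w (v - u) : ℝ) : Circ)))
        ∂haarAddCircle ∂(stdGaussian (EuclideanSpace ℝ (Fin d))) := by
  have hC : 0 ≤ C := (abs_nonneg _).trans (hfC 0)
  rw [drawLaw, integral_prod]
  · congr 1
    ext w
    -- For fixed w the phase γ wᵀu + τ is again uniform modulo 2π. By translation invariance only
    -- the relative shift γ wᵀ(v - u) remains.
    rw [← integral_add_right_eq_self (μ := haarAddCircle) _ ((γ * inner ℝ w u : ℝ) : Circ),
      ← integral_uniform_coe]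
    congr 1
    ext x
    rw [← AddCircle.coe_add, ← AddCircle.coe_add, circleCos_coe, circleCos_coe, feature, feature,
      inner_sub_right]
    congr 3 <;> ring
  · refine integrable_of_abs_le (C := C * C) ?_ fun x => ?_
    · exact ((hf.comp (measurable_feature γ u)).mul
        (hg.comp (measurable_feature γ v))).aemeasurable
    · rw [abs_mul]
      exact mul_le_mul (hfC _) (hgC _) (abs_nonneg _) hC

lemma integral_feature {γ : ℝ} (u : EuclideanSpace ℝ (Fin d)) {f : ℝ → ℝ}
    (hf : Measurable f) {C : ℝ} (hfC : ∀ z, |f z| ≤ C) :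
    ∫ x, f (feature γ x.1 x.2 u) ∂(drawLaw d) = ∫ z, f z ∂arcsine := by
  have h := integral_feature_mul (γ := γ) u u hf (g := fun _ => 1) measurable_const
    (C := max C 1) (fun z => (hfC z).trans (le_max_left _ _)) (fun z => by simp)
  simp only [mul_one] at h
  rw [h, integral_haar_circleCos hf hfC]
  simp

lemma kernel_pos (γ : ℝ) (u v : EuclideanSpace ℝ (Fin d)) : 0 < kernel γ u v := Real.exp_pos _

lemma kernel_le_one (γ : ℝ) (u v : EuclideanSpace ℝ (Fin d)) : kernel γ u v ≤ 1 := by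
  rw [kernel, Real.exp_le_one_iff]
  have : 0 ≤ γ ^ 2 * ‖u - v‖ ^ 2 := by positivity
  linarith

/-- The shift is a centred Gaussian of variance γ²‖u - v‖²; its characteristic function at k is
exp(-k²γ²‖u - v‖²/2). -/
lemma integral_cos_shift (γ : ℝ) (u v : EuclideanSpace ℝ (Fin d)) (k : ℤ) :
    ∫ w, Real.cos (k * (γ * inner ℝ w (v - u))) ∂(stdGaussian (EuclideanSpace ℝ (Fin d))) =
      kernel γ u v ^ (k.natAbs ^ 2) := by
  have h := charFun_stdGaussian (E := EuclideanSpace ℝ (Fin d)) (((k : ℝ) * γ) • (v - u))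
  rw [charFun_apply] at h
  have h2 := congrArg Complex.re h
  have hi : Integrable (fun w : EuclideanSpace ℝ (Fin d) =>
      Complex.exp ((inner ℝ w (((k : ℝ) * γ) • (v - u)) : ℝ) * Complex.I))
      (stdGaussian (EuclideanSpace ℝ (Fin d))) :=
    Integrable.of_bound (Measurable.aestronglyMeasurable (by fun_prop)) 1
      (ae_of_all _ fun w => (Complex.norm_exp_ofReal_mul_I _).le)
  have h3 := integral_re (𝕜 := ℂ) hi
  simp only [RCLike.re_eq_complex_re, Complex.exp_ofReal_mul_I_re, inner_smul_right] at h3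
  simp only [inner_smul_right] at h2
  rw [h2] at h3
  have e : ∀ w : EuclideanSpace ℝ (Fin d), (k : ℝ) * (γ * inner ℝ w (v - u)) =
      (k : ℝ) * γ * inner ℝ w (v - u) := fun w => by ring
  simp_rw [e]
  rw [h3, norm_smul, norm_sub_rev, kernel, ← Real.exp_nat_mul]
  have e2 : (-((‖(k : ℝ) * γ‖ * ‖u - v‖ : ℝ) : ℂ) ^ 2 / 2) =
      ((-(‖(k : ℝ) * γ‖ * ‖u - v‖) ^ 2 / 2 : ℝ) : ℂ) := by push_cast; ring
  rw [e2, Complex.exp_ofReal_re]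
  congr 1
  have e3 : ((k.natAbs ^ 2 : ℕ) : ℝ) = (k : ℝ) ^ 2 := by
    rw [← Int.cast_natCast, Int.natCast_pow, Int.natAbs_sq]; simp
  rw [e3, mul_pow, Real.norm_eq_abs, sq_abs]
  ring

end Law

/-! ### Two-sided correlation bounds -/

section Joint

open AddCircle

variable {d : ℕ} (γ : ℝ) (u v : EuclideanSpace ℝ (Fin d))

/-- The correlation `E[f(z_u) f(z_v)]` dominates the contribution of the first harmonic. -/
lemma integral_feature_mul_self_ge {f : ℝ → ℝ} (hf : Measurable f) {C : ℝ}
    (hfC : ∀ z, |f z| ≤ C) :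
    2 * kernel γ u v * (∫ z, f z * z ∂arcsine) ^ 2 ≤
      ∫ x, f (feature γ x.1 x.2 u) * f (feature γ x.1 x.2 v) ∂(drawLaw d) := by
  rw [integral_feature_mul u v hf hf hfC hfC]
  have h := mean_autocorrelation_ge (Λ := stdGaussian (EuclideanSpace ℝ (Fin d)))
    (D := fun w => γ * inner ℝ w (v - u)) (φ := fun t => f (circleCos t))
    (hf.comp continuous_circleCos.measurable) (fun t => hfC _) (by fun_prop) (kernel_pos γ u v)
    (integral_cos_shift γ u v)
  have e : ∫ t, f (circleCos t) * circleCos t ∂haarAddCircle = ∫ z, f z * z ∂arcsine := by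
    -- The transfer from the circle to the arcsine law asks for a globally bounded integrand, so the
    -- factor z is clamped to [-1, 1], which carries the law.
    have hm : Measurable fun z : ℝ => f z * max (-1) (min z 1) := by fun_prop
    have hb : ∀ z : ℝ, |max (-1) (min z 1)| ≤ 1 := fun z => by
      rw [abs_le]; exact ⟨le_max_left _ _, max_le (by norm_num) (min_le_right _ _)⟩
    have hcut : ∀ z ∈ Set.Icc (-1 : ℝ) 1, max (-1) (min z 1) = z := fun z hz => by
      rw [min_eq_left hz.2, max_eq_right hz.1]
    have h2 := integral_haar_circleCos hm (C := C * 1) fun z => by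
      rw [abs_mul]
      exact mul_le_mul (hfC z) (hb z) (abs_nonneg _) ((abs_nonneg _).trans (hfC 0))
    have h3 : ∫ z, f z * max (-1) (min z 1) ∂arcsine = ∫ z, f z * z ∂arcsine := by
      apply integral_congr_ae
      filter_upwards [ae_arcsine_mem_Icc] with z hz
      rw [hcut z hz]
    rw [← h3, ← h2]
    congr 1
    ext t
    rw [hcut]
    have := Complex.abs_re_le_norm (fourier 1 t)
    rw [norm_fourier_apply, abs_le] at this
    exact this
  rw [e] at h
  exact h

/-- A centred `f(z_u)` has correlation at most `K E[f²]`. -/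
lemma integral_feature_mul_self_le {f : ℝ → ℝ} (hf : Measurable f) {C : ℝ}
    (hfC : ∀ z, |f z| ≤ C) (h0 : ∫ z, f z ∂arcsine = 0) :
    ∫ x, f (feature γ x.1 x.2 u) * f (feature γ x.1 x.2 v) ∂(drawLaw d) ≤
      kernel γ u v * ∫ z, f z ^ 2 ∂arcsine := by
  rw [integral_feature_mul u v hf hf hfC hfC,
    ← integral_haar_circleCos (hf.pow_const 2) (C := C ^ 2) fun z => by
      rw [abs_pow]; exact pow_le_pow_left₀ (abs_nonneg _) (hfC z) 2]
  refine mean_autocorrelation_le (Λ := stdGaussian (EuclideanSpace ℝ (Fin d)))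
    (D := fun w => γ * inner ℝ w (v - u)) (φ := fun t => f (circleCos t))
    (hf.comp continuous_circleCos.measurable) (fun t => hfC _) (by fun_prop) (kernel_pos γ u v)
    (kernel_le_one γ u v) (integral_cos_shift γ u v) ?_
  rw [integral_haar_circleCos hf hfC, h0]

end Joint

/-! ### Almost surely bounded measurable functions -/

section Bounded

variable {S T : Type*} [MeasurableSpace S] [MeasurableSpace T] {μ : Measure S} {f g : S → ℝ}

/-- Measurable and almost surely bounded. -/
def BddMeas (f : S → ℝ) (μ : Measure S) : Prop :=
  Measurable f ∧ ∃ C, ∀ᵐ x ∂μ, |f x| ≤ C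

lemma BddMeas.of_forall (hf : Measurable f) {C : ℝ} (hC : ∀ x, |f x| ≤ C) : BddMeas f μ :=
  ⟨hf, C, ae_of_all _ hC⟩

lemma BddMeas.const (c : ℝ) : BddMeas (fun _ => c) μ :=
  ⟨measurable_const, |c|, ae_of_all _ fun _ => le_rfl⟩

lemma BddMeas.add (hf : BddMeas f μ) (hg : BddMeas g μ) : BddMeas (fun x => f x + g x) μ := by
  obtain ⟨hf, C, hC⟩ := hf
  obtain ⟨hg, D, hD⟩ := hg
  refine ⟨hf.add hg, C + D, ?_⟩
  filter_upwards [hC, hD] with x h1 h2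
  exact (abs_add_le _ _).trans (add_le_add h1 h2)

lemma BddMeas.sub (hf : BddMeas f μ) (hg : BddMeas g μ) : BddMeas (fun x => f x - g x) μ := by
  obtain ⟨hf, C, hC⟩ := hf
  obtain ⟨hg, D, hD⟩ := hg
  refine ⟨hf.sub hg, C + D, ?_⟩
  filter_upwards [hC, hD] with x h1 h2
  exact (abs_sub _ _).trans (add_le_add h1 h2)

lemma BddMeas.mul (hf : BddMeas f μ) (hg : BddMeas g μ) : BddMeas (fun x => f x * g x) μ := by
  obtain ⟨hf, C, hC⟩ := hf
  obtain ⟨hg, D, hD⟩ := hg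
  refine ⟨hf.mul hg, C * D, ?_⟩
  filter_upwards [hC, hD] with x h1 h2
  rw [abs_mul]
  exact mul_le_mul h1 h2 (abs_nonneg _) ((abs_nonneg _).trans h1)

lemma BddMeas.pow (hf : BddMeas f μ) (n : ℕ) : BddMeas (fun x => f x ^ n) μ := by
  obtain ⟨hf, C, hC⟩ := hf
  refine ⟨hf.pow_const n, C ^ n, ?_⟩
  filter_upwards [hC] with x h1
  rw [abs_pow]
  exact pow_le_pow_left₀ (abs_nonneg _) h1 n

lemma BddMeas.abs (hf : BddMeas f μ) : BddMeas (fun x => |f x|) μ := by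
  obtain ⟨hf, C, hC⟩ := hf
  refine ⟨hf.abs, C, ?_⟩
  filter_upwards [hC] with x h1
  rwa [abs_abs]

lemma BddMeas.integrable [IsFiniteMeasure μ] (hf : BddMeas f μ) : Integrable f μ := by
  obtain ⟨hf, C, hC⟩ := hf
  exact Integrable.of_bound hf.aestronglyMeasurable C (by simpa using hC)

lemma bddMeas_id_arcsine : BddMeas (fun z : ℝ => z) arcsine := by
  refine ⟨measurable_id, 1, ?_⟩
  filter_upwards [ae_arcsine_mem_Icc] with z hz
  exact abs_le.2 hz

end Bounded

/-! ### Polarization of the weighted correlation -/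

section Polarization

variable {S : Type*} [MeasurableSpace S] {μ : Measure S} [IsProbabilityMeasure μ] {A B : S → ℝ}

/-- With A' = (A² - s)A - k and likewise B', this is (A + A')(B + B') - (A - A')(B - B') = 2(AB' +
A'B), where the terms in k integrate to zero. For A = f(z_u) and B = f(z_v) the left side is a
difference of two autocorrelations, each of which the Fourier bounds control. -/
lemma polarization_weighted (hA : BddMeas A μ) (hB : BddMeas B μ) (hA0 : ∫ y, A y ∂μ = 0)
    (hB0 : ∫ y, B y ∂μ = 0) (s k : ℝ) :
    (∫ y, (A y + ((A y ^ 2 - s) * A y - k)) * (B y + ((B y ^ 2 - s) * B y - k)) ∂μ)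
      - ∫ y, (A y - ((A y ^ 2 - s) * A y - k)) * (B y - ((B y ^ 2 - s) * B y - k)) ∂μ =
      2 * ∫ y, (A y ^ 2 + B y ^ 2 - 2 * s) * (A y * B y) ∂μ := by
  have hA' : BddMeas (fun y => (A y ^ 2 - s) * A y - k) μ :=
    (((hA.pow 2).sub (.const s)).mul hA).sub (.const k)
  have hB' : BddMeas (fun y => (B y ^ 2 - s) * B y - k) μ :=
    (((hB.pow 2).sub (.const s)).mul hB).sub (.const k)
  rw [← integral_sub ((hA.add hA').mul (hB.add hB')).integrable
    ((hA.sub hA').mul (hB.sub hB')).integrable]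
  have e : ∀ y, (A y + ((A y ^ 2 - s) * A y - k)) * (B y + ((B y ^ 2 - s) * B y - k))
      - (A y - ((A y ^ 2 - s) * A y - k)) * (B y - ((B y ^ 2 - s) * B y - k)) =
      2 * ((A y ^ 2 + B y ^ 2 - 2 * s) * (A y * B y)) - (2 * k * A y + 2 * k * B y) := fun y => by
    ring
  simp_rw [e]
  have b1 := hA.integrable
  have b2 := hB.integrable
  have b3 := ((((hA.pow 2).add (hB.pow 2)).sub (.const (2 * s))).mul (hA.mul hB)).integrable
  rw [integral_sub (by fun_prop) (by fun_prop), integral_add (by fun_prop) (by fun_prop),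
    integral_const_mul, integral_const_mul, integral_const_mul, hA0, hB0]
  ring

end Polarization

/-! ### The sufficient moment inequality -/

section Core

variable {d : ℕ} (γ : ℝ) (u v : EuclideanSpace ℝ (Fin d)) {f : ℝ → ℝ} {C : ℝ}

lemma integral_sq_add_sub_le (hf : Measurable f) (hfC : ∀ z, |f z| ≤ C) {s : ℝ} :
    ∫ y, (f (feature γ y.1 y.2 u) ^ 2 + f (feature γ y.1 y.2 v) ^ 2 - 2 * s) ^ 2 ∂(drawLaw d) ≤
      4 * ∫ z, (f z ^ 2 - s) ^ 2 ∂arcsine := by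
  have hm : Measurable fun z => (f z ^ 2 - s) ^ 2 := by fun_prop
  have hb : ∀ z, |(f z ^ 2 - s) ^ 2| ≤ (C ^ 2 + |s|) ^ 2 := fun z => by
    rw [abs_pow]
    refine pow_le_pow_left₀ (abs_nonneg _) ((abs_sub _ _).trans ?_) 2
    rw [abs_pow]
    gcongr
    exact hfC z
  have h1 := integral_feature (γ := γ) u hm hb
  have h2 := integral_feature (γ := γ) v hm hb
  have i : ∀ u' : EuclideanSpace ℝ (Fin d), Integrable
      (fun y => (f (feature γ y.1 y.2 u') ^ 2 - s) ^ 2) (drawLaw d) := fun u' =>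
    integrable_of_abs_le (hm.comp (measurable_feature γ u')).aemeasurable fun y => hb _
  have h3 : 4 * ∫ z, (f z ^ 2 - s) ^ 2 ∂arcsine = ∫ y, 2 * (f (feature γ y.1 y.2 u) ^ 2 - s) ^ 2 +
      2 * (f (feature γ y.1 y.2 v) ^ 2 - s) ^ 2 ∂(drawLaw d) := by
    rw [integral_add ((i u).const_mul 2) ((i v).const_mul 2), integral_const_mul,
      integral_const_mul, h1, h2]
    ring
  rw [h3]
  refine integral_mono_of_nonneg (ae_of_all _ fun y => sq_nonneg _)
    (((i u).const_mul 2).add ((i v).const_mul 2)) (ae_of_all _ fun y => ?_)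
  dsimp only
  generalize f (feature γ y.1 y.2 u) = a
  generalize f (feature γ y.1 y.2 v) = b
  nlinarith [sq_nonneg (a ^ 2 - b ^ 2)]

/-- The covariance of `z_u z_v`-products with the squared norms, bounded below through the
first harmonic. -/
lemma integral_weighted_mul_ge (hf : Measurable f) (hfC : ∀ z, |f z| ≤ C)
    (h0 : ∫ z, f z ∂arcsine = 0) {s x p q F : ℝ} (hs : ∫ z, f z ^ 2 ∂arcsine = s)
    (hx : ∫ z, (f z ^ 2 - s) ^ 2 ∂arcsine = x) (hp : ∫ z, f z * z ∂arcsine = p)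
    (hq : ∫ z, (f z ^ 2 - s) * (f z * z) ∂arcsine = q)
    (hF : ∫ z, (f z ^ 2 - s) ^ 2 * f z ^ 2 ∂arcsine = F) :
    kernel γ u v * (2 * (p + q) ^ 2 - (s - 2 * x + F)) ≤
      2 * ∫ y, (f (feature γ y.1 y.2 u) ^ 2 + f (feature γ y.1 y.2 v) ^ 2 - 2 * s) *
        (f (feature γ y.1 y.2 u) * f (feature γ y.1 y.2 v)) ∂(drawLaw d) := by
  have bf : BddMeas f arcsine := .of_forall hf hfC
  have bh : BddMeas (fun z => f z ^ 2 - s) arcsine := (bf.pow 2).sub (.const s)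
  have bz := bddMeas_id_arcsine
  have z0 : ∫ z, z ∂arcsine = 0 := by
    rw [integral_arcsine (f := fun z => z) measurable_id]; simp
  -- Subtracting k centres the correction, as the upper correlation bound requires. It does not
  -- affect the first harmonic, since z is centred.
  set k : ℝ := ∫ z, (f z ^ 2 - s) * f z ∂arcsine with hk
  have hCk : ∀ z, |(f z ^ 2 - s) * f z - k| ≤ (C ^ 2 + |s|) * C + |k| := fun z => by
    refine (abs_sub _ _).trans ?_
    rw [abs_mul]
    have h1 : |f z ^ 2 - s| ≤ C ^ 2 + |s| := by
      refine (abs_sub _ _).trans ?_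
      rw [abs_pow]
      gcongr
      exact hfC z
    gcongr
    exact hfC z
  have hmk : Measurable fun z => (f z ^ 2 - s) * f z - k := by fun_prop
  -- The plus combination gets the lower bound by the first harmonic; the minus combination gets the
  -- upper bound by its second moment. Their difference bounds the weighted correlation from below.
  have h1 := integral_feature_mul_self_ge γ u v (f := fun z => f z + ((f z ^ 2 - s) * f z - k))
    (hf.add hmk) (C := C + ((C ^ 2 + |s|) * C + |k|))
    (fun z => (abs_add_le _ _).trans (add_le_add (hfC z) (hCk z)))
  have h2 := integral_feature_mul_self_le γ u v (f := fun z => f z - ((f z ^ 2 - s) * f z - k))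
    (hf.sub hmk) (C := C + ((C ^ 2 + |s|) * C + |k|))
    (fun z => (abs_sub _ _).trans (add_le_add (hfC z) (hCk z)))
    (by
      rw [integral_sub bf.integrable ((bh.mul bf).sub (.const k)).integrable,
        integral_sub (bh.mul bf).integrable (BddMeas.const k).integrable, h0, ← hk]
      simp)
  have e1 : ∫ z, (f z + ((f z ^ 2 - s) * f z - k)) * z ∂arcsine = p + q := by
    have e : ∀ z, (f z + ((f z ^ 2 - s) * f z - k)) * z =
        f z * z + (f z ^ 2 - s) * (f z * z) - k * z := fun z => by ring
    simp_rw [e]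
    rw [integral_sub ((bf.mul bz).add (bh.mul (bf.mul bz))).integrable
      (bz.integrable.const_mul k), integral_add (bf.mul bz).integrable
      (bh.mul (bf.mul bz)).integrable, integral_const_mul, z0, hp, hq]
    ring
  have e2 : ∫ z, (f z - ((f z ^ 2 - s) * f z - k)) ^ 2 ∂arcsine = s - 2 * x + F - k ^ 2 := by
    have e : ∀ z, (f z - ((f z ^ 2 - s) * f z - k)) ^ 2 =
        f z ^ 2 - 2 * (f z ^ 2 - s) ^ 2 - 2 * s * (f z ^ 2 - s) + 2 * k * f z
          + (f z ^ 2 - s) ^ 2 * f z ^ 2 - 2 * k * ((f z ^ 2 - s) * f z) + k ^ 2 := fun z => by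
      ring
    simp_rw [e]
    have b2 := (bf.pow 2).integrable
    have bx := (bh.pow 2).integrable
    have bs := bh.integrable
    have bF := ((bh.pow 2).mul (bf.pow 2)).integrable
    have bk := (bh.mul bf).integrable
    have b1 := bf.integrable
    have hh0 : ∫ z, (f z ^ 2 - s) ∂arcsine = 0 := by
      rw [integral_sub b2 (integrable_const _), hs]; simp
    rw [integral_add (by fun_prop) (by fun_prop), integral_sub (by fun_prop) (by fun_prop),
      integral_add (by fun_prop) (by fun_prop), integral_add (by fun_prop) (by fun_prop),
      integral_sub (by fun_prop) (by fun_prop), integral_sub (by fun_prop) (by fun_prop),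
      integral_const_mul, integral_const_mul, integral_const_mul, integral_const_mul, hs, hx, hh0,
      h0, hF, ← hk]
    simp
    ring
  rw [e1] at h1
  rw [e2] at h2
  have bA : ∀ u' : EuclideanSpace ℝ (Fin d),
      BddMeas (fun y => f (feature γ y.1 y.2 u')) (drawLaw d) := fun u' =>
    .of_forall (hf.comp (measurable_feature γ u')) fun y => hfC _
  have z1 : ∀ u' : EuclideanSpace ℝ (Fin d),
      ∫ y, f (feature γ y.1 y.2 u') ∂(drawLaw d) = 0 := fun u' => by
    rw [integral_feature u' hf hfC, h0]
  have hdiff := polarization_weighted (bA u) (bA v) (z1 u) (z1 v) s k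
  nlinarith [kernel_pos γ u v, sq_nonneg k, mul_nonneg (kernel_pos γ u v).le (sq_nonneg k)]

/-- The moment inequality behind the comparison of the two estimators. -/
lemma normalized_moment_inequality (hf : Measurable f) (hfC : ∀ z, |f z| ≤ C)
    (h0 : ∫ z, f z ∂arcsine = 0) {s p q F : ℝ} (hs : ∫ z, f z ^ 2 ∂arcsine = s) (hs0 : 0 < s)
    (hp : ∫ z, f z * z ∂arcsine = p)
    (hq : ∫ z, (f z ^ 2 - s) * (f z * z) ∂arcsine = q)
    (hF : ∫ z, (f z ^ 2 - s) ^ 2 * f z ^ 2 ∂arcsine = F) (hlt : s + F < 2 * (p + q) ^ 2) :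
    (∫ y, f (feature γ y.1 y.2 u) * f (feature γ y.1 y.2 v) ∂(drawLaw d)) *
      (∫ y, (f (feature γ y.1 y.2 u) ^ 2 + f (feature γ y.1 y.2 v) ^ 2 - 2 * s) ^ 2 ∂(drawLaw d)) <
    4 * s * ∫ y, (f (feature γ y.1 y.2 u) ^ 2 + f (feature γ y.1 y.2 v) ^ 2 - 2 * s) *
        (f (feature γ y.1 y.2 u) * f (feature γ y.1 y.2 v)) ∂(drawLaw d) := by
  have h1 := integral_weighted_mul_ge γ u v hf hfC h0 hs rfl hp hq hF
  have h2 := integral_sq_add_sub_le γ u v hf hfC (s := s)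
  have h3 := integral_feature_mul_self_le γ u v hf hfC h0
  rw [hs] at h3
  have hx : 0 ≤ ∫ z, (f z ^ 2 - s) ^ 2 ∂arcsine := integral_nonneg fun z => sq_nonneg _
  have hY : 0 ≤ ∫ y, (f (feature γ y.1 y.2 u) ^ 2 + f (feature γ y.1 y.2 v) ^ 2 - 2 * s) ^ 2
      ∂(drawLaw d) := integral_nonneg fun z => sq_nonneg _
  have hK := kernel_pos γ u v
  generalize (∫ y, f (feature γ y.1 y.2 u) * f (feature γ y.1 y.2 v) ∂(drawLaw d)) = c at *
  generalize (∫ y, (f (feature γ y.1 y.2 u) ^ 2 + f (feature γ y.1 y.2 v) ^ 2 - 2 * s) ^ 2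
    ∂(drawLaw d)) = Y at *
  generalize (∫ y, (f (feature γ y.1 y.2 u) ^ 2 + f (feature γ y.1 y.2 v) ^ 2 - 2 * s) *
        (f (feature γ y.1 y.2 u) * f (feature γ y.1 y.2 v)) ∂(drawLaw d)) = X at *
  generalize (∫ z, (f z ^ 2 - s) ^ 2 ∂arcsine) = x at *
  generalize kernel γ u v = K at *
  have h4 : c * Y ≤ K * s * Y := mul_le_mul_of_nonneg_right h3 hY
  have h5 : K * s * Y ≤ K * s * (4 * x) := mul_le_mul_of_nonneg_left h2 (by positivity)
  -- The moment condition says exactly that the lower bound for 2X exceeds 2Kx; together with cY ≤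
  -- 4Ksx this closes the estimate.
  have h6 : K * (2 * x) < 2 * X :=
    (mul_lt_mul_of_pos_left (by linarith) hK).trans_le h1
  have h7 : s * (K * (2 * x)) < s * (2 * X) := mul_lt_mul_of_pos_left h6 hs0
  linarith

end Core

/-! ### From the moment condition to the estimators -/

section Comparison

variable {Ω : Type*} [MeasurableSpace Ω] {P : Measure Ω}
  {d : ℕ} {w : ℕ → Ω → EuclideanSpace ℝ (Fin d)} {τ : ℕ → Ω → ℝ} {n : ℕ}

lemma Quantizer.measurableSet_cell (Q : Quantizer n) (i : Fin n) : MeasurableSet (Q.cell i) := by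
  have : Q.cell i = (Set.Ioi (Q.t i.castSucc) ∪ {x | i.val = 0 ∧ x = -1}) ∩ Set.Iic (Q.t i.succ) := by
    ext x; simp [Quantizer.cell]
  rw [this]
  refine (measurableSet_Ioi.union ?_).inter measurableSet_Iic
  by_cases h : i.val = 0
  · simp [h]
  · simp [h]

lemma Quantizer.measurable_val (Q : Quantizer n) : Measurable Q.val := by
  unfold Quantizer.val
  exact Finset.measurable_fun_sum _ fun i _ =>
    measurable_const.indicator (Q.measurableSet_cell i)

lemma Quantizer.abs_val_le (Q : Quantizer n) (x : ℝ) : |Q.val x| ≤ ∑ i, |Q.level i| := by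
  unfold Quantizer.val
  refine (Finset.abs_sum_le_sum_abs _ _).trans (Finset.sum_le_sum fun i _ => ?_)
  by_cases h : x ∈ Q.cell i
  · rw [Set.indicator_of_mem h]
  · rw [Set.indicator_of_notMem h, abs_zero]; positivity

lemma dbVariance_const_mul {X : Ω → ℝ} {c : ℝ} (hc : c ≠ 0) (K : ℝ) :
    dbVariance P (fun ω => c * X ω) K = dbVariance P X K := by
  rw [dbVariance, dbVariance, variance_const_mul, integral_const_mul]
  rw [mul_pow, mul_assoc, mul_div_mul_left _ _ (by positivity)]

lemma tendsto_mul_dbVariance {W : ℕ → Ω → ℝ} {r V : ℝ} (K : ℝ) (hr : r ≠ 0)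
    (h1 : Tendsto (fun m => ∫ ω, W m ω ∂P) atTop (𝓝 r))
    (h2 : Tendsto (fun m : ℕ => (m : ℝ) * variance (W m) P) atTop (𝓝 V)) :
    Tendsto (fun m : ℕ => (m : ℝ) * dbVariance P (W m) K) atTop (𝓝 (V * K ^ 2 / r ^ 2)) := by
  have h := (h2.mul_const (K ^ 2)).div (h1.pow 2) (pow_ne_zero 2 hr)
  refine h.congr fun m => ?_
  rw [dbVariance]
  simp only [Pi.div_apply]
  ring

/-- Comparison of the simple and the normalized estimator for a quantizer with a centred and
informative output, under the moment condition `s + F < 2 (p + q)²` or for a constant `Q²`. -/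
theorem estimator_comparison [IsProbabilityMeasure P] (hsample : IsSample P w τ) (Q : Quantizer n) (γ : ℝ)
    (u v : EuclideanSpace ℝ (Fin d)) (h0 : ∫ z, Q.val z ∂arcsine = 0) {s p : ℝ}
    (hs : ∫ z, Q.val z ^ 2 ∂arcsine = s) (hp : ∫ z, Q.val z * z ∂arcsine = p) (hp0 : 0 < p)
    (hcase : (∀ z ∈ Set.Icc (-1 : ℝ) 1, Q.val z ^ 2 = s) ∨
      s + (∫ z, (Q.val z ^ 2 - s) ^ 2 * Q.val z ^ 2 ∂arcsine) <
        2 * (p + ∫ z, (Q.val z ^ 2 - s) * (Q.val z * z) ∂arcsine) ^ 2) :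
    (∀ᶠ m : ℕ in atTop,
      0 < (∫ ω, simpleEst γ w τ Q u v m ω ∂P) ∧ 0 < (∫ ω, normEst γ w τ Q u v m ω ∂P)) ∧
    (∀ᶠ m : ℕ in atTop,
      dbVariance P (normEst γ w τ Q u v m) (kernel γ u v) ≤
        dbVariance P (simpleEst γ w τ Q u v m) (kernel γ u v)) ∧
    (∃ Vn Vs : ℝ,
      Tendsto (fun m : ℕ =>
        (m : ℝ) * dbVariance P (normEst γ w τ Q u v m) (kernel γ u v)) atTop (𝓝 Vn) ∧
      Tendsto (fun m : ℕ =>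
        (m : ℝ) * dbVariance P (simpleEst γ w τ Q u v m) (kernel γ u v)) atTop (𝓝 Vs) ∧
      Vn ≤ Vs) := by
  have hf := Q.measurable_val
  have hfC := Q.abs_val_le
  set C := ∑ i, |Q.level i|
  set K := kernel γ u v with hKdef
  have hK : 0 < K := kernel_pos γ u v
  set A : EuclideanSpace ℝ (Fin d) × ℝ → ℝ := fun y => Q.val (feature γ y.1 y.2 u) with hA
  set B : EuclideanSpace ℝ (Fin d) × ℝ → ℝ := fun y => Q.val (feature γ y.1 y.2 v) with hB
  have mA : Measurable A := hf.comp (measurable_feature γ u)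
  have mB : Measurable B := hf.comp (measurable_feature γ v)
  have cA : ∀ y, |A y| ≤ C := fun y => hfC _
  have cB : ∀ y, |B y| ≤ C := fun y => hfC _
  have bA : BddMeas A (drawLaw d) := .of_forall mA cA
  have bB : BddMeas B (drawLaw d) := .of_forall mB cB
  have b2 : ∀ z, |Q.val z ^ 2| ≤ C ^ 2 := fun z => by
    rw [abs_pow]; exact pow_le_pow_left₀ (abs_nonneg _) (hfC z) 2
  have sA : ∫ y, A y ^ 2 ∂(drawLaw d) = s := by
    rw [← hs, ← integral_feature (γ := γ) u (hf.pow_const 2) b2]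
  have sB : ∫ y, B y ^ 2 ∂(drawLaw d) = s := by
    rw [← hs, ← integral_feature (γ := γ) v (hf.pow_const 2) b2]
  set c := ∫ y, A y * B y ∂(drawLaw d) with hc
  have hc_ge := integral_feature_mul_self_ge γ u v hf hfC
  have hc_le := integral_feature_mul_self_le γ u v hf hfC h0
  rw [hp] at hc_ge
  rw [hs] at hc_le
  change 2 * K * p ^ 2 ≤ c at hc_ge
  change c ≤ K * s at hc_le
  have hc0 : 0 < c := lt_of_lt_of_le (by positivity) hc_ge
  have hs0 : 0 < s := pos_of_mul_pos_right (hc0.trans_le hc_le) hK.le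
  have hYlaw := hsample.hasLaw_draw
  set r := c / s with hr
  have hr0 : 0 < r := by positivity
  have hrs : c = r * s := by rw [hr]; field_simp
  have cAB : ∀ y, |A y * B y| ≤ C * C := fun y => by
    rw [abs_mul]
    exact mul_le_mul (cA y) (cB y) (abs_nonneg _) ((abs_nonneg _).trans (cA y))
  obtain ⟨hmean, hvar⟩ := tendsto_normRatio hYlaw hsample.indep mA mB cA cB hs0 sA sB
    (r := r) (hc.symm.trans hrs) (W := fun m ω => normEst γ w τ Q u v m ω) (fun m ω => rfl)
  have hsimple : ∀ m : ℕ, 1 ≤ m → _ := fun m hm =>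
    mean_variance_twice_mean hYlaw hsample.indep (mA.mul mB) cAB hm (c := c) rfl
      (W := simpleEst γ w τ Q u v m) (fun ω => rfl)
  have hpos : ∀ᶠ m : ℕ in atTop,
      0 < (∫ ω, simpleEst γ w τ Q u v m ω ∂P) ∧ 0 < (∫ ω, normEst γ w τ Q u v m ω ∂P) := by
    filter_upwards [eventually_ge_atTop 1, hmean.eventually_const_lt hr0] with m hm h2
    exact ⟨by rw [(hsimple m hm).1]; positivity, h2⟩
  have hVn := tendsto_mul_dbVariance K hr0.ne' hmean hvar
  set Z := ∫ y, (A y * B y - c) ^ 2 ∂(drawLaw d) with hZ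
  have hVs : Tendsto (fun m : ℕ => (m : ℝ) * dbVariance P (simpleEst γ w τ Q u v m) K)
      atTop (𝓝 (Z * K ^ 2 / c ^ 2)) := by
    refine tendsto_const_nhds.congr' ?_
    filter_upwards [eventually_ge_atTop 1] with m hm
    have hm0 : (0 : ℝ) < m := by exact_mod_cast hm
    rw [dbVariance, (hsimple m hm).1, (hsimple m hm).2]
    field_simp
    norm_num
    rw [hZ, mul_comm]
  refine ⟨hpos, ?_⟩
  rcases hcase with hconst | hlt
  · have heq : ∀ m : ℕ, 1 ≤ m → dbVariance P (normEst γ w τ Q u v m) K =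
        dbVariance P (simpleEst γ w τ Q u v m) K := by
      intro m hm
      have hm0 : (0 : ℝ) < m := by exact_mod_cast hm
      -- If Q² is constantly s, both norms equal √(ms) and the normalization is the deterministic
      -- factor 1 / (2s), which debiasing cancels.
      have e : normEst γ w τ Q u v m = fun ω => (1 / (2 * s)) * simpleEst γ w τ Q u v m ω := by
        ext ω
        have hsq : ∀ u' : EuclideanSpace ℝ (Fin d), ∑ i ∈ Finset.range m,
            Q.val (feature γ (w i ω) (τ i ω) u') ^ 2 = m * s := fun u' => by
          have : ∀ i, Q.val (feature γ (w i ω) (τ i ω) u') ^ 2 = s := fun i =>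
            hconst _ ⟨Real.neg_one_le_cos _, Real.cos_le_one _⟩
          simp [this]
        rw [normEst, simpleEst, hsq, hsq, Real.mul_self_sqrt (by positivity)]
        field_simp
      rw [e, dbVariance_const_mul (by positivity)]
    have hev : ∀ᶠ m : ℕ in atTop, dbVariance P (normEst γ w τ Q u v m) K =
        dbVariance P (simpleEst γ w τ Q u v m) K := by
      filter_upwards [eventually_ge_atTop 1] with m hm using heq m hm
    refine ⟨hev.mono fun m h => h.le, _, _, hVs.congr' ?_, hVs, le_rfl⟩
    filter_upwards [hev] with m hm
    rw [hm]
  · have key := normalized_moment_inequality γ u v hf hfC h0 hs hs0 hp rfl rfl hlt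
    have hV : (∫ y, ((A y * B y - r * (A y ^ 2 + B y ^ 2) / 2) / s) ^ 2 ∂(drawLaw d)) * K ^ 2 / r ^ 2
        < Z * K ^ 2 / c ^ 2 := by
      have bH : BddMeas (fun y => A y ^ 2 + B y ^ 2 - 2 * s) (drawLaw d) :=
        ((bA.pow 2).add (bB.pow 2)).sub (.const _)
      have bAB := bA.mul bB
      have hH0 : ∫ y, (A y ^ 2 + B y ^ 2 - 2 * s) ∂(drawLaw d) = 0 := by
        rw [integral_sub ((bA.pow 2).add (bB.pow 2)).integrable (integrable_const _),
          integral_add (bA.pow 2).integrable (bB.pow 2).integrable, sA, sB]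
        simp
        ring
      -- Since rs = c, the linearized summand is ((AB - c) - rH/2) / s with H = A² + B² - 2s
      -- centred.
      have e : ∀ y, ((A y * B y - r * (A y ^ 2 + B y ^ 2) / 2) / s) ^ 2 =
          ((A y * B y - c) ^ 2 - r * ((A y ^ 2 + B y ^ 2 - 2 * s) * (A y * B y))
            + r * c * (A y ^ 2 + B y ^ 2 - 2 * s)
            + r ^ 2 / 4 * (A y ^ 2 + B y ^ 2 - 2 * s) ^ 2) / s ^ 2 := fun y => by
        rw [hrs, div_pow]
        congr 1
        ring
      simp_rw [e]
      have i1 := ((bAB.sub (.const c)).pow 2).integrable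
      have i2 := (bH.mul bAB).integrable
      have i3 := bH.integrable
      have i4 := (bH.pow 2).integrable
      rw [integral_div, integral_add (by fun_prop) (by fun_prop),
        integral_add (by fun_prop) (by fun_prop), integral_sub (by fun_prop) (by fun_prop),
        integral_const_mul, integral_const_mul, integral_const_mul, hH0, ← hZ]
      change c * (∫ y, (A y ^ 2 + B y ^ 2 - 2 * s) ^ 2 ∂(drawLaw d)) <
        4 * s * ∫ y, (A y ^ 2 + B y ^ 2 - 2 * s) * (A y * B y) ∂(drawLaw d) at key
      generalize (∫ y, (A y ^ 2 + B y ^ 2 - 2 * s) ^ 2 ∂(drawLaw d)) = Y at *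
      generalize (∫ y, (A y ^ 2 + B y ^ 2 - 2 * s) * (A y * B y) ∂(drawLaw d)) = X at *
      have e2 : (Z - r * X + r * c * 0 + r ^ 2 / 4 * Y) / s ^ 2 * K ^ 2 / r ^ 2 =
          Z * K ^ 2 / c ^ 2 - (4 * s * X - c * Y) * (K ^ 2 / (4 * s ^ 2 * c)) := by
        rw [hr]
        field_simp
        ring
      rw [e2]
      have : 0 < (4 * s * X - c * Y) * (K ^ 2 / (4 * s ^ 2 * c)) :=
        mul_pos (by linarith) (by positivity)
      linarith
    refine ⟨?_, _, _, hVn, hVs, hV.le⟩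
    -- A value strictly between the two limits separates the sequences from some m on; this is where
    -- strictness of the moment condition is needed.
    obtain ⟨M, hM1, hM2⟩ := exists_between hV
    filter_upwards [eventually_ge_atTop 1, hVn.eventually_lt_const hM1,
      hVs.eventually_const_lt hM2] with m hm h1 h2
    have hm0 : (0 : ℝ) < m := by exact_mod_cast hm
    exact (lt_of_mul_lt_mul_left (h1.trans h2) hm0.le).le

end Comparison

/-! ### Cells of a quantizer and their moments -/

section Cells

variable {n : ℕ} (Q : Quantizer n)

lemma Quantizer.t_mem_Icc (i : Fin (n + 1)) : Q.t i ∈ Set.Icc (-1 : ℝ) 1 := by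
  rw [← Q.t_first, ← Q.t_last]
  exact ⟨Q.t_strictMono.monotone (Fin.zero_le i), Q.t_strictMono.monotone (Fin.le_last i)⟩

lemma Quantizer.cell_subset_Icc (i : Fin n) : Q.cell i ⊆ Set.Icc (-1) 1 := by
  rintro x ⟨h1, h2⟩
  refine ⟨?_, h2.trans (Q.t_mem_Icc _).2⟩
  rcases h1 with h1 | h1
  · exact (Q.t_mem_Icc _).1.trans h1.le
  · exact h1.2.ge

lemma Quantizer.eq_of_mem_cell {i j : Fin n} {x : ℝ} (hi : x ∈ Q.cell i) (hj : x ∈ Q.cell j) :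
    i = j := by
  have key : ∀ i j : Fin n, x ∈ Q.cell i → x ∈ Q.cell j → ¬ i < j := by
    rintro i j ⟨-, h1⟩ ⟨h2, -⟩ hij
    rcases h2 with h2 | h2
    · have : Q.t i.succ ≤ Q.t j.castSucc :=
        Q.t_strictMono.monotone (Fin.succ_le_castSucc_iff.2 hij)
      linarith
    · have : i.val < j.val := hij
      omega
  exact le_antisymm (not_lt.1 (key j i hj hi)) (not_lt.1 (key i j hi hj))

/-- The cell is the first one whose right border is at least x; minimality puts x beyond its left
border. -/
lemma Quantizer.exists_mem_cell {x : ℝ} (hx : x ∈ Set.Icc (-1 : ℝ) 1) : ∃ i, x ∈ Q.cell i := by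
  have hn : n ≠ 0 := by
    rintro rfl
    have h1 := Q.t_first
    have h2 := Q.t_last
    rw [show Fin.last 0 = 0 from rfl, h1] at h2
    norm_num at h2
  obtain ⟨k, rfl⟩ := Nat.exists_eq_succ_of_ne_zero hn
  have hne : (Finset.univ.filter fun i : Fin (k + 1) => x ≤ Q.t i.succ).Nonempty :=
    ⟨Fin.last k, by
      simp only [Finset.mem_filter, Finset.mem_univ, true_and]
      rw [Fin.succ_last, Q.t_last]; exact hx.2⟩
  set i := (Finset.univ.filter fun i : Fin (k + 1) => x ≤ Q.t i.succ).min' hne with hi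
  have h1 := Finset.min'_mem _ hne
  rw [← hi] at h1
  simp only [Finset.mem_filter, Finset.mem_univ, true_and] at h1
  refine ⟨i, ?_, h1⟩
  by_cases h0 : i.val = 0
  · rcases hx.1.eq_or_lt with h | h
    · exact Or.inr ⟨h0, h.symm⟩
    · left
      have : i.castSucc = 0 := by ext; simpa using h0
      rwa [this, Q.t_first]
  · left
    by_contra hc
    push Not at hc
    set j : Fin (k + 1) := ⟨i.val - 1, by omega⟩ with hj
    have hji : j.succ = i.castSucc := by
      ext; simp [hj]; omega
    have hmem : j ∈ Finset.univ.filter fun i : Fin (k + 1) => x ≤ Q.t i.succ := by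
      simp only [Finset.mem_filter, Finset.mem_univ, true_and]
      rwa [hji]
    have := Finset.min'_le _ _ hmem
    rw [← hi, Fin.le_def] at this
    simp [hj] at this
    omega

lemma Quantizer.val_eq_of_mem {i : Fin n} {x : ℝ} (hx : x ∈ Q.cell i) : Q.val x = Q.level i := by
  unfold Quantizer.val
  rw [Finset.sum_eq_single i, Set.indicator_of_mem hx]
  · intro j _ hj
    rw [Set.indicator_of_notMem]
    exact fun h => hj (Q.eq_of_mem_cell h hx)
  · simp

lemma Quantizer.exists_val_eq {x : ℝ} (hx : x ∈ Set.Icc (-1 : ℝ) 1) :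
    ∃ i, x ∈ Q.cell i ∧ Q.val x = Q.level i := by
  obtain ⟨i, hi⟩ := Q.exists_mem_cell hx
  exact ⟨i, hi, Q.val_eq_of_mem hi⟩

lemma Quantizer.bddMeas_val : BddMeas Q.val arcsine := .of_forall Q.measurable_val Q.abs_val_le

lemma Quantizer.integral_eq_sum_cell {F : ℝ → ℝ} (hF : BddMeas F arcsine) :
    ∫ z, F z ∂arcsine = ∑ i, ∫ z in Q.cell i, F z ∂arcsine := by
  have h : ∀ i ∈ (Finset.univ : Finset (Fin n)),
      Integrable ((Q.cell i).indicator F) arcsine := fun i _ =>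
    hF.integrable.indicator (Q.measurableSet_cell i)
  simp_rw [← fun i => integral_indicator (μ := arcsine) (f := F) (Q.measurableSet_cell i)]
  rw [← integral_finsetSum _ h]
  apply integral_congr_ae
  filter_upwards [ae_arcsine_mem_Icc] with z hz
  obtain ⟨i, hi⟩ := Q.exists_mem_cell hz
  rw [Finset.sum_eq_single i, Set.indicator_of_mem hi]
  · intro j _ hj
    rw [Set.indicator_of_notMem]
    exact fun h => hj (Q.eq_of_mem_cell h hi)
  · simp

/-- Cell-wise decomposition of an integral whose integrand involves the quantizer. -/
lemma Quantizer.integral_eq_sum_of_eq {F : ℝ → ℝ} (hF : BddMeas F arcsine) {G : Fin n → ℝ → ℝ}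
    (hG : ∀ i, ∀ z ∈ Q.cell i, F z = G i z) :
    ∫ z, F z ∂arcsine = ∑ i, ∫ z in Q.cell i, G i z ∂arcsine := by
  rw [Q.integral_eq_sum_cell hF]
  exact Finset.sum_congr rfl fun i _ => setIntegral_congr_fun (Q.measurableSet_cell i) (hG i)

/-- The moments of the arcsine law over a cell. -/
noncomputable def Quantizer.cellMoment (k : ℕ) (i : Fin n) : ℝ := ∫ z in Q.cell i, z ^ k ∂arcsine

lemma arcsine_singleton_neg_one : arcsine {(-1 : ℝ)} = 0 := by
  rw [arcsine, Measure.map_apply Real.measurable_cos (measurableSet_singleton _),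
    Measure.smul_apply, Measure.restrict_apply (Real.measurable_cos (measurableSet_singleton _))]
  have : Real.cos ⁻¹' {-1} ∩ Set.Ioc 0 Real.pi ⊆ {Real.pi} := by
    rintro θ ⟨h1, h2⟩
    exact Real.injOn_cos ⟨h2.1.le, h2.2⟩ ⟨Real.pi_pos.le, le_rfl⟩ (by
      rw [Real.cos_pi]; exact h1)
  rw [measure_mono_null this (by simp)]
  simp

/-- In the angle a cell is an interval with reversed orientation. The extra end point -1 of the
first cell has arcsine measure zero. -/
lemma Quantizer.setIntegral_cell {F : ℝ → ℝ} (hF : Measurable F) (i : Fin n) :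
    ∫ z in Q.cell i, F z ∂arcsine = Real.pi⁻¹ *
      ∫ θ in Real.arccos (Q.t i.succ)..Real.arccos (Q.t i.castSucc), F (Real.cos θ) := by
  have h1 := Q.t_mem_Icc i.succ
  have h2 := Q.t_mem_Icc i.castSucc
  have hlt : Q.t i.castSucc < Q.t i.succ := Q.t_strictMono Fin.castSucc_lt_succ
  rw [← setIntegral_arcsine hF (Real.arccos_nonneg _) (Real.arccos_le_arccos hlt.le)
    (Real.arccos_le_pi _), Real.cos_arccos h1.1 h1.2, Real.cos_arccos h2.1 h2.2]
  apply setIntegral_congr_set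
  have h3 : ∀ᵐ z ∂arcsine, z ≠ -1 := by
    rw [ae_iff]; simpa using arcsine_singleton_neg_one
  filter_upwards [h3] with z hz
  refine propext (?_ : z ∈ Q.cell i ↔ z ∈ Set.Ioc (Q.t i.castSucc) (Q.t i.succ))
  simp [Quantizer.cell, hz]

lemma Quantizer.cellMoment_zero (i : Fin n) : Q.cellMoment 0 i = Real.pi⁻¹ *
    (Real.arccos (Q.t i.castSucc) - Real.arccos (Q.t i.succ)) := by
  rw [cellMoment, Q.setIntegral_cell (F := fun z => z ^ 0) (measurable_id.pow_const 0)]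
  simp

lemma Quantizer.cellMoment_one (i : Fin n) : Q.cellMoment 1 i = Real.pi⁻¹ *
    (Real.sin (Real.arccos (Q.t i.castSucc)) - Real.sin (Real.arccos (Q.t i.succ))) := by
  rw [cellMoment, Q.setIntegral_cell (F := fun z => z ^ 1) (measurable_id.pow_const 1)]
  simp

lemma Quantizer.cellMoment_zero_pos (i : Fin n) : 0 < Q.cellMoment 0 i := by
  rw [Q.cellMoment_zero]
  have h1 := Q.t_mem_Icc i.succ
  have h2 := Q.t_mem_Icc i.castSucc
  have := Real.strictAntiOn_arccos h2 h1 (Q.t_strictMono Fin.castSucc_lt_succ)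
  have := Real.pi_pos
  have : 0 < Real.arccos (Q.t i.castSucc) - Real.arccos (Q.t i.succ) := by linarith
  positivity

lemma integrableOn_cell {F : ℝ → ℝ} (hF : BddMeas F arcsine) (s : Set ℝ) :
    IntegrableOn F s arcsine := hF.integrable.integrableOn

lemma bddMeas_pow_arcsine (k : ℕ) : BddMeas (fun z : ℝ => z ^ k) arcsine := bddMeas_id_arcsine.pow k

lemma integral_cos_pow_four : ∫ θ in (0 : ℝ)..Real.pi, Real.cos θ ^ 4 = 3 / 8 * Real.pi := by
  have := integral_cos_pow (a := 0) (b := Real.pi) 2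
  norm_num [integral_cos_sq] at this ⊢
  rw [this]
  ring

lemma arcsine_moment_one : ∫ z, z ∂arcsine = 0 := by
  rw [integral_arcsine (f := fun z => z) measurable_id]; simp

lemma arcsine_moment_two : ∫ z, z ^ 2 ∂arcsine = 1 / 2 := by
  rw [integral_arcsine (f := fun z => z ^ 2) (measurable_id.pow_const 2)]
  have := Real.pi_pos
  simp [integral_cos_sq]
  field_simp

lemma arcsine_moment_four : ∫ z, z ^ 4 ∂arcsine = 3 / 8 := by
  rw [integral_arcsine (f := fun z => z ^ 4) (measurable_id.pow_const 4)]
  have := Real.pi_pos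
  rw [integral_cos_pow_four]
  field_simp

/-- The centroid condition implies that `z` may be replaced by `Q z` against functions of `Q z`. -/
lemma Quantizer.integral_comp_val_mul_pow {k : ℕ} {c : Fin n → ℝ}
    (hc : ∀ i, Q.cellMoment k i = c i * Q.cellMoment 0 i) {φ ψ : ℝ → ℝ}
    (hφ : BddMeas (fun z => φ (Q.val z)) arcsine) (hψ : BddMeas (fun z => ψ (Q.val z)) arcsine)
    (hψc : ∀ i, ψ (Q.level i) = c i) :
    ∫ z, φ (Q.val z) * z ^ k ∂arcsine = ∫ z, φ (Q.val z) * ψ (Q.val z) ∂arcsine := by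
  rw [Q.integral_eq_sum_of_eq (hφ.mul (bddMeas_pow_arcsine k))
      (G := fun i z => φ (Q.level i) * z ^ k)
      (fun i z hz => by rw [Q.val_eq_of_mem hz]),
    Q.integral_eq_sum_of_eq (hφ.mul hψ) (G := fun i z => φ (Q.level i) * c i * z ^ 0)
      (fun i z hz => by rw [Q.val_eq_of_mem hz, hψc]; simp)]
  refine Finset.sum_congr rfl fun i _ => ?_
  rw [integral_const_mul, integral_const_mul]
  change _ * Q.cellMoment k i = _ * Q.cellMoment 0 i
  rw [hc]; ring

lemma distortion_eq : distortion Q = ∫ z, (z - Q.val z) ^ 2 ∂arcsine :=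
  integral_mul_density ((measurable_id.sub Q.measurable_val).pow_const 2)

lemma distortionSq_eq : distortionSq Q = ∫ z, (z ^ 2 - Q.val z ^ 2) ^ 2 ∂arcsine :=
  integral_mul_density
    (((measurable_id.pow_const 2).sub (Q.measurable_val.pow_const 2)).pow_const 2)

/-- The mean squared error against `z ^ k` of a function of the quantizer, cell by cell. -/
lemma Quantizer.integral_sq_sub_eq_sum (k : ℕ) {ψ : ℝ → ℝ}
    (hψ : BddMeas (fun z => ψ (Q.val z)) arcsine) :
    ∫ z, (z ^ k - ψ (Q.val z)) ^ 2 ∂arcsine = ∑ i, (Q.cellMoment (2 * k) i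
      - 2 * ψ (Q.level i) * Q.cellMoment k i + ψ (Q.level i) ^ 2 * Q.cellMoment 0 i) := by
  rw [Q.integral_eq_sum_of_eq (((bddMeas_pow_arcsine k).sub hψ).pow 2)
    (G := fun i z => z ^ (2 * k) - 2 * ψ (Q.level i) * z ^ k + ψ (Q.level i) ^ 2 * z ^ 0)
    (fun i z hz => by rw [Q.val_eq_of_mem hz]; ring)]
  refine Finset.sum_congr rfl fun i _ => ?_
  have h : ∀ k, Integrable (fun z : ℝ => z ^ k) (arcsine.restrict (Q.cell i)) := fun k =>
    integrableOn_cell (bddMeas_pow_arcsine k) (Q.cell i)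
  have h0 := h 0
  have h1 := h k
  have h2 := h (2 * k)
  rw [integral_add (by fun_prop) (by fun_prop), integral_sub (by fun_prop) (by fun_prop),
    integral_const_mul, integral_const_mul]
  rfl

end Cells

/-! ### Optimal levels are cell means -/

section Stationarity

variable {n : ℕ} {Q : Quantizer n}

/-- If replacing the levels by the cell means of `z ^ k` does not decrease the error, the levels
are the cell means. -/
lemma Quantizer.centroid_of_le {Q' : Quantizer n} (ht : Q'.t = Q.t) (k : ℕ) {ψ : ℝ → ℝ}
    (hψ : Continuous ψ) (hQ' : ∀ i, ψ (Q'.level i) = Q.cellMoment k i / Q.cellMoment 0 i)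
    (hle : ∫ z, (z ^ k - ψ (Q.val z)) ^ 2 ∂arcsine ≤ ∫ z, (z ^ k - ψ (Q'.val z)) ^ 2 ∂arcsine)
    (i : Fin n) : Q.cellMoment k i = ψ (Q.level i) * Q.cellMoment 0 i := by
  have hb : ∀ R : Quantizer n, BddMeas (fun z => ψ (R.val z)) arcsine := fun R => by
    refine ⟨hψ.measurable.comp R.measurable_val, ∑ i, |ψ (R.level i)|, ?_⟩
    filter_upwards [ae_arcsine_mem_Icc] with z hz
    obtain ⟨i, -, hi⟩ := R.exists_val_eq hz
    rw [hi]
    exact Finset.single_le_sum (f := fun i => |ψ (R.level i)|) (fun i _ => abs_nonneg _)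
      (Finset.mem_univ i)
  have hm : ∀ k i, Q'.cellMoment k i = Q.cellMoment k i := fun k i => by
    rw [cellMoment, cellMoment]
    have : Q'.cell i = Q.cell i := by unfold Quantizer.cell; rw [ht]
    rw [this]
  rw [Q.integral_sq_sub_eq_sum k (hb Q), Q'.integral_sq_sub_eq_sum k (hb Q'), ← sub_nonpos,
    ← Finset.sum_sub_distrib] at hle
  -- Completing the square: moving a level value to the cell mean lowers the error by the cell mass
  -- times the squared displacement. These gains are nonnegative, so optimality forces each to
  -- vanish.
  have e : ∀ i, (Q.cellMoment (2 * k) i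
      - 2 * ψ (Q.level i) * Q.cellMoment k i + ψ (Q.level i) ^ 2 * Q.cellMoment 0 i)
      - (Q'.cellMoment (2 * k) i
      - 2 * ψ (Q'.level i) * Q'.cellMoment k i + ψ (Q'.level i) ^ 2 * Q'.cellMoment 0 i) =
      Q.cellMoment 0 i * (ψ (Q.level i) - Q.cellMoment k i / Q.cellMoment 0 i) ^ 2 := fun i => by
    have h0 := (Q.cellMoment_zero_pos i).ne'
    rw [hm, hm, hm, hQ']
    field_simp
    ring
  simp_rw [e] at hle
  have hnn : ∀ i ∈ Finset.univ, 0 ≤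
      Q.cellMoment 0 i * (ψ (Q.level i) - Q.cellMoment k i / Q.cellMoment 0 i) ^ 2 := fun i _ =>
    mul_nonneg (Q.cellMoment_zero_pos i).le (sq_nonneg _)
  have h0 := (Finset.sum_eq_zero_iff_of_nonneg hnn).1
    (le_antisymm hle (Finset.sum_nonneg hnn)) i (Finset.mem_univ i)
  have hp := Q.cellMoment_zero_pos i
  have h1 : ψ (Q.level i) - Q.cellMoment k i / Q.cellMoment 0 i = 0 := by
    rcases mul_eq_zero.1 h0 with h | h
    · exact absurd h hp.ne'
    · exact pow_eq_zero_iff (two_ne_zero) |>.1 h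
  have h2 : ψ (Q.level i) = Q.cellMoment k i / Q.cellMoment 0 i := by linarith
  rw [h2]; field_simp

/-- The cell means `z ^ k` are at most one in absolute value. -/
lemma Quantizer.abs_cellMoment_le (Q : Quantizer n) (k : ℕ) (i : Fin n) :
    |Q.cellMoment k i| ≤ Q.cellMoment 0 i := by
  unfold Quantizer.cellMoment
  refine abs_integral_le_integral_abs.trans (setIntegral_mono_on
    (integrableOn_cell (bddMeas_pow_arcsine k).abs _)
    (integrableOn_cell (bddMeas_pow_arcsine 0) _) (Q.measurableSet_cell i) fun z hz => ?_)
  have := Q.cell_subset_Icc i hz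
  rw [pow_zero, abs_pow]
  exact pow_le_one₀ (abs_nonneg _) (abs_le.2 this)

end Stationarity

/-! ### Moment condition for LM-RFF quantizers -/

section LMRFF

variable {n : ℕ} {Q : Quantizer n}

lemma centroid_of_minimal (hQ : ∀ Q' : Quantizer n, distortion Q ≤ distortion Q') (i : Fin n) :
    Q.cellMoment 1 i = Q.level i * Q.cellMoment 0 i := by
  have hle := hQ { Q with level := fun i => Q.cellMoment 1 i / Q.cellMoment 0 i }
  rw [distortion_eq, distortion_eq] at hle
  exact Quantizer.centroid_of_le (Q := Q)
    (Q' := { Q with level := fun i => Q.cellMoment 1 i / Q.cellMoment 0 i }) rfl 1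
    continuous_id (fun i => rfl) (by simpa using hle) i

/-- The centroid condition makes Q(z) the conditional mean of z given its cell. -/
lemma integral_comp_val_mul_id_of_centroid (hc : ∀ i, Q.cellMoment 1 i = Q.level i * Q.cellMoment 0 i)
    {φ : ℝ → ℝ}
    (hφ : BddMeas (fun z => φ (Q.val z)) arcsine) :
    ∫ z, φ (Q.val z) * z ∂arcsine = ∫ z, φ (Q.val z) * Q.val z ∂arcsine := by
  have := Q.integral_comp_val_mul_pow hc hφ (ψ := fun x => x) Q.bddMeas_val (fun i => rfl)
  simpa using this

lemma integral_val_of_centroid (hc : ∀ i, Q.cellMoment 1 i = Q.level i * Q.cellMoment 0 i)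
    : ∫ z, Q.val z ∂arcsine = 0 := by
  have := integral_comp_val_mul_id_of_centroid hc (φ := fun _ => 1) (.const 1)
  simp only [one_mul] at this
  rw [← this, arcsine_moment_one]

lemma integral_val_mul_id_of_centroid (hc : ∀ i, Q.cellMoment 1 i = Q.level i * Q.cellMoment 0 i) :
    ∫ z, Q.val z * z ∂arcsine = ∫ z, Q.val z ^ 2 ∂arcsine := by
  rw [integral_comp_val_mul_id_of_centroid hc (φ := fun x => x) Q.bddMeas_val]
  simp_rw [sq]

lemma distortion_of_centroid (hc : ∀ i, Q.cellMoment 1 i = Q.level i * Q.cellMoment 0 i)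
    : distortion Q = 1 / 2 - ∫ z, Q.val z ^ 2 ∂arcsine := by
  have b1 := (bddMeas_pow_arcsine 2).integrable
  have b2 := (Q.bddMeas_val.mul bddMeas_id_arcsine).integrable
  have b3 := (Q.bddMeas_val.pow 2).integrable
  have e : ∀ z, (z - Q.val z) ^ 2 = z ^ 2 - 2 * (Q.val z * z) + Q.val z ^ 2 := fun z => by ring
  rw [distortion_eq]
  simp_rw [e]
  rw [integral_add (by fun_prop) b3, integral_sub b1 (by fun_prop), integral_const_mul,
    integral_val_mul_id_of_centroid hc, arcsine_moment_two]
  ring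

lemma abs_level_le_one_of_centroid (hc : ∀ i, Q.cellMoment 1 i = Q.level i * Q.cellMoment 0 i)
    (i : Fin n) : |Q.level i| ≤ 1 := by
  have h1 := Q.abs_cellMoment_le 1 i
  have h0 := Q.cellMoment_zero_pos i
  rw [hc, abs_mul, abs_of_pos h0] at h1
  exact le_of_mul_le_mul_right (by linarith) h0

/-- The error weighted by `1 - Q²` is at least the square of the distortion. -/
lemma sq_distortion_le_of_centroid (hc : ∀ i, Q.cellMoment 1 i = Q.level i * Q.cellMoment 0 i) :
    distortion Q ^ 2 ≤ ∫ z, (1 - Q.val z ^ 2) * (z - Q.val z) ^ 2 ∂arcsine := by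
  set δ := distortion Q with hδ
  set e : Fin n → ℝ := fun i => Q.cellMoment 2 i - Q.level i ^ 2 * Q.cellMoment 0 i with he
  have hcell : ∀ i, ∫ z in Q.cell i, (z - Q.level i) ^ 2 ∂arcsine = e i := fun i => by
    have h : ∀ k, Integrable (fun z : ℝ => z ^ k) (arcsine.restrict (Q.cell i)) := fun k =>
      integrableOn_cell (bddMeas_pow_arcsine k) (Q.cell i)
    have h0 := h 0
    have h1 := h 1
    have h2 := h 2
    have e1 : ∀ z : ℝ, (z - Q.level i) ^ 2 =
        z ^ 2 - 2 * Q.level i * z ^ 1 + Q.level i ^ 2 * z ^ 0 := fun z => by ring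
    simp_rw [e1]
    rw [integral_add (by fun_prop) (by fun_prop), integral_sub (by fun_prop) (by fun_prop),
      integral_const_mul, integral_const_mul]
    change Q.cellMoment 2 i - 2 * Q.level i * Q.cellMoment 1 i + Q.level i ^ 2 * Q.cellMoment 0 i
      = e i
    rw [hc, he]
    ring
  have bW : BddMeas (fun z => (z - Q.val z) ^ 2) arcsine := (bddMeas_id_arcsine.sub Q.bddMeas_val).pow 2
  have hδs : δ = ∑ i, e i := by
    rw [hδ, distortion_eq, Q.integral_eq_sum_of_eq bW (G := fun i z => (z - Q.level i) ^ 2)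
      (fun i z hz => by rw [Q.val_eq_of_mem hz])]
    exact Finset.sum_congr rfl fun i _ => hcell i
  have hmass : ∑ i, Q.cellMoment 0 i = 1 := by
    have := Q.integral_eq_sum_cell (bddMeas_pow_arcsine 0)
    simp only [pow_zero, integral_const, probReal_univ, smul_eq_mul, mul_one] at this
    rw [this]
    simp [Quantizer.cellMoment]
  rw [Q.integral_eq_sum_of_eq (((BddMeas.const 1).sub (Q.bddMeas_val.pow 2)).mul bW)
    (G := fun i z => (1 - Q.level i ^ 2) * (z - Q.level i) ^ 2)
    (fun i z hz => by rw [Q.val_eq_of_mem hz])]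
  simp_rw [integral_const_mul, hcell]
  -- Let m be the mass of a cell with level μ. Because z² ≤ 1, the cell error e is at most (1 -
  -- μ²)m, so (1 - μ²)e ≥ e²/m ≥ 2δe - δ²m. Summing with total mass 1 and total error δ gives δ², a
  -- Cauchy-Schwarz bound in tangent form.
  have hterm : ∀ i ∈ Finset.univ, 2 * δ * e i - δ ^ 2 * Q.cellMoment 0 i ≤
      (1 - Q.level i ^ 2) * e i := by
    intro i _
    have h0 := Q.cellMoment_zero_pos i
    have h2 := (le_abs_self _).trans (Q.abs_cellMoment_le 2 i)
    have he0 : 0 ≤ e i := by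
      rw [← hcell i]; exact integral_nonneg fun z => sq_nonneg _
    have he1 : e i ≤ (1 - Q.level i ^ 2) * Q.cellMoment 0 i := by
      simp only [he]; linarith
    generalize (1 - Q.level i ^ 2) = a at *
    generalize e i = b at *
    generalize Q.cellMoment 0 i = c at *
    have h3 : b * b / c ≤ a * b := by
      rw [div_le_iff₀ h0]
      nlinarith
    have h4 : 2 * δ * b - δ ^ 2 * c ≤ b * b / c := by
      rw [le_div_iff₀ h0]
      nlinarith [sq_nonneg (b - δ * c)]
    linarith
  refine le_trans (le_of_eq ?_) (Finset.sum_le_sum hterm)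
  rw [Finset.sum_sub_distrib, ← Finset.mul_sum, ← Finset.mul_sum, ← hδs, hmass]
  ring

lemma abs_val_le_one_of_centroid (hc : ∀ i, Q.cellMoment 1 i = Q.level i * Q.cellMoment 0 i)
    {z : ℝ} (hz : z ∈ Set.Icc (-1 : ℝ) 1) : |Q.val z| ≤ 1 := by
  obtain ⟨i, -, hi⟩ := Q.exists_val_eq hz
  rw [hi]
  exact abs_level_le_one_of_centroid hc i

/-- The Taylor expansion of z⁴ at a = Q(z) has a first-order term that integrates to zero by the
centroid condition. Its remainder (z - a)²(z² + 2az + 3a²) is at most (z - a)²(6 - 4(1 - a²)), and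
the error weighted by 1 - a² is at least the squared distortion. -/
lemma integral_val_pow_four_ge_of_centroid (hc : ∀ i, Q.cellMoment 1 i = Q.level i * Q.cellMoment 0 i)
    :
    3 / 8 - 6 * distortion Q + 4 * distortion Q ^ 2 ≤ ∫ z, Q.val z ^ 4 ∂arcsine := by
  have bQ := Q.bddMeas_val
  have bz := bddMeas_id_arcsine
  have bW : BddMeas (fun z => (z - Q.val z) ^ 2) arcsine := (bz.sub bQ).pow 2
  have i1 := (bQ.pow 4).integrable
  have i2 := ((bQ.pow 3).mul bz).integrable
  have i3 := bW.integrable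
  have i4 := (((BddMeas.const 1).sub (bQ.pow 2)).mul bW).integrable
  have h := sq_distortion_le_of_centroid hc
  have hle : ∫ z, z ^ 4 ∂arcsine ≤ ∫ z, Q.val z ^ 4 + (4 * (Q.val z ^ 3 * z) - 4 * Q.val z ^ 4)
      + (6 * (z - Q.val z) ^ 2 - 4 * ((1 - Q.val z ^ 2) * (z - Q.val z) ^ 2)) ∂arcsine := by
    refine integral_mono_ae (bddMeas_pow_arcsine 4).integrable (by fun_prop) ?_
    filter_upwards [ae_arcsine_mem_Icc] with z hz
    have h1 := abs_le.1 (abs_val_le_one_of_centroid hc hz)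
    generalize Q.val z = a at *
    have hz2 : z ^ 2 ≤ 1 := by nlinarith [hz.1, hz.2]
    have h3 : 0 ≤ (z - a) ^ 2 * (1 - z ^ 2 + (1 + a ^ 2 - 2 * a * z)) := by
      refine mul_nonneg (sq_nonneg _) ?_
      nlinarith [sq_nonneg (a - z)]
    nlinarith
  have h4 : ∫ z, Q.val z ^ 3 * z ∂arcsine = ∫ z, Q.val z ^ 4 ∂arcsine := by
    rw [integral_comp_val_mul_id_of_centroid hc (φ := fun x => x ^ 3) (bQ.pow 3)]
    congr 1
  rw [integral_add (by fun_prop) (by fun_prop), integral_add (by fun_prop) (by fun_prop),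
    integral_sub (by fun_prop) (by fun_prop), integral_sub (by fun_prop) (by fun_prop),
    integral_const_mul, integral_const_mul, integral_const_mul, integral_const_mul, h4,
    arcsine_moment_four, ← distortion_eq] at hle
  linarith

/-- Here p = s, q = x and F ≤ x, so s + x > 1/2 suffices. As s = 1/2 - δ, this means x > δ, and the
fourth-moment bound gives x ≥ 1/8 - 5δ + 3δ². The quadratic 1/8 - 6δ + 3δ² stays positive up to δ ≈
0.02106, whence the threshold 0.021. -/
lemma moment_condition_of_centroid (hc : ∀ i, Q.cellMoment 1 i = Q.level i * Q.cellMoment 0 i)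
    (hδ : distortion Q < 0.021) {s : ℝ}
    (hs : ∫ z, Q.val z ^ 2 ∂arcsine = s) :
    s + (∫ z, (Q.val z ^ 2 - s) ^ 2 * Q.val z ^ 2 ∂arcsine) <
      2 * (s + ∫ z, (Q.val z ^ 2 - s) * (Q.val z * z) ∂arcsine) ^ 2 := by
  have bQ := Q.bddMeas_val
  have b2 := bQ.pow 2
  have bh : BddMeas (fun z => Q.val z ^ 2 - s) arcsine := b2.sub (.const s)
  have hδs := distortion_of_centroid hc
  rw [hs] at hδs
  set x := ∫ z, (Q.val z ^ 2 - s) ^ 2 ∂arcsine with hx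
  have i1 := (bQ.pow 4).integrable
  have i2 := b2.integrable
  have i3 := bh.integrable
  have i4 := (bh.pow 2).integrable
  have hx4 : x = ∫ z, Q.val z ^ 4 ∂arcsine - s ^ 2 := by
    have e : ∀ z, (Q.val z ^ 2 - s) ^ 2 = Q.val z ^ 4 - 2 * s * Q.val z ^ 2 + s ^ 2 := fun z => by
      ring
    rw [hx]
    simp_rw [e]
    rw [integral_add (by fun_prop) (by fun_prop), integral_sub (by fun_prop) (by fun_prop),
      integral_const_mul, hs]
    simp
    ring
  have hh0 : ∫ z, (Q.val z ^ 2 - s) ∂arcsine = 0 := by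
    rw [integral_sub i2 (integrable_const _), hs]; simp
  have hq : ∫ z, (Q.val z ^ 2 - s) * (Q.val z * z) ∂arcsine = x := by
    have h1 := integral_comp_val_mul_id_of_centroid hc (φ := fun y => (y ^ 2 - s) * y) (bh.mul bQ)
    simp_rw [← mul_assoc]
    rw [h1]
    have e : ∀ z, (Q.val z ^ 2 - s) * Q.val z * Q.val z =
        (Q.val z ^ 2 - s) ^ 2 + s * (Q.val z ^ 2 - s) := fun z => by ring
    simp_rw [e]
    rw [integral_add i4 (by fun_prop), integral_const_mul, hh0]
    simp [hx]
  have hF : ∫ z, (Q.val z ^ 2 - s) ^ 2 * Q.val z ^ 2 ∂arcsine ≤ x := by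
    refine integral_mono_ae ((bh.pow 2).mul b2).integrable i4 ?_
    filter_upwards [ae_arcsine_mem_Icc] with z hz
    have h1 := abs_val_le_one_of_centroid hc hz
    have h2 : Q.val z ^ 2 ≤ 1 := by rw [← sq_abs]; exact pow_le_one₀ (abs_nonneg _) h1
    exact mul_le_of_le_one_right (sq_nonneg _) h2
  have h4 := integral_val_pow_four_ge_of_centroid hc
  rw [hq]
  have hδ0 : 0 ≤ distortion Q := by
    rw [distortion_eq]; exact integral_nonneg fun z => sq_nonneg _
  have hs' : s = 1 / 2 - distortion Q := by linarith
  have hxδ : distortion Q < x := by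
    rw [hx4, hs']
    norm_num at hδ
    nlinarith [mul_pos (sub_pos.2 hδ) (by linarith : 0 < 1 - distortion Q)]
  nlinarith

end LMRFF

/-! ### Moment condition for LM²-RFF quantizers -/

section LMSq

variable {n : ℕ} {Q : Quantizer n}

lemma Quantizer.IsSymmetric.cellMoment_rev (hQ : Q.IsSymmetric) {k : ℕ} (hk : Even k) (i : Fin n) :
    Q.cellMoment k i.rev = Q.cellMoment k i := by
  unfold Quantizer.cellMoment
  rw [Q.setIntegral_cell (F := fun z => z ^ k) (measurable_id.pow_const k),
    Q.setIntegral_cell (F := fun z => z ^ k) (measurable_id.pow_const k), ← Fin.rev_castSucc,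
    ← Fin.rev_succ, hQ.1, hQ.1, Real.arccos_neg, Real.arccos_neg]
  congr 1
  have := intervalIntegral.integral_comp_sub_left (a := Real.arccos (Q.t i.succ))
    (b := Real.arccos (Q.t i.castSucc)) (fun θ => Real.cos θ ^ k) Real.pi
  simp only [Real.cos_pi_sub, hk.neg_pow] at this
  exact this.symm

lemma Quantizer.IsSymmetric.val_mul_nonneg (hQ : Q.IsSymmetric)
    (hpos : ∀ i : Fin n, n ≤ 2 * i.val → 0 ≤ Q.level i) (hn : Even n) {z : ℝ}
    (hz : z ∈ Set.Icc (-1 : ℝ) 1) : 0 ≤ Q.val z * z := by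
  obtain ⟨i, hi, hv⟩ := Q.exists_val_eq hz
  rw [hv]
  obtain ⟨k, rfl⟩ := hn
  have ht : ∀ i : Fin (k + k), k ≤ i.val → 0 ≤ Q.t i.castSucc := fun i h => by
    have h1 := hQ.1 i.castSucc
    have h2 : Q.t i.castSucc.rev ≤ Q.t i.castSucc := by
      apply Q.t_strictMono.monotone
      rw [Fin.le_def, Fin.val_rev, Fin.val_castSucc]
      omega
    linarith
  by_cases h : k ≤ i.val
  · refine mul_nonneg (hpos i (by omega)) ?_
    rcases hi.1 with h1 | h1
    · exact (ht i h).trans h1.le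
    · have := i.isLt
      omega
  · have hr : k ≤ i.rev.val := by rw [Fin.val_rev]; omega
    have h1 := hpos i.rev (by omega)
    rw [hQ.2] at h1
    have h2 := ht i.rev hr
    rw [← Fin.rev_succ, hQ.1] at h2
    have h3 := hi.2
    exact mul_nonneg_of_nonpos_of_nonpos (by linarith) (by linarith)

lemma centroidSq_of_minimal (hQ : Q.IsSymmetric) (hn : Even n)
    (hmin : ∀ Q' : Quantizer n, Q'.IsSymmetric → distortionSq Q ≤ distortionSq Q') (i : Fin n) :
    Q.cellMoment 2 i = Q.level i ^ 2 * Q.cellMoment 0 i := by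
  set c : Fin n → ℝ := fun i => Q.cellMoment 2 i / Q.cellMoment 0 i with hc
  have hc0 : ∀ i, 0 ≤ c i := fun i =>
    div_nonneg (integral_nonneg fun z => sq_nonneg _) (Q.cellMoment_zero_pos i).le
  -- The competitor's squared levels are the cell means of z². Signs are chosen by half, and the
  -- reflection invariance of these means makes it symmetric.
  set Q' : Quantizer n :=
    { Q with level := fun i => if n ≤ 2 * i.val then √(c i) else -√(c i) } with hQ'
  have hsym : Q'.IsSymmetric := by
    refine ⟨hQ.1, fun i => ?_⟩
    have hci : c i.rev = c i := by
      simp only [hc]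
      rw [hQ.cellMoment_rev even_two, hQ.cellMoment_rev Even.zero]
    obtain ⟨k, rfl⟩ := hn
    simp only [hQ', hci, Fin.val_rev]
    by_cases h : k + k ≤ 2 * i.val
    · rw [if_pos h, if_neg (by omega)]
    · rw [if_neg h, if_pos (by omega), neg_neg]
  have hle := hmin Q' hsym
  rw [distortionSq_eq, distortionSq_eq] at hle
  refine Quantizer.centroid_of_le (Q := Q) (Q' := Q') rfl 2 (ψ := fun x => x ^ 2)
    (continuous_pow 2) (fun i => ?_) hle i
  simp only [hQ']
  split_ifs
  · rw [Real.sq_sqrt (hc0 i)]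
  · rw [neg_sq, Real.sq_sqrt (hc0 i)]

lemma Quantizer.IsSymmetric.integral_val (hQ : Q.IsSymmetric) : ∫ z, Q.val z ∂arcsine = 0 := by
  have h : ∫ z, Q.val z ∂arcsine = ∑ i, Q.level i * Q.cellMoment 0 i := by
    rw [Q.integral_eq_sum_of_eq Q.bddMeas_val (G := fun i z => Q.level i * z ^ 0)
      (fun i z hz => by rw [Q.val_eq_of_mem hz]; simp)]
    exact Finset.sum_congr rfl fun i _ => integral_const_mul _ _
  have h2 : ∑ i, Q.level i * Q.cellMoment 0 i = ∑ i, -(Q.level i * Q.cellMoment 0 i) := by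
    rw [← Equiv.sum_comp Fin.revPerm]
    refine Finset.sum_congr rfl fun i _ => ?_
    rw [Fin.revPerm_apply, hQ.2, hQ.cellMoment_rev Even.zero]
    ring
  rw [Finset.sum_neg_distrib] at h2
  rw [h]
  linarith

lemma integral_val_sq_of_centroidSq (hc : ∀ i, Q.cellMoment 2 i = Q.level i ^ 2 * Q.cellMoment 0 i)
    : ∫ z, Q.val z ^ 2 ∂arcsine = 1 / 2 := by
  have := Q.integral_comp_val_mul_pow hc (φ := fun _ => 1) (.const 1) (ψ := fun x => x ^ 2)
    (Q.bddMeas_val.pow 2) (fun i => rfl)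
  simp only [one_mul] at this
  rw [← this, arcsine_moment_two]

lemma integral_val_sq_mul_sq_of_centroidSq (hc : ∀ i, Q.cellMoment 2 i = Q.level i ^ 2 * Q.cellMoment 0 i)
    :
    ∫ z, Q.val z ^ 2 * z ^ 2 ∂arcsine = ∫ z, Q.val z ^ 4 ∂arcsine := by
  have := Q.integral_comp_val_mul_pow hc (φ := fun x => x ^ 2) (Q.bddMeas_val.pow 2)
    (ψ := fun x => x ^ 2) (Q.bddMeas_val.pow 2) (fun i => rfl)
  rw [this]
  congr 1
  ext z
  ring

lemma distortionSq_of_centroidSq (hc : ∀ i, Q.cellMoment 2 i = Q.level i ^ 2 * Q.cellMoment 0 i)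
    : distortionSq Q = 3 / 8 - ∫ z, Q.val z ^ 4 ∂arcsine := by
  have bQ := Q.bddMeas_val
  have i1 := (bQ.pow 4).integrable
  have i2 := ((bQ.pow 2).mul (bddMeas_pow_arcsine 2)).integrable
  have i3 := (bddMeas_pow_arcsine 4).integrable
  have e : ∀ z, (z ^ 2 - Q.val z ^ 2) ^ 2 =
      z ^ 4 - 2 * (Q.val z ^ 2 * z ^ 2) + Q.val z ^ 4 := fun z => by ring
  rw [distortionSq_eq]
  simp_rw [e]
  rw [integral_add (by fun_prop) (by fun_prop), integral_sub (by fun_prop) (by fun_prop),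
    integral_const_mul, integral_val_sq_mul_sq_of_centroidSq hc, arcsine_moment_four]
  ring

lemma sq_val_le_one_of_centroidSq (hc : ∀ i, Q.cellMoment 2 i = Q.level i ^ 2 * Q.cellMoment 0 i)
    {z : ℝ} (hz : z ∈ Set.Icc (-1 : ℝ) 1) : Q.val z ^ 2 ≤ 1 := by
  obtain ⟨i, -, hi⟩ := Q.exists_val_eq hz
  rw [hi]
  have h1 := (le_abs_self _).trans (Q.abs_cellMoment_le 2 i)
  have h0 := Q.cellMoment_zero_pos i
  rw [hc] at h1
  exact le_of_mul_le_mul_right (by linarith) h0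

/-- Q² has mean 1/2, so E[Q⁴] ≥ 1/4 because the variance of Q² is nonnegative. -/
lemma distortionSq_le_of_centroidSq (hc : ∀ i, Q.cellMoment 2 i = Q.level i ^ 2 * Q.cellMoment 0 i)
    : distortionSq Q ≤ 1 / 8 := by
  rw [distortionSq_of_centroidSq hc]
  have bQ := Q.bddMeas_val
  have i1 := (bQ.pow 4).integrable
  have i2 := (bQ.pow 2).integrable
  have h : 0 ≤ ∫ z, (Q.val z ^ 4 - Q.val z ^ 2 + 1 / 4) ∂arcsine :=
    integral_nonneg fun z => by
      have : Q.val z ^ 4 - Q.val z ^ 2 + 1 / 4 = (Q.val z ^ 2 - 1 / 2) ^ 2 := by ring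
      rw [Pi.zero_apply, this]; positivity
  rw [integral_add (by fun_prop) (by fun_prop), integral_sub i1 i2,
    integral_val_sq_of_centroidSq hc] at h
  simp at h
  linarith

/-- When Q(z) and z have the same sign, |z - Q| ≤ |z + Q|, hence (z - Q)² ≤ |z² - Q²|. Integrating
and applying Cauchy-Schwarz gives 1 - 2p ≤ √D, where D is the distortion. -/
lemma integral_val_mul_id_ge_of_centroidSq (hsgn : ∀ z ∈ Set.Icc (-1 : ℝ) 1, 0 ≤ Q.val z * z)
    (hc : ∀ i, Q.cellMoment 2 i = Q.level i ^ 2 * Q.cellMoment 0 i) :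
    1 / 2 - √(distortionSq Q) / 2 ≤ ∫ z, Q.val z * z ∂arcsine := by
  have bQ := Q.bddMeas_val
  have bz := bddMeas_id_arcsine
  have i1 := (bQ.pow 2).integrable
  have i2 := (bQ.mul bz).integrable
  have i3 := (bz.pow 2).integrable
  have bD : BddMeas (fun z => |z ^ 2 - Q.val z ^ 2|) arcsine := ((bz.pow 2).sub (bQ.pow 2)).abs
  have h1 : ∫ z, (z ^ 2 - 2 * (Q.val z * z) + Q.val z ^ 2) ∂arcsine ≤
      ∫ z, |z ^ 2 - Q.val z ^ 2| ∂arcsine := by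
    refine integral_mono_ae (by fun_prop) bD.integrable ?_
    filter_upwards [ae_arcsine_mem_Icc] with z hz
    have h := hsgn z hz
    generalize Q.val z = a at *
    have e1 : z ^ 2 - 2 * (a * z) + a ^ 2 = |z - a| * |z - a| := by
      rw [abs_mul_abs_self]; ring
    have e2 : |z ^ 2 - a ^ 2| = |z - a| * |z + a| := by rw [← abs_mul]; ring_nf
    rw [e1, e2]
    refine mul_le_mul_of_nonneg_left ?_ (abs_nonneg _)
    exact sq_le_sq.1 (by nlinarith)
  have h2 : (∫ z, |z ^ 2 - Q.val z ^ 2| ∂arcsine) ≤ √(distortionSq Q) := by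
    apply Real.le_sqrt_of_sq_le
    have hv := variance_nonneg (fun z => |z ^ 2 - Q.val z ^ 2|) arcsine
    have hmem : MemLp (fun z => |z ^ 2 - Q.val z ^ 2|) 2 arcsine := by
      obtain ⟨hm, C, hC⟩ := bD
      exact MemLp.of_bound hm.aestronglyMeasurable C (by simpa using hC)
    rw [variance_eq_sub hmem] at hv
    rw [distortionSq_eq]
    simp only [Pi.pow_apply, sq_abs] at hv
    linarith
  rw [integral_add (by fun_prop) (by fun_prop), integral_sub (by fun_prop) (by fun_prop),
    integral_const_mul, arcsine_moment_two, integral_val_sq_of_centroidSq hc] at h1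
  linarith

lemma integral_val_mul_id_pos_of_centroidSq (hsgn : ∀ z ∈ Set.Icc (-1 : ℝ) 1, 0 ≤ Q.val z * z)
    (hc : ∀ i, Q.cellMoment 2 i = Q.level i ^ 2 * Q.cellMoment 0 i) : 0 < ∫ z, Q.val z * z ∂arcsine := by
  have h1 := integral_val_mul_id_ge_of_centroidSq hsgn hc
  have h2 : √(distortionSq Q) < 1 := by
    rw [Real.sqrt_lt' one_pos]
    linarith [distortionSq_le_of_centroidSq hc]
  linarith

/-- With y₄ = E[Q⁴] = 3/8 - D and J = E[Q³z], the condition follows from y₄ + 1/4 < 2(p/2 + J)².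
Lower bounds p ≥ 1/2 - √D/2 and J ≥ y₄ - D/2 turn it into an inequality in y₄ alone. -/
lemma moment_condition_of_centroidSq (hsgn : ∀ z ∈ Set.Icc (-1 : ℝ) 1, 0 ≤ Q.val z * z)
    (hc : ∀ i, Q.cellMoment 2 i = Q.level i ^ 2 * Q.cellMoment 0 i) (hD : distortionSq Q ≤ 0.0237) :
    1 / 2 + (∫ z, (Q.val z ^ 2 - 1 / 2) ^ 2 * Q.val z ^ 2 ∂arcsine) <
      2 * ((∫ z, Q.val z * z ∂arcsine) +
        ∫ z, (Q.val z ^ 2 - 1 / 2) * (Q.val z * z) ∂arcsine) ^ 2 := by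
  have bQ := Q.bddMeas_val
  have bz := bddMeas_id_arcsine
  have i4 := (bQ.pow 4).integrable
  have i2 := (bQ.pow 2).integrable
  have i1 := (bQ.mul bz).integrable
  have i3 := ((bQ.pow 3).mul bz).integrable
  have i22 := ((bQ.pow 2).mul (bz.pow 2)).integrable
  have hDe := distortionSq_of_centroidSq hc
  have hp := integral_val_mul_id_ge_of_centroidSq hsgn hc
  have hsq : √(distortionSq Q) ≤ 0.154 := by
    rw [Real.sqrt_le_left (by norm_num)]
    norm_num at hD ⊢
    linarith
  set y4 := ∫ z, Q.val z ^ 4 ∂arcsine with hy4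
  set p := ∫ z, Q.val z * z ∂arcsine with hpdef
  -- the weighted error is dominated by the squared error
  have h3 : 2 * y4 - 2 * ∫ z, Q.val z ^ 3 * z ∂arcsine ≤ distortionSq Q := by
    have h : ∫ z, (Q.val z ^ 2 * z ^ 2 - 2 * (Q.val z ^ 3 * z) + Q.val z ^ 4) ∂arcsine ≤
        ∫ z, (z ^ 2 - Q.val z ^ 2) ^ 2 ∂arcsine := by
      refine integral_mono_ae (by fun_prop) (((bz.pow 2).sub (bQ.pow 2)).pow 2).integrable ?_
      filter_upwards [ae_arcsine_mem_Icc] with z hz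
      have h := hsgn z hz
      generalize Q.val z = a at *
      -- This product is the difference (z² - a²)² - a²(z - a)².
      have : 0 ≤ (z - a) ^ 2 * (z ^ 2 + 2 * (a * z)) := by positivity
      nlinarith
    rw [← distortionSq_eq, integral_add (by fun_prop) (by fun_prop),
      integral_sub (by fun_prop) (by fun_prop), integral_const_mul,
      integral_val_sq_mul_sq_of_centroidSq hc, ← hy4] at h
    linarith
  have hq : ∫ z, (Q.val z ^ 2 - 1 / 2) * (Q.val z * z) ∂arcsine =
      (∫ z, Q.val z ^ 3 * z ∂arcsine) - p / 2 := by
    have e : ∀ z, (Q.val z ^ 2 - 1 / 2) * (Q.val z * z) =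
        Q.val z ^ 3 * z - 1 / 2 * (Q.val z * z) := fun z => by ring
    simp_rw [e]
    rw [integral_sub i3 (by fun_prop), integral_const_mul]
    ring
  have hF : ∫ z, (Q.val z ^ 2 - 1 / 2) ^ 2 * Q.val z ^ 2 ∂arcsine ≤ y4 - 1 / 4 := by
    have bh : BddMeas (fun z => Q.val z ^ 2 - 1 / 2) arcsine := (bQ.pow 2).sub (.const _)
    have h : ∫ z, (Q.val z ^ 2 - 1 / 2) ^ 2 * Q.val z ^ 2 ∂arcsine ≤
        ∫ z, (Q.val z ^ 4 - Q.val z ^ 2 + 1 / 4) ∂arcsine := by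
      refine integral_mono_ae ((bh.pow 2).mul (bQ.pow 2)).integrable (by fun_prop) ?_
      filter_upwards [ae_arcsine_mem_Icc] with z hz
      have h2 := sq_val_le_one_of_centroidSq hc hz
      calc (Q.val z ^ 2 - 1 / 2) ^ 2 * Q.val z ^ 2 ≤ (Q.val z ^ 2 - 1 / 2) ^ 2 :=
            mul_le_of_le_one_right (sq_nonneg _) h2
        _ = _ := by ring
    rw [integral_add (by fun_prop) (by fun_prop), integral_sub i4 i2,
      integral_val_sq_of_centroidSq hc] at h
    simp at h
    linarith
  rw [hq]
  set J := ∫ z, Q.val z ^ 3 * z ∂arcsine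
  -- From √D ≤ 0.154 one has p/2 ≥ 0.2115, and J ≥ (3/2)y₄ - 3/16. At y₄ = 0.3513, the least value
  -- allowed by D ≤ 0.0237, their sum is 0.55095, rounded down to 0.5509.
  have hlow : 0.551 - 0.0001 + 3 / 2 * (y4 - 0.3513) ≤ p + (J - p / 2) := by
    norm_num at hsq hD ⊢
    linarith
  have hy : 0.3513 ≤ y4 := by norm_num at hD ⊢; linarith
  norm_num at hlow hy ⊢
  nlinarith

end LMSq

/-! ### Four-cell competitors and distortion bounds -/

/-- A quantizer whose borders are interpolated by a strictly monotone function can be refined to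
any multiple of its number of cells without changing its values. -/
lemma Quantizer.exists_refinement {k N n : ℕ} (hN : 0 < N) (hn : n = N * k) (R : Quantizer k)
    {F : ℝ → ℝ} (hF : StrictMono F) (hRF : ∀ j : Fin (k + 1), R.t j = F j.val) :
    ∃ Q : Quantizer n, (∀ z ∈ Set.Icc (-1 : ℝ) 1, Q.val z = R.val z) ∧
      (R.IsSymmetric → (∀ x, F (k - x) = -F x) → Q.IsSymmetric) := by
  subst hn
  have hN' : (0 : ℝ) < N := by exact_mod_cast hN
  have hlt : ∀ i : Fin (N * k), i.val / N < k := fun i => Nat.div_lt_of_lt_mul i.isLt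
  -- Each cell of R is cut into N pieces by sampling F at multiples of 1/N, and every piece inherits
  -- the level of its parent cell, found by integer division.
  let Q : Quantizer (N * k) :=
    { t := fun i => F (i.val / N)
      level := fun i => R.level ⟨i.val / N, hlt i⟩
      t_strictMono := fun i j hij => hF (by
        have : (i.val : ℝ) < j.val := by exact_mod_cast hij
        gcongr)
      t_first := by
        have := hRF 0
        rw [R.t_first] at this
        simpa using this.symm
      t_last := by
        have := hRF (Fin.last k)
        rw [R.t_last] at this
        rw [this]
        congr 1
        simp
        field_simp }
  refine ⟨Q, fun z hz => ?_, fun hR hodd => ⟨fun i => ?_, fun i => ?_⟩⟩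
  · obtain ⟨i, hi, hv⟩ := Q.exists_val_eq hz
    rw [hv]
    refine (R.val_eq_of_mem (i := ⟨i.val / N, hlt i⟩) ⟨?_, ?_⟩).symm
    · refine hi.1.imp (fun h => ?_) (fun h => ⟨by simp [h.1], h.2⟩)
      refine lt_of_le_of_lt ?_ h
      rw [hRF]
      apply hF.monotone
      simpa using Nat.cast_div_le (α := ℝ) (m := i.val) (n := N)
    · refine hi.2.trans ?_
      rw [hRF]
      apply hF.monotone
      rw [div_le_iff₀ hN']
      have : i.val + 1 ≤ (i.val / N + 1) * N := by
        have := Nat.lt_div_mul_add (a := i.val) hN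
        rw [add_mul]
        omega
      simpa using (by exact_mod_cast this : ((i.val + 1 : ℕ) : ℝ) ≤ ((i.val / N + 1 : ℕ) : ℝ) * N)
  · change F _ = -F _
    rw [← hodd]
    congr 1
    have := i.isLt
    rw [Fin.val_rev, Nat.cast_sub (by omega)]
    push_cast
    field_simp
    ring
  · change R.level _ = -R.level _
    rw [← hR.2]
    congr 1
    ext
    have h1 : i.val < N * k := i.isLt
    simp only [Fin.val_rev]
    exact Nat.mul_sub_div _ _ _ h1

lemma Quantizer.sum_cellMoment {n : ℕ} (Q : Quantizer n) (k : ℕ) :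
    ∑ i, Q.cellMoment k i = ∫ z, z ^ k ∂arcsine :=
  (Q.integral_eq_sum_cell (bddMeas_pow_arcsine k)).symm

lemma Quantizer.cellMoment_two {n : ℕ} (Q : Quantizer n) (i : Fin n) :
    Q.cellMoment 2 i = Real.pi⁻¹ *
      ((Q.t i.castSucc * Real.sin (Real.arccos (Q.t i.castSucc))
        - Q.t i.succ * Real.sin (Real.arccos (Q.t i.succ))
        + Real.arccos (Q.t i.castSucc) - Real.arccos (Q.t i.succ)) / 2) := by
  have h1 := Q.t_mem_Icc i.succ
  have h2 := Q.t_mem_Icc i.castSucc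
  rw [cellMoment, Q.setIntegral_cell (F := fun z => z ^ 2) (measurable_id.pow_const 2)]
  rw [integral_cos_sq, Real.cos_arccos h1.1 h1.2, Real.cos_arccos h2.1 h2.2]

/-- The symmetric quantizer with four cells, inner border `T`, outer level `a`, inner level `c`. -/
noncomputable def fourCell (T : ℝ) (hT : T ∈ Set.Ico (1 / 2 : ℝ) 1) (a c : ℝ) : Quantizer 4 where
  t := ![-1, -T, 0, T, 1]
  level := ![-a, -c, c, a]
  t_strictMono := by
    have h1 := hT.1
    have h2 := hT.2
    rw [Fin.strictMono_iff_lt_succ]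
    intro i
    fin_cases i <;> simp <;> linarith
  t_first := rfl
  t_last := rfl

/-- An odd interpolation of the borders of `fourCell`, as a function of the offset from the
middle border. -/
noncomputable def borderInterp (T u : ℝ) : ℝ :=
  max (min (T * u) (2 * T - 1 + (1 - T) * u)) (1 - 2 * T + (1 - T) * u)

lemma borderInterp_strictMono {T : ℝ} (hT : T ∈ Set.Ico (1 / 2 : ℝ) 1) :
    StrictMono (borderInterp T) := by
  have h1 : 0 < T := by linarith [hT.1]
  have h2 : 0 < 1 - T := by linarith [hT.2]
  have ha : StrictMono fun u : ℝ => T * u := fun x y h => mul_lt_mul_of_pos_left h h1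
  have hb : ∀ c, StrictMono fun u : ℝ => c + (1 - T) * u := fun c x y h =>
    add_lt_add_right (mul_lt_mul_of_pos_left h h2) c
  exact fun x y h => max_lt_max (min_lt_min (ha h) (hb _ h)) (hb _ h)

lemma borderInterp_neg {T : ℝ} (hT : T ∈ Set.Ico (1 / 2 : ℝ) 1) (u : ℝ) :
    borderInterp T (-u) = -borderInterp T u := by
  have h1 := hT.1
  unfold borderInterp
  simp only [max_def, min_def]
  split_ifs <;> linarith

/-- The slope 1 - T of the outer pieces is at most the inner slope T because T ≥ 1/2, so the min and
max select the inner piece on [-1, 1] and the outer ones beyond. -/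
lemma fourCell_t {T : ℝ} (hT : T ∈ Set.Ico (1 / 2 : ℝ) 1) (a c : ℝ) (j : Fin 5) :
    (fourCell T hT a c).t j = borderInterp T (j.val - 2) := by
  have h1 := hT.1
  have h2 := hT.2
  unfold borderInterp fourCell
  fin_cases j <;> simp only [max_def, min_def] <;> split_ifs <;> simp at * <;> linarith

lemma fourCell_isSymmetric {T : ℝ} (hT : T ∈ Set.Ico (1 / 2 : ℝ) 1) (a c : ℝ) :
    (fourCell T hT a c).IsSymmetric := by
  constructor <;> intro i <;> fin_cases i <;> simp [fourCell, Fin.rev]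

/-- This makes a four-cell quantizer available as a competitor at every bit depth b ≥ 2. -/
lemma exists_fourCell_refinement {T : ℝ} (hT : T ∈ Set.Ico (1 / 2 : ℝ) 1) (a c : ℝ) {b : ℕ}
    (hb : 2 ≤ b) : ∃ Q : Quantizer (2 ^ b), Q.IsSymmetric ∧
      ∀ z ∈ Set.Icc (-1 : ℝ) 1, Q.val z = (fourCell T hT a c).val z := by
  have hpow : 2 ^ b = 2 ^ (b - 2) * 4 := by
    rw [show 4 = 2 ^ 2 from rfl, ← pow_add]
    congr 1
    omega
  obtain ⟨Q, hv, hs⟩ := (fourCell T hT a c).exists_refinement (Nat.two_pow_pos (b - 2)) hpow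
    (F := fun x => borderInterp T (x - 2))
    (fun x y h => borderInterp_strictMono hT (by linarith)) (fourCell_t hT a c)
  refine ⟨Q, hs (fourCell_isSymmetric hT a c) fun x => ?_, hv⟩
  rw [← borderInterp_neg hT]
  congr 1
  push_cast
  ring

lemma distortion_congr {m n : ℕ} {Q : Quantizer m} {R : Quantizer n}
    (h : ∀ z ∈ Set.Icc (-1 : ℝ) 1, Q.val z = R.val z) : distortion Q = distortion R :=
  setIntegral_congr_fun measurableSet_Icc fun z hz => by simp only [h z hz]

lemma distortionSq_congr {m n : ℕ} {Q : Quantizer m} {R : Quantizer n}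
    (h : ∀ z ∈ Set.Icc (-1 : ℝ) 1, Q.val z = R.val z) : distortionSq Q = distortionSq R :=
  setIntegral_congr_fun measurableSet_Icc fun z hz => by simp only [h z hz]

/-- The distortion in terms of the first two cell moments. -/
lemma distortion_eq_sum {n : ℕ} (Q : Quantizer n) : distortion Q = 1 / 2 +
    ∑ i, (Q.level i ^ 2 * Q.cellMoment 0 i - 2 * Q.level i * Q.cellMoment 1 i) := by
  have h := Q.integral_sq_sub_eq_sum 1 (ψ := fun x => x) Q.bddMeas_val
  simp only [pow_one] at h
  rw [distortion_eq, h, ← arcsine_moment_two, ← Q.sum_cellMoment, ← Finset.sum_add_distrib]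
  refine Finset.sum_congr rfl fun i _ => ?_
  ring

lemma distortionSq_eq_sum {n : ℕ} (Q : Quantizer n) : distortionSq Q = 3 / 8 +
    ∑ i, (Q.level i ^ 4 * Q.cellMoment 0 i - 2 * Q.level i ^ 2 * Q.cellMoment 2 i) := by
  have h := Q.integral_sq_sub_eq_sum 2 (ψ := fun x => x ^ 2) (Q.bddMeas_val.pow 2)
  rw [distortionSq_eq, h, ← arcsine_moment_four, ← Q.sum_cellMoment, ← Finset.sum_add_distrib]
  refine Finset.sum_congr rfl fun i _ => ?_
  ring

lemma distortion_fourCell {T : ℝ} (hT : T ∈ Set.Ico (1 / 2 : ℝ) 1) (a c : ℝ) :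
    distortion (fourCell T hT a c) = 1 / 2 - 4 * (a * √(1 - T ^ 2) + c * (1 - √(1 - T ^ 2))) / Real.pi
      + 2 * (a ^ 2 * (Real.arccos T / Real.pi) + c ^ 2 * (1 / 2 - Real.arccos T / Real.pi)) := by
  have := Real.pi_pos
  rw [distortion_eq_sum]
  simp only [Quantizer.cellMoment_zero, Quantizer.cellMoment_one, Real.sin_arccos]
  simp [Fin.sum_univ_four, fourCell, Real.arccos_neg]
  field_simp
  ring

lemma distortionSq_fourCell {T : ℝ} (hT : T ∈ Set.Ico (1 / 2 : ℝ) 1) (a c : ℝ) :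
    distortionSq (fourCell T hT a c) = 3 / 8
      - 2 * (a ^ 2 * (Real.arccos T + T * √(1 - T ^ 2)) +
        c ^ 2 * (Real.pi / 2 - Real.arccos T - T * √(1 - T ^ 2))) / Real.pi
      + 2 * (a ^ 4 * (Real.arccos T / Real.pi) + c ^ 4 * (1 / 2 - Real.arccos T / Real.pi)) := by
  have := Real.pi_pos
  rw [distortionSq_eq_sum]
  simp only [Quantizer.cellMoment_zero, Quantizer.cellMoment_two, Real.sin_arccos]
  simp [Fin.sum_univ_four, fourCell, Real.arccos_neg]
  field_simp
  ring

/-- The competitor has inner border at the angle 3π/10, where sine and cosine are algebraic, and its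
levels are the centroids of its cells. Its distortion is about 0.02094, just under the threshold. -/
lemma distortion_lt_of_isLMRFF {b : ℕ} (hb : 2 ≤ b) {Q : Quantizer (2 ^ b)} (hQ : IsLMRFF b Q) :
    distortion Q < 0.021 := by
  have hπ := Real.pi_pos
  have hπ4 := Real.pi_lt_d4
  -- the inner border is `cos (3π/10)`, and `sin (3π/10) = cos (π/5)`
  set S := Real.cos (Real.pi / 5) with hS
  have hSv : S = (1 + √5) / 4 := Real.cos_pi_div_five
  have h5 : √5 ^ 2 = 5 := Real.sq_sqrt (by norm_num)
  have h5a : 2.236 < √5 := Real.lt_sqrt_of_sq_lt (by norm_num)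
  have h5b : √5 < 2.2361 := by rw [Real.sqrt_lt' (by norm_num)]; norm_num
  set T := Real.cos (3 * Real.pi / 10) with hTd
  have hST : Real.sin (3 * Real.pi / 10) = S := by
    rw [hS, ← Real.sin_pi_div_two_sub]
    congr 1
    ring
  have hT0 : 0 < T := Real.cos_pos_of_mem_Ioo ⟨by linarith, by linarith⟩
  have hT2 : T ^ 2 = 1 - S ^ 2 := by rw [← hST, hTd, Real.cos_sq']
  have hT : T ∈ Set.Ico (1 / 2 : ℝ) 1 := by
    constructor <;> nlinarith
  have hsq : √(1 - T ^ 2) = S := by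
    rw [hT2, sub_sub_cancel, Real.sqrt_sq]
    rw [hSv]
    positivity
  have harc : Real.arccos T = 3 * Real.pi / 10 := Real.arccos_cos (by linarith) (by linarith)
  obtain ⟨R, -, hR⟩ := exists_fourCell_refinement hT (10 * S / (3 * Real.pi))
    (5 * (1 - S) / Real.pi) hb
  refine (hQ R).trans_lt ?_
  rw [distortion_congr hR, distortion_fourCell, harc, hsq]
  have e : 1 / 2 - 4 * (10 * S / (3 * Real.pi) * S + 5 * (1 - S) / Real.pi * (1 - S)) / Real.pi
      + 2 * ((10 * S / (3 * Real.pi)) ^ 2 * (3 * Real.pi / 10 / Real.pi) +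
        (5 * (1 - S) / Real.pi) ^ 2 * (1 / 2 - 3 * Real.pi / 10 / Real.pi)) =
      1 / 2 - (20 / 3 * S ^ 2 + 10 * (1 - S) ^ 2) / Real.pi ^ 2 := by
    field_simp
    ring
  rw [e]
  have h1 : 0.479 < (20 / 3 * S ^ 2 + 10 * (1 - S) ^ 2) / Real.pi ^ 2 := by
    rw [lt_div_iff₀ (by positivity), hSv]
    have h2 : Real.pi ^ 2 < 9.86966 := by norm_num at hπ4 ⊢; nlinarith
    have h3 : 20 / 3 * ((1 + √5) / 4) ^ 2 + 10 * (1 - (1 + √5) / 4) ^ 2 =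
        25 / 24 * √5 ^ 2 - 35 / 12 * √5 + 145 / 24 := by ring
    rw [h3, h5]
    norm_num at h2 h5b ⊢
    linarith
  norm_num at *
  linarith

/-- The border √2/2, at the angle π/4, gives four cells of equal mass; the squared levels 1/2 ± 1/π
are the cell means of z². The distortion is then 1/8 - 1/π² ≈ 0.02368. -/
lemma distortionSq_le_of_isLMSqRFF {b : ℕ} (hb : 2 ≤ b) {Q : Quantizer (2 ^ b)}
    (hQ : IsLMSqRFF b Q) : distortionSq Q ≤ 0.0237 := by
  have hπ := Real.pi_pos
  have hπ4 := Real.pi_lt_d4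
  have hπ3 := Real.pi_gt_three
  have h2 : √2 ^ 2 = 2 := Real.sq_sqrt (by norm_num)
  have hT : √2 / 2 ∈ Set.Ico (1 / 2 : ℝ) 1 := by
    have : 0 ≤ √2 := Real.sqrt_nonneg _
    constructor <;> nlinarith
  have hTT : √2 / 2 * √(1 - (√2 / 2) ^ 2) = 1 / 2 := by
    have : 1 - (√2 / 2) ^ 2 = (√2 / 2) ^ 2 := by rw [div_pow, h2]; norm_num
    rw [this, Real.sqrt_sq (by positivity), ← sq, div_pow, h2]
    norm_num
  have harc : Real.arccos (√2 / 2) = Real.pi / 4 := by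
    rw [← Real.cos_pi_div_four]
    exact Real.arccos_cos (by linarith) (by linarith)
  have hinv : 1 / Real.pi ≤ 1 / 2 := one_div_le_one_div_of_le (by norm_num) (by linarith)
  have hinv0 : 0 < 1 / Real.pi := by positivity
  obtain ⟨R, hsym, hR⟩ := exists_fourCell_refinement hT (√(1 / 2 + 1 / Real.pi))
    (√(1 / 2 - 1 / Real.pi)) hb
  refine (hQ.2.2 R hsym).trans ?_
  have h4 : ∀ x : ℝ, 0 ≤ x → √x ^ 4 = x ^ 2 := fun x hx => by
    rw [show 4 = 2 * 2 from rfl, pow_mul, Real.sq_sqrt hx]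
  rw [distortionSq_congr hR, distortionSq_fourCell, harc, hTT, Real.sq_sqrt (by linarith),
    Real.sq_sqrt (by linarith), h4 _ (by linarith), h4 _ (by linarith)]
  have e : 3 / 8 - 2 * ((1 / 2 + 1 / Real.pi) * (Real.pi / 4 + 1 / 2) +
        (1 / 2 - 1 / Real.pi) * (Real.pi / 2 - Real.pi / 4 - 1 / 2)) / Real.pi +
      2 * ((1 / 2 + 1 / Real.pi) ^ 2 * (Real.pi / 4 / Real.pi) +
        (1 / 2 - 1 / Real.pi) ^ 2 * (1 / 2 - Real.pi / 4 / Real.pi)) =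
      1 / 8 - 1 / Real.pi ^ 2 := by
    field_simp
    ring
  rw [e]
  have h1 : 0.1013 ≤ 1 / Real.pi ^ 2 := by
    rw [le_div_iff₀ (by positivity)]
    norm_num at *
    nlinarith
  norm_num at *
  linarith

/-! ### The one-bit case -/

/-- A quantizer with levels of constant absolute value has constant square. -/
lemma val_sq_eq_integral {n : ℕ} {Q : Quantizer n} {l : ℝ} (h : ∀ i, Q.level i ^ 2 = l) {z : ℝ}
    (hz : z ∈ Set.Icc (-1 : ℝ) 1) : Q.val z ^ 2 = ∫ x, Q.val x ^ 2 ∂arcsine := by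
  have hl : ∀ z ∈ Set.Icc (-1 : ℝ) 1, Q.val z ^ 2 = l := fun z hz => by
    obtain ⟨i, -, hi⟩ := Q.exists_val_eq hz
    rw [hi, h]
  rw [hl z hz, integral_congr_ae (g := fun _ => l)]
  · simp
  · filter_upwards [ae_arcsine_mem_Icc] with x hx using hl x hx

/-- The one-bit sign quantizer with level `2 / π`. -/
noncomputable def signQuantizer : Quantizer 2 where
  t := ![-1, 0, 1]
  level := ![-(2 / Real.pi), 2 / Real.pi]
  t_strictMono := by
    rw [Fin.strictMono_iff_lt_succ]
    intro i
    fin_cases i <;> simp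
  t_first := rfl
  t_last := rfl

lemma distortion_signQuantizer : distortion signQuantizer = 1 / 2 - 4 / Real.pi ^ 2 := by
  have := Real.pi_pos
  rw [distortion_eq_sum]
  simp only [Quantizer.cellMoment_zero, Quantizer.cellMoment_one, Real.sin_arccos]
  simp [signQuantizer]
  field_simp
  ring

/-- With y = |π/2 - φ| this is Jordan's inequality sin y > 2y/π, squared, because φ(π - φ) = π²/4 -
y². -/
lemma sin_sq_lt_of_ne_pi_div_two {φ : ℝ} (h0 : 0 < φ) (h1 : φ < Real.pi) (hne : φ ≠ Real.pi / 2) :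
    Real.sin φ ^ 2 < 4 / Real.pi ^ 2 * (φ * (Real.pi - φ)) := by
  have hπ := Real.pi_pos
  have key : ∀ y, 0 < y → y < Real.pi / 2 →
      Real.cos y ^ 2 < 4 / Real.pi ^ 2 * (Real.pi ^ 2 / 4 - y ^ 2) := fun y hy hy' => by
    have h := Real.mul_lt_sin hy hy'
    have h2 : (2 / Real.pi * y) ^ 2 < Real.sin y ^ 2 := by gcongr
    rw [Real.cos_sq']
    have e : 4 / Real.pi ^ 2 * (Real.pi ^ 2 / 4 - y ^ 2) = 1 - (2 / Real.pi * y) ^ 2 := by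
      field_simp
      ring
    linarith
  rcases lt_or_gt_of_ne hne with h | h
  · have := key (Real.pi / 2 - φ) (by linarith) (by linarith)
    rw [Real.cos_pi_div_two_sub] at this
    convert this using 2
    ring
  · have := key (φ - Real.pi / 2) (by linarith) (by linarith)
    rw [Real.cos_sub_pi_div_two] at this
    convert this using 2
    ring

/-- Let φ be the angle of the inner border. With centroid levels the distortion is 1/2 - sin²φ /
(φ(π - φ)), which exceeds that of the sign quantizer unless φ = π/2. Symmetry of a one-bit LM-RFF
minimizer is thus derived, not assumed. -/
lemma level_sq_eq_of_minimal_two {Q : Quantizer 2}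
    (hQ : ∀ Q' : Quantizer 2, distortion Q ≤ distortion Q') (i : Fin 2) :
    Q.level i ^ 2 = 4 / Real.pi ^ 2 := by
  have hπ := Real.pi_pos
  have hc := centroid_of_minimal hQ
  have hle := hQ signQuantizer
  rw [distortion_signQuantizer, distortion_eq_sum] at hle
  simp only [mul_assoc, hc, Fin.sum_univ_two] at hle
  have h0 := hc 0
  have h1 := hc 1
  have hlt0 := Q.t_strictMono (show (0 : Fin 3) < 1 by decide)
  have hlt1 := Q.t_strictMono (show (1 : Fin 3) < 2 by decide)
  have e0 := Q.t_first
  have e2 : Q.t 2 = 1 := Q.t_last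
  rw [e0] at hlt0
  rw [e2] at hlt1
  simp only [Quantizer.cellMoment_zero, Quantizer.cellMoment_one, Fin.castSucc_zero,
    Fin.succ_zero_eq_one, Fin.castSucc_one, Fin.succ_one_eq_two, e0, e2, Real.arccos_one,
    Real.arccos_neg_one, Real.sin_pi, Real.sin_zero, zero_sub, sub_zero] at hle h0 h1
  set φ := Real.arccos (Q.t 1) with hφ
  have hφ0 : 0 < φ := Real.arccos_pos.2 hlt1
  have hφ1 : φ < Real.pi := by
    rw [hφ, ← Real.arccos_neg_one]
    exact Real.strictAntiOn_arccos ⟨le_rfl, by norm_num⟩ ⟨hlt0.le, hlt1.le⟩ hlt0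
  have hψ : 0 < Real.pi - φ := by linarith
  have l0 : Q.level 0 = -Real.sin φ / (Real.pi - φ) := by
    field_simp at h0 ⊢
    linarith
  have l1 : Q.level 1 = Real.sin φ / φ := by
    field_simp at h1 ⊢
    linarith
  have hφ2 : φ = Real.pi / 2 := by
    by_contra hne
    have h := sin_sq_lt_of_ne_pi_div_two hφ0 hφ1 hne
    have e : (1 / 2 : ℝ) - Real.sin φ ^ 2 / (φ * (Real.pi - φ)) ≤ 1 / 2 - 4 / Real.pi ^ 2 := by
      refine le_trans (le_of_eq ?_) hle
      rw [l0, l1]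
      field_simp
      ring
    have h' : Real.sin φ ^ 2 / (φ * (Real.pi - φ)) < 4 / Real.pi ^ 2 := by
      rwa [div_lt_iff₀ (by positivity)]
    linarith
  rw [hφ2, Real.sin_pi_div_two] at l0 l1
  fin_cases i
  · simp only [Fin.zero_eta, l0]
    field_simp
    ring
  · simp only [Fin.mk_one, l1]
    field_simp
    ring

/-! ### Conclusion for both kinds of quantizer -/

/-- The moment conditions under which normalization does not increase the debiased variance. -/
lemma moment_conditions_of_isLMType {b : ℕ} (hb : 1 ≤ b) {Q : Quantizer (2 ^ b)}
    (hQ : IsLMType b Q) :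
    (∫ z, Q.val z ∂arcsine = 0) ∧ 0 < (∫ z, Q.val z * z ∂arcsine) ∧
      ((∀ z ∈ Set.Icc (-1 : ℝ) 1, Q.val z ^ 2 = ∫ x, Q.val x ^ 2 ∂arcsine) ∨
        (∫ z, Q.val z ^ 2 ∂arcsine) +
            (∫ z, (Q.val z ^ 2 - ∫ x, Q.val x ^ 2 ∂arcsine) ^ 2 * Q.val z ^ 2 ∂arcsine) <
          2 * ((∫ z, Q.val z * z ∂arcsine) +
            ∫ z, (Q.val z ^ 2 - ∫ x, Q.val x ^ 2 ∂arcsine) * (Q.val z * z) ∂arcsine) ^ 2) := by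
  have hπ := Real.pi_pos
  rcases hQ with hQ | hQ
  · have hc := centroid_of_minimal hQ
    have hp := integral_val_mul_id_of_centroid hc
    refine ⟨integral_val_of_centroid hc, ?_, ?_⟩
    · rw [hp]
      rcases hb.eq_or_lt with rfl | hb2
      · have h0 : (0 : ℝ) ∈ Set.Icc (-1 : ℝ) 1 := by norm_num
        rw [← val_sq_eq_integral (level_sq_eq_of_minimal_two hQ) h0]
        obtain ⟨i, -, hi⟩ := Q.exists_val_eq h0
        rw [hi, level_sq_eq_of_minimal_two hQ]
        positivity
      · have h1 := distortion_of_centroid hc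
        have h2 := distortion_lt_of_isLMRFF hb2 hQ
        norm_num at h2
        linarith
    · rcases hb.eq_or_lt with rfl | hb2
      · left
        exact fun z hz => val_sq_eq_integral (level_sq_eq_of_minimal_two hQ) hz
      · right
        rw [hp]
        exact moment_condition_of_centroid hc (distortion_lt_of_isLMRFF hb2 hQ) rfl
  · have hn : Even (2 ^ b) := (Nat.even_pow.2 ⟨even_two, by omega⟩)
    have hc := centroidSq_of_minimal hQ.1 hn hQ.2.2
    have hsgn : ∀ z ∈ Set.Icc (-1 : ℝ) 1, 0 ≤ Q.val z * z := fun z hz =>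
      hQ.1.val_mul_nonneg hQ.2.1 hn hz
    refine ⟨hQ.1.integral_val, integral_val_mul_id_pos_of_centroidSq hsgn hc, ?_⟩
    rcases hb.eq_or_lt with rfl | hb2
    · left
      refine fun z hz => val_sq_eq_integral (l := Q.level 0 ^ 2) (fun i => ?_) hz
      have h := hQ.1.2 0
      fin_cases i
      · rfl
      · change Q.level 1 = -Q.level 0 at h
        change Q.level 1 ^ 2 = Q.level 0 ^ 2
        rw [h, neg_sq]
    · right
      rw [integral_val_sq_of_centroidSq hc]
      exact moment_condition_of_centroidSq hsgn hc (distortionSq_le_of_isLMSqRFF hb2 hQ)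

end RFF

theorem theorem6 {Ω : Type*} [MeasurableSpace Ω] (P : Measure Ω) [IsProbabilityMeasure P]
    {d : ℕ} (w : ℕ → Ω → EuclideanSpace ℝ (Fin d)) (τ : ℕ → Ω → ℝ)
    (hsample : RFF.IsSample P w τ)
    (b : ℕ) (hb : 1 ≤ b) (Q : RFF.Quantizer (2 ^ b)) (hQ : RFF.IsLMType b Q)
    (γ : ℝ) (hγ_pos : 0 < γ) (hγ : γ ≤ Real.pi / Real.sqrt 2)
    (u v : EuclideanSpace ℝ (Fin d)) (hu : ‖u‖ = 1) (hv : ‖v‖ = 1)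
    (hρ : inner ℝ u v ∈ Set.Icc (0 : ℝ) 1) :
    -- both debiased variances are well defined for large `m`
    (∀ᶠ m : ℕ in atTop,
      0 < (∫ ω, RFF.simpleEst γ w τ Q u v m ω ∂P) ∧
      0 < (∫ ω, RFF.normEst γ w τ Q u v m ω ∂P)) ∧
    -- they compare for all large `m`
    (∀ᶠ m : ℕ in atTop,
      RFF.dbVariance P (RFF.normEst γ w τ Q u v m) (RFF.kernel γ u v) ≤
        RFF.dbVariance P (RFF.simpleEst γ w τ Q u v m) (RFF.kernel γ u v)) ∧
    -- and so do their leading coefficients in `1 / m`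
    (∃ Vn Vs : ℝ,
      Tendsto (fun m : ℕ =>
        (m : ℝ) * RFF.dbVariance P (RFF.normEst γ w τ Q u v m) (RFF.kernel γ u v))
        atTop (𝓝 Vn) ∧
      Tendsto (fun m : ℕ =>
        (m : ℝ) * RFF.dbVariance P (RFF.simpleEst γ w τ Q u v m) (RFF.kernel γ u v))
        atTop (𝓝 Vs) ∧
      Vn ≤ Vs) := by
  obtain ⟨h0, hp, hcase⟩ := RFF.moment_conditions_of_isLMType hb hQ
  exact RFF.estimator_comparison hsample Q γ u v h0 rfl rfl hp hcase
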